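/- **Setting.** Let $d\ge 2$. The core tensor $C\in\mathbb R^{d\times d\times d}$ has entries $C_{ijk}=1$ if $i=j=k$, $C_{ijk}=3$ if $i<j=k$ or $i=j<k$, $C_{ijk}=6$ if $i<j<k$, and $C_{ijk}=0$ otherwise. It is the third level signature $\sigma(\psi)$ of the axis path $\psi:[0,1]\to\mathbb R^d$, the piecewise linear path through the points $\sqrt[3]{6}\,(e_1+\dots+e_m)$ at the times $m/d$ ($0\le m\le d$), where $\sigma(X)_{ijk}=\int_0^1\int_0^{t_3}\int_0^{t_2}\dot X_i(t_1)\dot X_j(t_2)\dot X_k(t_3)\,dt_1dt_2dt_3$. A matrix acts on tensors by $(A*T)_{ijk}=\sum_{\alpha,\beta,\gamma}T_{\alpha\beta\gamma}A_{i\alpha}A_{j\beta}A_{k\gamma}$. For $1\le s<d$ and $x,y\in\mathbb R^{d-s}$ let $U^{(s,x)}=I_d+\sum_{\gamma>s}x_{\gamma-s}E_{s\gamma}$ and $L^{(s,y)}=I_d+\sum_{\gamma>s}y_{\gamma-s}E_{\gamma s}$; let $D^{(s,h)}$ be $I_d$ with the entry at $(s,s)$ replaced by the real cube root of $h$ ($1\le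 s\le d$), and $P^{(s,t)}$ the permutation matrix of the transposition $(s\,t)$. **Algorithm.** Input: $G\in \mathrm{GL}_d*C$. Set $Q=I_d$. For $s=1,\dots,d-1$ do the following. 1. Compute $Q_{\rm up}=\mathsf{up}(G)$: * *If $s\le d-3$:* for $s<a,b,\gamma\le d$ put $M_{(a,b),\gamma}=G_{ab\gamma}-G_{ba\gamma}$ and $B_{(a,b)}=G_{bas}-G_{abs}$. If $\operatorname{rank}M=\operatorname{rank}(M\mid B)=d-s$, let $x$ be the solution of $Mx=B$ and $\mathsf{up}(G)=U^{(s,x)}$. Otherwise draw a random $W\in I_{s-1}\oplus \mathrm{GL}_{d-s+1}$ and let $\mathsf{up}(G)=\mathsf{up}(W*G)\,W$, recursively. * *If $s=d-2$:* with $(a,b,c)=(d-2,d-1,d)$ and $G'=G$, test $G'_{bcc}\ne G'_{cbc}$; put $Q_1=I_d+\frac{G'_{cbb}-G'_{bcb}}{G'_{bcc}-G'_{cbc}}E_{bc}$ and replace $G'$ by $Q_1*G'$; put $Q_2=I_d+\frac{G'_{cba}-G'_{bca}}{G'_{bcc}-G'_{cbc}}E_{ac}$ and replace $G'$ by $Q_2*G'$;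 test $G'_{abb}\neq G'_{bab}$; put $Q_3=I_d+\frac{G'_{baa}-G'_{aba}}{G'_{abb}-G'_{bab}}E_{ab}$ and replace $G'$ by $Q_3*G'$; test $G'_{aaa}\ne0$. If all tests succeed, $\mathsf{up}(G)=Q_3Q_2Q_1$. Otherwise draw a random $W\in I_{d-3}\oplus \mathrm{GL}_3$ and let $\mathsf{up}(G)=\mathsf{up}(W*G)\,W$, recursively. * *If $s=d-1$:* $\mathsf{up}(G)=I_d+\frac{G_{d,d-1,d-1}-G_{d-1,d,d-1}}{G_{d-1,d,d}-G_{d,d-1,d}}E_{d-1,d}$ if $G_{d-1,d,d}\ne G_{d,d-1,d}$, and $\mathsf{up}(G)=P^{(d-1,d)}$ otherwise. 2. Put $H=Q_{\rm up}*G$, $y=-H_{sss}^{-1}(H_{s,s+1,s},\dots,H_{s,d,s})$ and $Q_{\rm dlow}=D^{(s,H_{sss}^{-1})}L^{(s,y)}$. Replace $G$ by $Q_{\rm dlow}*H$ and $Q$ by $Q_{\rm dlow}Q_{\rm up}Q$. After the loop return $A=Q^{-1}D^{(d,G_{ddd})}$. **Model of computation.** Exact real arithmetic; constants, $+,-,\times,\div$,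 real cube roots, tests for zero, and draws of a random number count as one elementary operation each. Random numbers are independent with a fixed law $\nu$, an arbitrary probability measure on $\mathbb R$ without atoms. A random element of $\mathrm{GL}_m$ is a matrix with random entries, redrawn while it is singular. Congruences are computed one mode after the other, skipping zero entries of the matrix. Inverses are computed, and linear systems are tested and solved, by Gaussian elimination; for $Mx=B$ it is applied first to the $2(d-s)$ random combinations $\sum_a v_a\,[M\mid B]_{(a,b)}$ and $\sum_a v'_a\,[M\mid B]_{(a,b)}$ ($s<b\le d$) with random vectors $v,v'$. If these have a unique solution, it is tested in all equations of $Mx=B$ (if it fails there, the rank condition is violated); if not, elimination is applied to all equations. **Theorem 1.1.** For every $d\ge2$, every $\nu$ and every $G\in\mathrm{GL}_d*C$, the algorithm halts with probability one, and every run that halts returns the unique $A\in \mathrm{GL}_d$ with $G=A*C$. In particular it recovers the piecewise linear path $t\mapsto A\psi(t)$, whose third level signature is $G$. There is an absolute constant $K$ (independent of $d$, $\nu$ and $G$) such that the expected number of elementary operations is at most $Kd^4$. -/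

import Mathlib

open MeasureTheory Filter
open scoped ENNReal NNReal Topology

namespace SigLearn

/-! ## Tensors, congruence, signatures -/

/-- `d × d × d` tensors with entries in `R`. -/
abbrev Tensor (d : ℕ) (R : Type) : Type := Fin d → Fin d → Fin d → R

/-- Matrix-tensor congruence `A * T`. -/
def congruence {d : ℕ} (A : Matrix (Fin d) (Fin d) ℝ) (T : Tensor d ℝ) : Tensor d ℝ :=
  fun i j k => ∑ a, ∑ b, ∑ c, T a b c * A i a * A j b * A k c

/-- The core tensor `C`. -/
def coreTensor (d : ℕ) : Tensor d ℝ := fun i j k =>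
  if i = j ∧ j = k then 1
  else if (i < j ∧ j = k) ∨ (i = j ∧ j < k) then 3
  else if i < j ∧ j < k then 6
  else 0

/-- The orbit `GL_d * C`. -/
def coreOrbit (d : ℕ) : Set (Tensor d ℝ) :=
  {G | ∃ A : GL (Fin d) ℝ, G = congruence (A : Matrix (Fin d) (Fin d) ℝ) (coreTensor d)}

/-- The third level iterated-integrals signature of a (piecewise smooth) path on `[0,1]`. -/
noncomputable def signature {d : ℕ} (X : ℝ → Fin d → ℝ) : Tensor d ℝ := fun i j k =>
  ∫ t₃ in (0 : ℝ)..1, ∫ t₂ in (0 : ℝ)..t₃, ∫ t₁ in (0 : ℝ)..t₂,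
    deriv (fun t => X t i) t₁ * deriv (fun t => X t j) t₂ * deriv (fun t => X t k) t₃

/-- The axis path: the piecewise linear path through the points `6^(1/3) (e_1 + ... + e_m)` at the
times `m / d`, for `m = 0, ..., d`. Its coordinate `i` (counted from `0`) grows linearly from `0` to
`6^(1/3)` on `[i / d, (i + 1) / d]` and is constant elsewhere. -/
noncomputable def axisPath (d : ℕ) : ℝ → Fin d → ℝ := fun t i =>
  (6 : ℝ) ^ (1 / 3 : ℝ) * max 0 (min 1 ((d : ℝ) * t - (i : ℝ)))

/-- The real cube root. -/
noncomputable def realCbrt (x : ℝ) : ℝ :=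
  if 0 ≤ x then x ^ (1 / 3 : ℝ) else -((-x) ^ (1 / 3 : ℝ))

/-! ## The model of computation

Randomized algebraic computation over a type `R` of numbers. A program that is written for an
arbitrary type `R` can access numbers only through the instructions below, so every operation on
numbers is visible in the tree. -/

inductive Arith where
  | add
  | sub
  | mul
  | div

/-- Programs (computation trees) over numbers of type `R` with result type `α`. `abort` marks a
computation that is cut off before it is finished. -/
inductive Prog (R : Type) (α : Type) : Type where
  | ret (a : α)
  | const (q : ℚ) (k : R → Prog R α)
  | arith (o : Arith) (x y : R) (k : R → Prog R α)
  | cbrt (x : R) (k : R → Prog R α)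
  | isZero (x : R) (k : Bool → Prog R α)
  | rand (k : R → Prog R α)
  | abort

namespace Prog

def bind {R α β : Type} : Prog R α → (α → Prog R β) → Prog R β
  | .ret a, f => f a
  | .const q k, f => .const q (fun r => (k r).bind f)
  | .arith o x y k, f => .arith o x y (fun r => (k r).bind f)
  | .cbrt x k, f => .cbrt x (fun r => (k r).bind f)
  | .isZero x k, f => .isZero x (fun b => (k b).bind f)
  | .rand k, f => .rand (fun r => (k r).bind f)
  | .abort, _ => .abort

instance {R : Type} : Monad (Prog R) where
  pure := Prog.ret
  bind := Prog.bind

end Prog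

/-! ### Execution over the real numbers -/

noncomputable def Arith.eval : Arith → ℝ → ℝ → ℝ
  | .add, x, y => x + y
  | .sub, x, y => x - y
  | .mul, x, y => x * y
  | .div, x, y => x / y

open Classical in
/-- Every finished run, whatever the random numbers are, has a result that satisfies `P`. -/
noncomputable def Prog.Always {α : Type} (P : α → Prop) : Prog ℝ α → Prop
  | .ret a => P a
  | .const q k => (k (q : ℝ)).Always P
  | .arith o x y k => (k (o.eval x y)).Always P
  | .cbrt x k => (k (realCbrt x)).Always P
  | .isZero x k => (k (decide (x = 0))).Always P
  | .rand k => ∀ x : ℝ, (k x).Always P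
  | .abort => True

open Classical in
/-- The probability that a run is finished (and not cut off), when the random numbers are
independent with law `ν`. -/
noncomputable def Prog.haltProb {α : Type} (ν : Measure ℝ) : Prog ℝ α → ℝ≥0∞
  | .ret _ => 1
  | .const q k => (k (q : ℝ)).haltProb ν
  | .arith o x y k => (k (o.eval x y)).haltProb ν
  | .cbrt x k => (k (realCbrt x)).haltProb ν
  | .isZero x k => (k (decide (x = 0))).haltProb ν
  | .rand k => ∫⁻ x, (k x).haltProb ν ∂ν
  | .abort => 0

open Classical in
/-- The expected number of elementary operations, when the random numbers are independent with law
`ν`: every constant, sum, difference, product, quotient, cube root, zero test and random number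
counts as one operation. -/
noncomputable def Prog.expectedCost {α : Type} (ν : Measure ℝ) : Prog ℝ α → ℝ≥0∞
  | .ret _ => 0
  | .const q k => 1 + (k (q : ℝ)).expectedCost ν
  | .arith o x y k => 1 + (k (o.eval x y)).expectedCost ν
  | .cbrt x k => 1 + (k (realCbrt x)).expectedCost ν
  | .isZero x k => 1 + (k (decide (x = 0))).expectedCost ν
  | .rand k => 1 + ∫⁻ x, (k x).expectedCost ν ∂ν
  | .abort => 0

/-! ## Subroutines -/

section Subroutines

variable {R : Type}

def const (q : ℚ) : Prog R R := .const q .ret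
def add (x y : R) : Prog R R := .arith .add x y .ret
def sub (x y : R) : Prog R R := .arith .sub x y .ret
def mul (x y : R) : Prog R R := .arith .mul x y .ret
def div (x y : R) : Prog R R := .arith .div x y .ret
def cbrt (x : R) : Prog R R := .cbrt x .ret
def isZero (x : R) : Prog R Bool := .isZero x .ret
def rand : Prog R R := .rand .ret

/-- Compute the `n` entries of a vector. -/
def tabulate {α : Type} : (n : ℕ) → (Fin n → Prog R α) → Prog R (Fin n → α)
  | 0, _ => pure Fin.elim0
  | n + 1, f => do
      let a ← f 0
      let v ← tabulate n (fun i => f i.succ)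
      pure (Fin.cons a v)

def forEach {α β : Type} (f : α → Prog R β) : List α → Prog R (List β)
  | [] => pure []
  | a :: l => do
      let b ← f a
      let bs ← forEach f l
      pure (b :: bs)

/-- The sum of `f i` over a list of indices. -/
def sumOver {ι : Type} (f : ι → Prog R R) : List ι → Prog R R
  | [] => const 0
  | i :: l => do
      let a ← f i
      let b ← sumOver f l
      add a b

/-- The sublist of the indices at which the vector `v` does not vanish. -/
def nonzeros {ι : Type} (v : ι → R) : List ι → Prog R (List ι)
  | [] => pure []
  | i :: l => do
      let z ← isZero (v i)
      let s ← nonzeros v l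
      pure (if z then s else i :: s)

def allZero : List R → Prog R Bool
  | [] => pure true
  | x :: l => do
      let z ← isZero x
      if z then allZero l else pure false

/-- The product of two matrices. -/
def matMul {d : ℕ} (A B : Fin d → Fin d → R) : Prog R (Fin d → Fin d → R) :=
  tabulate d fun i => tabulate d fun j =>
    sumOver (fun k => mul (A i k) (B k j)) (List.finRange d)

/-- The congruence `A * T`, one mode after the other; zero entries of `A` are skipped. -/
def applyCongruence {d : ℕ} (A : Fin d → Fin d → R) (T : Tensor d R) : Prog R (Tensor d R) := do
  let supp ← tabulate d fun i => nonzeros (A i) (List.finRange d)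
  let T₁ ← tabulate d fun i => tabulate d fun j => tabulate d fun k =>
    sumOver (fun a => mul (A i a) (T a j k)) (supp i)
  let T₂ ← tabulate d fun i => tabulate d fun j => tabulate d fun k =>
    sumOver (fun b => mul (A j b) (T₁ i b k)) (supp j)
  tabulate d fun i => tabulate d fun j => tabulate d fun k =>
    sumOver (fun c => mul (A k c) (T₂ i j c)) (supp k)

/-- Remove the first row with nonzero leading coefficient from a list of equations. -/
def findPivot {n q : ℕ} : List ((Fin (n + 1) → R) × (Fin q → R)) →
    Prog R (Option (((Fin (n + 1) → R) × (Fin q → R)) × List ((Fin (n + 1) → R) × (Fin q → R))))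
  | [] => pure none
  | r :: rs => do
      let z ← isZero (r.1 0)
      if z then
        let p ← findPivot rs
        match p with
        | none => pure none
        | some (piv, rest) => pure (some (piv, r :: rest))
      else pure (some (r, rs))

/-- Gaussian elimination for a list of equations `∑ j, r.1 j * x j = r.2` in `n` unknowns, with `q`
right-hand sides. The result is the unique solution if the coefficient matrix and the augmented
matrix both have rank `n`, and `none` otherwise. -/
def gauss {q : ℕ} : (n : ℕ) → List ((Fin n → R) × (Fin q → R)) →
    Prog R (Option (Fin n → Fin q → R))
  | 0, rows => do
      let ok ← allZero (rows.flatMap fun r => List.ofFn r.2)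
      pure (if ok then some Fin.elim0 else none)
  | n + 1, rows => do
      let p ← findPivot rows
      match p with
      | none => pure none
      | some (piv, rest) =>
        let u ← tabulate n fun j => div (piv.1 j.succ) (piv.1 0)
        let w ← tabulate q fun l => div (piv.2 l) (piv.1 0)
        let rest' ← forEach (fun r => do
          let u' ← tabulate n fun j => do
            let t ← mul (r.1 0) (u j)
            sub (r.1 j.succ) t
          let w' ← tabulate q fun l => do
            let t ← mul (r.1 0) (w l)
            sub (r.2 l) t
          pure (u', w')) rest
        let sol ← gauss n rest'
        match sol with
        | none => pure none
        | some x => do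
            let x₀ ← tabulate q fun l => do
              let t ← sumOver (fun j => mul (u j) (x j l)) (List.finRange n)
              sub (w l) t
            pure (some (Fin.cons x₀ x))

/-- All pairs of indices. -/
def pairs (n : ℕ) : List (Fin n × Fin n) :=
  (List.finRange n).flatMap fun a => (List.finRange n).map fun b => (a, b)

/-- Solve the `n * n` equations `∑ c, M a b c * x c = B a b` in `n` unknowns. The result is the
unique solution if `rank M = rank (M | B) = n`, and `none` otherwise, whatever the random numbers
are. To save operations, elimination is first applied to `2 * n` random combinations of the
equations, and the solution, if it is unique, is tested in all equations; only if these
combinations have no unique solution, elimination is applied to all equations. -/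
def solveSystem {n : ℕ} (M : Fin n → Fin n → Fin n → R) (B : Fin n → Fin n → R) :
    Prog R (Option (Fin n → R)) := do
  let v ← tabulate n fun _ => rand
  let v' ← tabulate n fun _ => rand
  let combine (u : Fin n → R) (b : Fin n) : Prog R ((Fin n → R) × (Fin 1 → R)) := do
    let m ← tabulate n fun c => sumOver (fun a => mul (u a) (M a b c)) (List.finRange n)
    let r ← sumOver (fun a => mul (u a) (B a b)) (List.finRange n)
    pure (m, fun _ => r)
  let rows ← forEach (combine v) (List.finRange n)
  let rows' ← forEach (combine v') (List.finRange n)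
  let sol ← gauss n (rows ++ rows')
  match sol with
  | some x => do
      let res ← forEach (fun ab : Fin n × Fin n => do
        let t ← sumOver (fun c => mul (M ab.1 ab.2 c) (x c 0)) (List.finRange n)
        sub t (B ab.1 ab.2)) (pairs n)
      let ok ← allZero res
      pure (if ok then some (fun c => x c 0) else none)
  | none => do
      let full ← gauss n ((pairs n).map fun ab =>
        (M ab.1 ab.2, fun _ : Fin 1 => B ab.1 ab.2))
      pure (full.map fun x c => x c 0)

/-- The inverse of a matrix, or `none` if the matrix is singular. -/
def inverse {d : ℕ} (Q : Fin d → Fin d → R) : Prog R (Option (Fin d → Fin d → R)) := do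
  let E ← tabulate d fun i => tabulate d fun j => const (if i = j then 1 else 0)
  gauss d ((List.finRange d).map fun i => (Q i, E i))

/-- A random invertible `m × m` matrix: the entries are random numbers, and singular matrices are
rejected (at most `N` attempts). -/
def randGL (m : ℕ) : ℕ → Prog R (Fin m → Fin m → R)
  | 0 => .abort
  | N + 1 => do
      let W ← tabulate m fun _ => tabulate m fun _ => rand
      let inv ← inverse W
      match inv with
      | some _ => pure W
      | none => randGL m N

end Subroutines

/-! ## The learning algorithm

Indices are counted from `0`. The step `s = 1, ..., d - 1` of the algorithm is represented by its
pivot index `p = s - 1 : Fin (d - 1)`; the remaining indices `s + 1, ..., d` are then the values of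
`tail p : Fin (d - (p + 1)) → Fin d`. -/

section Algorithm

variable {R : Type} {d : ℕ}

def pivot (p : Fin (d - 1)) : Fin d := ⟨p, by omega⟩

def tail (p : Fin (d - 1)) (c : Fin (d - (p + 1))) : Fin d := ⟨p + 1 + c, by omega⟩

def idMat (d : ℕ) : Prog R (Fin d → Fin d → R) :=
  tabulate d fun i => tabulate d fun j => const (if i = j then 1 else 0)

/-- `I + c E_{ab}` for `a ≠ b`. -/
def transvection (a b : Fin d) (c : R) : Prog R (Fin d → Fin d → R) :=
  tabulate d fun i => tabulate d fun j =>
    if i = a ∧ j = b then pure c else const (if i = j then 1 else 0)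

/-- The upper Gauss operation `U^{(s,x)}`. -/
def upperGauss (p : Fin (d - 1)) (x : Fin (d - (p + 1)) → R) : Prog R (Fin d → Fin d → R) :=
  tabulate d fun i => tabulate d fun j =>
    if h : (i : ℕ) = p ∧ (p : ℕ) < j then pure (x ⟨(j : ℕ) - (p + 1), by omega⟩)
    else const (if i = j then 1 else 0)

/-- The lower Gauss operation `L^{(s,y)}`. -/
def lowerGauss (p : Fin (d - 1)) (y : Fin (d - (p + 1)) → R) : Prog R (Fin d → Fin d → R) :=
  tabulate d fun i => tabulate d fun j =>
    if h : (j : ℕ) = p ∧ (p : ℕ) < i then pure (y ⟨(i : ℕ) - (p + 1), by omega⟩)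
    else const (if i = j then 1 else 0)

/-- The diagonal Gauss operation: the identity matrix with the entry at `(a, a)` replaced by the
cube root of `h`. -/
def diagGauss (a : Fin d) (h : R) : Prog R (Fin d → Fin d → R) := do
  let r ← cbrt h
  tabulate d fun i => tabulate d fun j =>
    if i = a ∧ j = a then pure r else const (if i = j then 1 else 0)

/-- The matrix of the transposition of `a` and `b`. -/
def permMat (a b : Fin d) : Prog R (Fin d → Fin d → R) :=
  tabulate d fun i => tabulate d fun j => const (if Equiv.swap a b i = j then 1 else 0)

/-- A random element of `I_{s-1} ⊕ GL_{d-s+1}`. -/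
def randBlock (p : Fin (d - 1)) (N : ℕ) : Prog R (Fin d → Fin d → R) := do
  let W ← randGL (d - p) N
  tabulate d fun i => tabulate d fun j =>
    if h : (p : ℕ) ≤ i ∧ (p : ℕ) ≤ j then
      pure (W ⟨(i : ℕ) - p, by omega⟩ ⟨(j : ℕ) - p, by omega⟩)
    else const (if i = j then 1 else 0)

/-- The upper transformation for `s ≤ d - 3` (at most `N` attempts). -/
def up4 (p : Fin (d - 1)) : ℕ → Tensor d R → Prog R (Fin d → Fin d → R)
  | 0, _ => .abort
  | N + 1, G => do
      let M ← tabulate (d - (p + 1)) fun a => tabulate (d - (p + 1)) fun b =>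
        tabulate (d - (p + 1)) fun c =>
          sub (G (tail p a) (tail p b) (tail p c)) (G (tail p b) (tail p a) (tail p c))
      let B ← tabulate (d - (p + 1)) fun a => tabulate (d - (p + 1)) fun b =>
        sub (G (tail p b) (tail p a) (pivot p)) (G (tail p a) (tail p b) (pivot p))
      let sol ← solveSystem M B
      match sol with
      | some x => upperGauss p x
      | none => do
          let W ← randBlock p N
          let G' ← applyCongruence W G
          let Q ← up4 p N G'
          matMul Q W

/-- One pass of the three explicit transformations for `s = d - 2`, where `a, b, c` are the last
three indices; `none` if a test fails. -/
def up3Attempt (a b c : Fin d) (G₀ : Tensor d R) : Prog R (Option (Fin d → Fin d → R)) := do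
  let den₁ ← sub (G₀ b c c) (G₀ c b c)
  let z₁ ← isZero den₁
  if z₁ then pure none else
    let num₁ ← sub (G₀ c b b) (G₀ b c b)
    let x₁ ← div num₁ den₁
    let Q₁ ← transvection b c x₁
    let G₁ ← applyCongruence Q₁ G₀
    let num₂ ← sub (G₁ c b a) (G₁ b c a)
    let den₂ ← sub (G₁ b c c) (G₁ c b c)
    let x₂ ← div num₂ den₂
    let Q₂ ← transvection a c x₂
    let G₂ ← applyCongruence Q₂ G₁
    let den₃ ← sub (G₂ a b b) (G₂ b a b)
    let z₃ ← isZero den₃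
    if z₃ then pure none else
      let num₃ ← sub (G₂ b a a) (G₂ a b a)
      let x₃ ← div num₃ den₃
      let Q₃ ← transvection a b x₃
      let G₃ ← applyCongruence Q₃ G₂
      let z₄ ← isZero (G₃ a a a)
      if z₄ then pure none else
        let Q ← matMul Q₂ Q₁
        let Q' ← matMul Q₃ Q
        pure (some Q')

/-- The upper transformation for `s = d - 2` (at most `N` attempts). -/
def up3 (p : Fin (d - 1)) (hp : (p : ℕ) + 3 = d) : ℕ → Tensor d R → Prog R (Fin d → Fin d → R)
  | 0, _ => .abort
  | N + 1, G => do
      let res ← up3Attempt ⟨p, by omega⟩ ⟨p + 1, by omega⟩ ⟨p + 2, by omega⟩ G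
      match res with
      | some Q => pure Q
      | none => do
          let W ← randBlock p N
          let G' ← applyCongruence W G
          let Q ← up3 p hp N G'
          matMul Q W

/-- The upper transformation for `s = d - 1`, where `a, b` are the last two indices. -/
def up2 (a b : Fin d) (G : Tensor d R) : Prog R (Fin d → Fin d → R) := do
  let den ← sub (G a b b) (G b a b)
  let z ← isZero den
  if z then permMat a b
  else
    let num ← sub (G b a a) (G a b a)
    let x ← div num den
    transvection a b x

def upTransform (N : ℕ) (p : Fin (d - 1)) (G : Tensor d R) : Prog R (Fin d → Fin d → R) :=
  if (p : ℕ) + 4 ≤ d then up4 p N G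
  else if h : (p : ℕ) + 3 = d then up3 p h N G
  else up2 ⟨p, by omega⟩ ⟨p + 1, by omega⟩ G

/-- One step of the main loop; the state consists of the transformation `Q` and the tensor `G`. -/
def learningStep (N : ℕ) (state : (Fin d → Fin d → R) × Tensor d R) (p : Fin (d - 1)) :
    Prog R ((Fin d → Fin d → R) × Tensor d R) := do
  let Qup ← upTransform N p state.2
  let H ← applyCongruence Qup state.2
  let one ← const 1
  let zero ← const 0
  let hinv ← div one (H (pivot p) (pivot p) (pivot p))
  let y ← tabulate (d - (p + 1)) fun c => do
    let t ← mul hinv (H (pivot p) (tail p c) (pivot p))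
    sub zero t
  let D ← diagGauss (pivot p) hinv
  let L ← lowerGauss p y
  let Qdlow ← matMul D L
  let G ← applyCongruence Qdlow H
  let Q₁ ← matMul Qup state.1
  let Q ← matMul Qdlow Q₁
  pure (Q, G)

/-- The tensor learning algorithm. It has no bound on the number of random changes of coordinates;
`tensorLearning N` is the algorithm, cut off when a loop would need more attempts than the budget
`N` allows. Every finished run of the algorithm is a finished run for all large `N`, so the algorithm
itself is described by the limit `N → ∞`; its expected cost is the supremum over `N`. -/
def tensorLearning (N : ℕ) (hd : 2 ≤ d) (G : Tensor d R) :
    Prog R (Matrix (Fin d) (Fin d) R) := do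
  let Q₀ ← idMat d
  let final ← (List.finRange (d - 1)).foldlM (learningStep N) (Q₀, G)
  let last : Fin d := ⟨d - 1, by omega⟩
  let inv ← inverse final.1
  match inv with
  | none => .abort
  | some Qinv => do
      let D ← diagGauss last (final.2 last last last)
      let A ← matMul Qinv D
      pure (Matrix.of A)

end Algorithm

end SigLearn

/-! The tensor held by the algorithm is always `B * C` with `B = Q A`, and after `k` steps `B = I_k
⊕ B'`. Hence every number computed from the tensor is a value of the core form on rows of the
unknown matrix `B`.

Antisymmetrizing the first two slots of the core form gives `skewForm`. By `skewForm_eq_sum` its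
dependence on the last argument `h` is through the weights `coreWeight j h`, which are triangular in
`h`. On vectors supported from the pivot `p` on, `e_p` in the last slot gives zero
(`skewForm_single_right_eq_zero`). The linear system of a step adds a combination of later rows to
row `p` so that the result is annihilated by all pairs of later rows. If the solution is unique
(`InjectiveAt`), the new row must be a multiple of `e_p` (`InjectiveAt.eq_of_skewForm`), and the
entries `H p j p` then reveal column `p`, which the lower transformation clears. With only two rows
after the pivot there is a single equation for two unknowns; that case rests on an identity in
dimension three (`skewThree_eliminated`), and the last one on a two by two determinant (`spec_up2`).

For the cost, uniqueness follows from three inequalities in a column of `B⁻¹`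
(`injectiveAt_of_inv`), that is, from polynomials in a trailing block of `B` being nonzero. A law
without atoms almost surely avoids the zeros of a nonzero polynomial. An upper Gauss operation
leaves the rows after `p` alone and the lower one leaves the trailing block alone, so one random
change of coordinates makes all later systems solvable. Two random combinations then already
determine the solution (`InjectiveAt.exists_combination`), so such a step costs `O(d ^ 3)`. Steps of
cost `O(d ^ 4)` occur at most three times: once for the random change, and in the last two steps.
The bound therefore holds almost surely and not only in the mean, and two attempts per loop suffice.

The logic `Spec` serves both purposes: along the filter `⊤` it speaks of every run, along `ae ν` of
almost every run. Uniqueness of `A` comes for free: a run sees only the tensor, and it returns every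
invertible matrix with that tensor. -/

namespace SigLearn

/-! ## A program logic -/

namespace Prog

open Classical in
/-- For `l`-almost all random numbers, a run performs at most `c` operations and, if it finishes, has
a result that satisfies `P`; runs may be cut off only if `ab` holds. -/
def Spec (l : Filter ℝ) (ab : Prop) {α : Type} : Prog ℝ α → ℕ∞ → (α → Prop) → Prop
  | .ret a, _, P => P a
  | .const q k, c, P => ∃ c', c' + 1 ≤ c ∧ (k (q : ℝ)).Spec l ab c' P
  | .arith o x y k, c, P => ∃ c', c' + 1 ≤ c ∧ (k (o.eval x y)).Spec l ab c' P
  | .cbrt x k, c, P => ∃ c', c' + 1 ≤ c ∧ (k (realCbrt x)).Spec l ab c' P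
  | .isZero x k, c, P => ∃ c', c' + 1 ≤ c ∧ (k (decide (x = 0))).Spec l ab c' P
  | .rand k, c, P => ∃ c', c' + 1 ≤ c ∧ ∀ᶠ x in l, (k x).Spec l ab c' P
  | .abort, _, _ => ab

variable {l : Filter ℝ} {ab : Prop} {α β : Type}

theorem Spec.mono {p : Prog ℝ α} {c c' : ℕ∞} {P P' : α → Prop} (h : p.Spec l ab c P)
    (hc : c ≤ c') (hP : ∀ a, P a → P' a) : p.Spec l ab c' P' := by
  induction p generalizing c c' with
  | ret a => exact hP _ h
  | abort => exact h
  | rand k ih =>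
    obtain ⟨e, he, h⟩ := h
    exact ⟨e, he.trans hc, h.mono fun x hx => ih x hx le_rfl⟩
  | const q k ih =>
    obtain ⟨e, he, h⟩ := h
    exact ⟨e, he.trans hc, ih _ h le_rfl⟩
  | arith o x y k ih =>
    obtain ⟨e, he, h⟩ := h
    exact ⟨e, he.trans hc, ih _ h le_rfl⟩
  | cbrt x k ih =>
    obtain ⟨e, he, h⟩ := h
    exact ⟨e, he.trans hc, ih _ h le_rfl⟩
  | isZero x k ih =>
    obtain ⟨e, he, h⟩ := h
    exact ⟨e, he.trans hc, ih _ h le_rfl⟩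

theorem Spec.cost_le {p : Prog ℝ α} {c c' : ℕ∞} {P : α → Prop} (h : p.Spec l ab c P)
    (hc : c ≤ c') : p.Spec l ab c' P := h.mono hc fun _ => id

theorem Spec.imp {p : Prog ℝ α} {c : ℕ∞} {P P' : α → Prop} (h : p.Spec l ab c P)
    (hP : ∀ a, P a → P' a) : p.Spec l ab c P' := h.mono le_rfl hP

theorem Spec.bind {p : Prog ℝ α} {f : α → Prog ℝ β} {c c' : ℕ∞} {P : α → Prop} {R : β → Prop}
    (h : p.Spec l ab c P) (hf : ∀ a, P a → (f a).Spec l ab c' R) :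
    (p >>= f).Spec l ab (c + c') R := by
  change (Prog.bind p f).Spec l ab (c + c') R
  have key : ∀ {e c : ℕ∞}, e + 1 ≤ c → e + c' + 1 ≤ c + c' := fun {e c} he => by
    rw [add_right_comm]; gcongr
  induction p generalizing c with
  | ret a => exact (hf a h).cost_le le_add_self
  | abort => exact h
  | rand k ih =>
    obtain ⟨e, he, h⟩ := h
    exact ⟨e + c', key he, h.mono fun x hx => ih x hx⟩
  | const q k ih =>
    obtain ⟨e, he, h⟩ := h
    exact ⟨e + c', key he, ih _ h⟩
  | arith o x y k ih =>
    obtain ⟨e, he, h⟩ := h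
    exact ⟨e + c', key he, ih _ h⟩
  | cbrt x k ih =>
    obtain ⟨e, he, h⟩ := h
    exact ⟨e + c', key he, ih _ h⟩
  | isZero x k ih =>
    obtain ⟨e, he, h⟩ := h
    exact ⟨e + c', key he, ih _ h⟩

theorem Spec.pure {a : α} {c : ℕ∞} {P : α → Prop} (h : P a) :
    (Pure.pure a : Prog ℝ α).Spec l ab c P := h

/-- The conjuncts may split the budget differently at a node, but `c - 1` dominates all the
remaining budgets. Filters are closed under finite intersections only, whence `Finite ι`; a member
of `ι` is needed to know that the node can be paid at all. -/
theorem Spec.forall {ι : Type} [Finite ι] {p : Prog ℝ α} {c : ℕ∞} {P : ι → α → Prop} (hι : Nonempty ι)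
    (h : ∀ i, p.Spec l ab c (P i)) : p.Spec l ab c (fun a => ∀ i, P i a) := by
  induction p generalizing c with
  | ret a => exact h
  | abort => exact h hι.some
  | rand k ih =>
    choose e he h using h
    by_cases hc : c = ⊤
    · refine ⟨⊤, by simp [hc], ?_⟩
      filter_upwards [eventually_all.2 h] with x hx
      exact ih x fun i => (hx i).cost_le le_top
    · refine ⟨c - 1, ?_, ?_⟩
      · exact (tsub_add_cancel_of_le (le_trans le_add_self (he hι.some))).le
      · filter_upwards [eventually_all.2 h] with x hx
        exact ih x fun i => (hx i).cost_le (ENat.le_sub_of_add_le_right (by simp) (he i))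
  | const q k ih =>
    choose e he h using h
    exact ⟨c - 1, (tsub_add_cancel_of_le (le_trans le_add_self (he hι.some))).le,
      ih _ fun i => (h i).cost_le (ENat.le_sub_of_add_le_right (by simp) (he i))⟩
  | arith o x y k ih =>
    choose e he h using h
    exact ⟨c - 1, (tsub_add_cancel_of_le (le_trans le_add_self (he hι.some))).le,
      ih _ fun i => (h i).cost_le (ENat.le_sub_of_add_le_right (by simp) (he i))⟩
  | cbrt x k ih =>
    choose e he h using h
    exact ⟨c - 1, (tsub_add_cancel_of_le (le_trans le_add_self (he hι.some))).le,
      ih _ fun i => (h i).cost_le (ENat.le_sub_of_add_le_right (by simp) (he i))⟩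
  | isZero x k ih =>
    choose e he h using h
    exact ⟨c - 1, (tsub_add_cancel_of_le (le_trans le_add_self (he hι.some))).le,
      ih _ fun i => (h i).cost_le (ENat.le_sub_of_add_le_right (by simp) (he i))⟩

theorem Spec.and {p : Prog ℝ α} {c : ℕ∞} {P P' : α → Prop} (h : p.Spec l ab c P)
    (h' : p.Spec l ab c P') : p.Spec l ab c (fun a => P a ∧ P' a) := by
  have := Spec.forall (p := p) (l := l) (ab := ab) (c := c) (P := fun b : Bool => if b then P else P')
    ⟨true⟩ (fun b => by cases b <;> simpa)
  exact this.imp fun a ha => ⟨by simpa using ha true, by simpa using ha false⟩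

/-- Along the filter `⊤`, "eventually" means for every random number. -/
theorem Spec.always {p : Prog ℝ α} {c : ℕ∞} {P : α → Prop} (h : p.Spec ⊤ ab c P) :
    p.Always P := by
  induction p generalizing c with
  | ret a => exact h
  | abort => trivial
  | rand k ih =>
    obtain ⟨e, he, h⟩ := h
    exact fun x => ih x (eventually_top.1 h x)
  | const q k ih => obtain ⟨e, he, h⟩ := h; exact ih _ h
  | arith o x y k ih => obtain ⟨e, he, h⟩ := h; exact ih _ h
  | cbrt x k ih => obtain ⟨e, he, h⟩ := h; exact ih _ h
  | isZero x k ih => obtain ⟨e, he, h⟩ := h; exact ih _ h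

/-- No finiteness is needed here, because the two universal quantifiers commute at a random draw.
This is what turns correctness into uniqueness of `A`. -/
theorem Always.forall {ι : Sort*} {p : Prog ℝ α} {P : ι → α → Prop}
    (h : ∀ i, p.Always (P i)) : p.Always (fun a => ∀ i, P i a) := by
  induction p with
  | ret a => exact h
  | abort => trivial
  | rand k ih => exact fun x => ih x fun i => h i x
  | const q k ih => exact ih _ h
  | arith o x y k ih => exact ih _ h
  | cbrt x k ih => exact ih _ h
  | isZero x k ih => exact ih _ h

theorem Always.imp {p : Prog ℝ α} {P P' : α → Prop} (h : p.Always P) (hP : ∀ a, P a → P' a) :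
    p.Always P' := by
  induction p with
  | ret a => exact hP _ h
  | abort => trivial
  | rand k ih => exact fun x => ih x (h x)
  | const q k ih => exact ih _ h
  | arith o x y k ih => exact ih _ h
  | cbrt x k ih => exact ih _ h
  | isZero x k ih => exact ih _ h

/-- With `ab = False` a cut-off run would contradict `Spec`, so cut-offs lie in a null set at each
draw. -/
theorem Spec.haltProb_eq_one {ν : Measure ℝ} [IsProbabilityMeasure ν] {p : Prog ℝ α} {c : ℕ∞}
    {P : α → Prop} (h : p.Spec (ae ν) False c P) : p.haltProb ν = 1 := by
  induction p generalizing c with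
  | ret a => rfl
  | abort => exact h.elim
  | rand k ih =>
    obtain ⟨e, he, h⟩ := h
    have : ∫⁻ x, (k x).haltProb ν ∂ν = ∫⁻ _, 1 ∂ν :=
      lintegral_congr_ae (h.mono fun x hx => ih x hx)
    simpa [haltProb] using this
  | const q k ih => obtain ⟨e, he, h⟩ := h; exact ih _ h
  | arith o x y k ih => obtain ⟨e, he, h⟩ := h; exact ih _ h
  | cbrt x k ih => obtain ⟨e, he, h⟩ := h; exact ih _ h
  | isZero x k ih => obtain ⟨e, he, h⟩ := h; exact ih _ h

/-- An almost sure bound on the cost bounds its integral against a probability measure. Cut-off runs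
are harmless, so `ab` is arbitrary. -/
theorem Spec.expectedCost_le {ν : Measure ℝ} [IsProbabilityMeasure ν] {p : Prog ℝ α} {c : ℕ∞}
    {P : α → Prop} (h : p.Spec (ae ν) ab c P) : p.expectedCost ν ≤ (c : ℝ≥0∞) := by
  have key : ∀ {e c : ℕ∞} {x : ℝ≥0∞}, e + 1 ≤ c → x ≤ (e : ℝ≥0∞) → 1 + x ≤ (c : ℝ≥0∞) := by
    intro e c x he hx
    calc 1 + x ≤ ((e + 1 : ℕ∞) : ℝ≥0∞) := by
          rw [add_comm, ENat.toENNReal_add, ENat.toENNReal_one]; gcongr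
      _ ≤ c := by exact_mod_cast he
  induction p generalizing c with
  | ret a => exact zero_le
  | abort => exact zero_le
  | rand k ih =>
    obtain ⟨e, he, h⟩ := h
    refine key he ?_
    calc ∫⁻ x, (k x).expectedCost ν ∂ν ≤ ∫⁻ _, (e : ℝ≥0∞) ∂ν :=
          lintegral_mono_ae (h.mono fun x hx => ih x hx)
      _ = e := by simp
  | const q k ih => obtain ⟨e, he, h⟩ := h; exact key he (ih _ h)
  | arith o x y k ih => obtain ⟨e, he, h⟩ := h; exact key he (ih _ h)
  | cbrt x k ih => obtain ⟨e, he, h⟩ := h; exact key he (ih _ h)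
  | isZero x k ih => obtain ⟨e, he, h⟩ := h; exact key he (ih _ h)

/-- The program is deterministic, performs at most `c` operations and has the result `a`. -/
def Runs (p : Prog ℝ α) (c : ℕ) (a : α) : Prop :=
  ∀ (l : Filter ℝ) (ab : Prop), p.Spec l ab (c : ℕ∞) (· = a)

theorem Runs.spec {p : Prog ℝ α} {c : ℕ} {a : α} {P : α → Prop} (h : p.Runs c a) (ha : P a) :
    p.Spec l ab c P := (h l ab).imp fun _ hb => hb ▸ ha

theorem Runs.cost_le {p : Prog ℝ α} {c c' : ℕ} {a : α} (h : p.Runs c a) (hc : c ≤ c') :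
    p.Runs c' a := fun l ab => (h l ab).cost_le (by exact_mod_cast hc)

theorem Runs.val {p : Prog ℝ α} {c : ℕ} {a b : α} (h : p.Runs c a) (hab : a = b) :
    p.Runs c b := hab ▸ h

theorem Runs.bind {p : Prog ℝ α} {f : α → Prog ℝ β} {c c' : ℕ} {a : α} {b : β}
    (h : p.Runs c a) (hf : (f a).Runs c' b) : (p >>= f).Runs (c + c') b := fun l ab => by
  push_cast
  exact (h l ab).bind fun x hx => hx ▸ hf l ab

theorem Runs.bind_spec {p : Prog ℝ α} {f : α → Prog ℝ β} {c : ℕ} {c' : ℕ∞} {a : α}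
    {R : β → Prop} (h : p.Runs c a) (hf : (f a).Spec l ab c' R) :
    (p >>= f).Spec l ab (c + c') R := (h l ab).bind fun _ hx => hx ▸ hf

theorem Runs.pure (a : α) : (Pure.pure a : Prog ℝ α).Runs 0 a := fun _ _ => rfl

end Prog

open Prog

/-! ### Costs and values of single instructions and of loops -/

theorem runs_const (q : ℚ) : (const q : Prog ℝ ℝ).Runs 1 q := fun _ _ => ⟨0, by simp, rfl⟩
theorem runs_add (x y : ℝ) : (add x y).Runs 1 (x + y) := fun _ _ => ⟨0, by simp, rfl⟩
theorem runs_sub (x y : ℝ) : (sub x y).Runs 1 (x - y) := fun _ _ => ⟨0, by simp, rfl⟩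
theorem runs_mul (x y : ℝ) : (mul x y).Runs 1 (x * y) := fun _ _ => ⟨0, by simp, rfl⟩
theorem runs_div (x y : ℝ) : (div x y).Runs 1 (x / y) := fun _ _ => ⟨0, by simp, rfl⟩
theorem runs_cbrt (x : ℝ) : (cbrt x).Runs 1 (realCbrt x) := fun _ _ => ⟨0, by simp, rfl⟩

open Classical in
theorem runs_isZero (x : ℝ) : (isZero x).Runs 1 (decide (x = 0)) := fun _ _ => ⟨0, by simp, rfl⟩

theorem runs_delta {d : ℕ} (i j : Fin d) :
    (const (if i = j then 1 else 0) : Prog ℝ ℝ).Runs 1 ((1 : Matrix (Fin d) (Fin d) ℝ) i j) :=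
  (runs_const _).val (by rw [Matrix.one_apply]; split <;> simp)

theorem spec_tabulate {l : Filter ℝ} {ab : Prop} {α : Type} {n : ℕ} {f : Fin n → Prog ℝ α}
    {c : Fin n → ℕ∞} {P : Fin n → α → Prop} (h : ∀ i, (f i).Spec l ab (c i) (P i)) :
    (tabulate n f).Spec l ab (∑ i, c i) (fun v => ∀ i, P i (v i)) := by
  induction n with
  | zero => exact fun i => i.elim0
  | succ n ih =>
    rw [Fin.sum_univ_succ]
    refine (h 0).bind fun a ha => ?_
    rw [← add_zero (∑ i : Fin n, c i.succ)]
    refine (ih fun i => h i.succ).bind fun v hv => ?_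
    exact Fin.cases ha hv

theorem runs_tabulate {α : Type} {n : ℕ} {f : Fin n → Prog ℝ α} {c : Fin n → ℕ} {g : Fin n → α}
    (h : ∀ i, (f i).Runs (c i) (g i)) : (tabulate n f).Runs (∑ i, c i) g := fun l ab => by
  have := spec_tabulate fun i => h i l ab
  push_cast
  exact this.imp fun v hv => funext hv

theorem runs_tabulate_const {α : Type} {n : ℕ} {f : Fin n → Prog ℝ α} {c : ℕ} {g : Fin n → α}
    (h : ∀ i, (f i).Runs c (g i)) : (tabulate n f).Runs (n * c) g :=
  (runs_tabulate h).cost_le (by simp)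

theorem runs_tabulate₂ {α : Type} {m n : ℕ} {f : Fin m → Fin n → Prog ℝ α} {c : ℕ}
    {g : Fin m → Fin n → α} (h : ∀ i j, (f i j).Runs c (g i j)) :
    (tabulate m fun i => tabulate n fun j => f i j).Runs (m * (n * c)) g :=
  runs_tabulate_const fun i => runs_tabulate_const fun j => h i j

theorem runs_forEach {α β : Type} {f : α → Prog ℝ β} {c : ℕ} {g : α → β} (L : List α)
    (h : ∀ a, (f a).Runs c (g a)) : (forEach f L).Runs (L.length * c) (L.map g) := by
  induction L with
  | nil => exact (Runs.pure _).cost_le (by simp)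
  | cons a L ih =>
    refine Runs.cost_le ((h a).bind (ih.bind (Runs.pure _))) ?_
    simp; ring_nf; rfl

theorem runs_sumOver {ι : Type} {f : ι → Prog ℝ ℝ} {c : ℕ} {g : ι → ℝ} (L : List ι)
    (h : ∀ a, (f a).Runs c (g a)) : (sumOver f L).Runs (L.length * (c + 1) + 1) (L.map g).sum := by
  induction L with
  | nil => exact (runs_const _).val (by simp) |>.cost_le (by simp)
  | cons a L ih =>
    refine ((h a).bind (ih.bind (runs_add _ _))).val (by simp) |>.cost_le ?_
    simp; ring_nf; rfl

theorem runs_sumOver_finRange {n : ℕ} {f : Fin n → Prog ℝ ℝ} {c : ℕ} {g : Fin n → ℝ}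
    (h : ∀ a, (f a).Runs c (g a)) :
    (sumOver f (List.finRange n)).Runs (n * (c + 1) + 1) (∑ i, g i) := by
  simpa [← List.ofFn_eq_map, List.sum_ofFn] using runs_sumOver (List.finRange n) h

open Classical in
theorem runs_nonzeros {ι : Type} (v : ι → ℝ) (L : List ι) :
    (nonzeros v L).Runs L.length (L.filter fun i => v i ≠ 0) := by
  induction L with
  | nil => exact Runs.pure _
  | cons a L ih =>
    refine Runs.cost_le (Runs.val ((runs_isZero (v a)).bind (ih.bind (Runs.pure _))) ?_) ?_
    · by_cases h : v a = 0 <;> simp [h]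
    · simp; omega

open Classical in
theorem runs_allZero (L : List ℝ) : (allZero L).Runs L.length (decide (∀ x ∈ L, x = 0)) := by
  induction L with
  | nil => exact (Runs.pure _).val (by simp)
  | cons a L ih =>
    rw [allZero, List.length_cons, add_comm]
    refine (runs_isZero a).bind ?_
    by_cases h : a = 0
    · simpa [h] using ih
    · simpa [h] using (Runs.pure false).cost_le (Nat.zero_le _)

/-- Loops in which each step preserves the flag `b` of an invariant at the ordinary cost, or raises it
at the additional cost `e`. -/
theorem spec_foldlM {l : Filter ℝ} {ab : Prop} {σ : Type} {n : ℕ} {f : σ → Fin n → Prog ℝ σ}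
    {I : ℕ → Bool → σ → Prop} {c : Fin n → ℕ∞} {e : ℕ∞}
    (ht : ∀ (p : Fin n) s, I p true s → (f s p).Spec l ab (c p) (I (p + 1) true))
    (hf : ∀ (p : Fin n) s, I p false s → (f s p).Spec l ab (c p) (I (p + 1) false) ∨
      (f s p).Spec l ab (c p + e) (I (p + 1) true)) (b : Bool) {s : σ} (hs : I 0 b s) :
    ((List.finRange n).foldlM f s).Spec l ab (∑ p, c p + if b then 0 else e)
      (fun s => ∃ b, I n b s) := by
  induction n generalizing s b I with
  | zero => exact ⟨b, hs⟩
  | succ n ih =>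
    rw [List.finRange_succ, List.foldlM_cons, Fin.sum_univ_succ]
    simp only [List.foldlM_map]
    -- The remaining loop is the same statement for the invariant shifted by one; the flag reached
    -- so far decides whether the surcharge `e` is still available.
    have step : ∀ b' s', I 1 b' s' →
        ((List.finRange n).foldlM (fun s i => f s i.succ) s').Spec l ab
          (∑ p : Fin n, c p.succ + if b' then 0 else e) (fun s => ∃ b, I (n + 1) b s) := by
      intro b' s' hs'
      refine ih (I := fun p => I (p + 1)) (c := fun p => c p.succ) (fun p s h => ?_)
        (fun p s h => ?_) b' hs'
      · simpa using ht p.succ s (by simpa using h)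
      · simpa using hf p.succ s (by simpa using h)
    cases b with
    | true => exact ((ht 0 s hs).bind fun s' h => step true s' h).cost_le (by simp)
    | false =>
      rcases hf 0 s hs with h | h
      · exact (h.bind fun s' h => step false s' h).cost_le (by simp [add_assoc])
      · exact (h.bind fun s' h => step true s' h).cost_le (by simp [add_assoc, add_comm])

/-! ## Deterministic subroutines -/

theorem runs_matMul {d : ℕ} (A B : Fin d → Fin d → ℝ) :
    (matMul A B).Runs (d * (d * (d * 2 + 1))) (Matrix.of A * Matrix.of B) :=
  Runs.val (runs_tabulate₂ fun i j => runs_sumOver_finRange fun k => runs_mul _ _) (by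
    ext i j; simp [Matrix.mul_apply])

theorem sum_map_filter_ne_zero {ι : Type} (v g : ι → ℝ) (L : List ι) [DecidablePred fun i => v i ≠ 0] :
    ((L.filter fun i => v i ≠ 0).map fun i => v i * g i).sum = (L.map fun i => v i * g i).sum := by
  induction L with
  | nil => rfl
  | cons a L ih =>
    by_cases h : v a = 0
    · simpa [h] using ih
    · simpa [h] using ih

open Classical in
/-- The number of nonzero entries of a matrix. -/
noncomputable def nnz {d : ℕ} (A : Fin d → Fin d → ℝ) : ℕ :=
  ∑ i, ((List.finRange d).filter fun j => A i j ≠ 0).length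

open Classical in
theorem nnz_row_eq {d : ℕ} (v : Fin d → ℝ) :
    ((List.finRange d).filter fun j => v j ≠ 0).length = (Finset.univ.filter fun j => v j ≠ 0).card := by
  rw [← List.toFinset_card_of_nodup ((List.nodup_finRange d).filter _)]
  congr 1; ext; simp

theorem nnz_le {d : ℕ} (A : Fin d → Fin d → ℝ) : nnz A ≤ d * d := by
  classical
  refine (Finset.sum_le_card_nsmul _ _ d fun i _ => ?_).trans (by simp)
  exact (List.length_filter_le _ _).trans (by simp)

/-- Upper Gauss operations differ from the identity in one row, lower ones in one column. Their
sparsity keeps the congruences of an ordinary step at `O(d ^ 3)`. -/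
theorem nnz_le_of_row {d : ℕ} {A : Fin d → Fin d → ℝ} (p : Fin d)
    (h : ∀ i j, A i j ≠ 0 → i = j ∨ i = p) : nnz A ≤ 2 * d := by
  classical
  have h1 : ∀ i, ((List.finRange d).filter fun j => A i j ≠ 0).length ≤ 1 + if i = p then d else 0 := by
    intro i
    split_ifs with hi
    · exact (List.length_filter_le _ _).trans (by simp)
    · rw [nnz_row_eq]
      refine (Finset.card_le_card (t := {i}) fun j hj => ?_).trans (by simp)
      have := h i j (by simpa using hj)
      simp; tauto
  refine (Finset.sum_le_sum fun i _ => h1 i).trans ?_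
  simp [Finset.sum_add_distrib]; omega

theorem nnz_le_of_col {d : ℕ} {A : Fin d → Fin d → ℝ} (p : Fin d)
    (h : ∀ i j, A i j ≠ 0 → i = j ∨ j = p) : nnz A ≤ 2 * d := by
  classical
  refine (Finset.sum_le_card_nsmul _ _ 2 fun i _ => ?_).trans (by simp [mul_comm])
  rw [nnz_row_eq]
  refine (Finset.card_le_card (t := {i, p}) fun j hj => ?_).trans Finset.card_le_two
  have := h i j (by simpa using hj)
  simp; tauto

open Classical in
-- In each of the three modes a nonzero entry of `A` costs one product and one sum for each of the
-- `d * d` positions of the other two indices. The leading `d * d` pays for the zero tests that find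
-- the supports.
theorem runs_applyCongruence {d : ℕ} (A : Fin d → Fin d → ℝ) (T : Tensor d ℝ) :
    (applyCongruence A T).Runs (d * d + 3 * (d * d * (2 * nnz A + d)))
      (congruence (Matrix.of A) T) := by
  have hs : ∀ (i : Fin d) (g : Fin d → ℝ),
      (sumOver (fun a => mul (A i a) (g a)) ((List.finRange d).filter fun j => A i j ≠ 0)).Runs
        (((List.finRange d).filter fun j => A i j ≠ 0).length * 2 + 1) (∑ a, A i a * g a) := by
    intro i g
    refine Runs.val (runs_sumOver _ fun a => runs_mul _ _) ?_
    rw [sum_map_filter_ne_zero, ← List.ofFn_eq_map, List.sum_ofFn]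
  refine Runs.val (Runs.cost_le ((runs_tabulate_const fun i => Runs.cost_le (c' := d) (runs_nonzeros (A i) _) (by simp)).bind
    ((runs_tabulate fun i => runs_tabulate₂ fun j k => hs i _).bind
    ((runs_tabulate_const fun i => runs_tabulate fun j => runs_tabulate_const fun k => hs j _).bind
    (runs_tabulate₂ fun i j => runs_tabulate fun k => hs k _)))) ?_) ?_
  · have e : ∑ i, (((List.finRange d).filter fun j => A i j ≠ 0).length * 2 + 1) = 2 * nnz A + d := by
      rw [Finset.sum_add_distrib, ← Finset.sum_mul]; simp [nnz, mul_comm]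
    simp only [← Finset.mul_sum, e]
    exact le_of_eq (by ring)
  · ext i j k
    simp only [congruence, Finset.mul_sum, Matrix.of_apply]
    -- The last mode is the outermost sum, so the order `c, b, a` has to be reversed.
    refine Finset.sum_comm.trans ((Finset.sum_congr rfl fun b _ => Finset.sum_comm).trans
      (Finset.sum_comm.trans ?_))
    exact Finset.sum_congr rfl fun a _ => Finset.sum_congr rfl fun b _ =>
      Finset.sum_congr rfl fun c _ => by ring

/-! ### Gaussian elimination -/

def IsSolution {n q : ℕ} (rows : List ((Fin n → ℝ) × (Fin q → ℝ))) (x : Fin n → Fin q → ℝ) : Prop :=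
  ∀ r ∈ rows, ∀ l, ∑ j, r.1 j * x j l = r.2 l

/-- Full column rank, stated without matrices so that it passes through elimination steps on lists
of rows. -/
def TrivialKernel {n q : ℕ} (rows : List ((Fin n → ℝ) × (Fin q → ℝ))) : Prop :=
  ∀ z : Fin n → ℝ, (∀ r ∈ rows, ∑ j, r.1 j * z j = 0) → z = 0

/-- The option is the unique solution of the equations, or `none` if there is no unique solution. -/
def UniqueSolution {n q : ℕ} (rows : List ((Fin n → ℝ) × (Fin q → ℝ)))
    (o : Option (Fin n → Fin q → ℝ)) : Prop :=
  (∀ x, o = some x → IsSolution rows x ∧ TrivialKernel rows) ∧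
    (o = none → TrivialKernel rows → ¬ ∃ x, IsSolution rows x)

theorem uniqueSolution_congr {n q : ℕ} {rows rows' : List ((Fin n → ℝ) × (Fin q → ℝ))}
    (h : rows.Perm rows') {o : Option (Fin n → Fin q → ℝ)} (ho : UniqueSolution rows o) :
    UniqueSolution rows' o := by
  simpa only [UniqueSolution, IsSolution, TrivialKernel, h.mem_iff] using ho

theorem spec_findPivot {l : Filter ℝ} {ab : Prop} {n q : ℕ}
    (rows : List ((Fin (n + 1) → ℝ) × (Fin q → ℝ))) :
    (findPivot rows).Spec l ab rows.length (fun o => (o = none ∧ ∀ r ∈ rows, r.1 0 = 0) ∨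
      ∃ piv rest, o = some (piv, rest) ∧ piv.1 0 ≠ 0 ∧ rows.Perm (piv :: rest)) := by
  induction rows with
  | nil => exact Or.inl ⟨rfl, by simp⟩
  | cons r rs ih =>
    rw [findPivot, List.length_cons, Nat.cast_add, add_comm (rs.length : ℕ∞)]
    refine (runs_isZero (r.1 0)).bind_spec ?_
    by_cases h : r.1 0 = 0
    · simp only [h, decide_true, if_true]
      rw [← add_zero (rs.length : ℕ∞)]
      refine ih.bind fun o ho => ?_
      rcases ho with ⟨rfl, ho⟩ | ⟨piv, rest, rfl, hp, hperm⟩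
      · exact Or.inl ⟨rfl, by simpa [h] using ho⟩
      · exact Or.inr ⟨piv, r :: rest, rfl, hp, (hperm.cons r).trans (List.Perm.swap _ _ _)⟩
    · simp only [h, decide_false]
      exact Or.inr ⟨r, rs, rfl, h, List.Perm.refl _⟩

theorem pivot_iff {n : ℕ} {p : Fin (n + 1) → ℝ} (hp : p 0 ≠ 0) (t : ℝ) (z : Fin (n + 1) → ℝ) :
    ∑ j, p j * z j = t ↔ z 0 = t / p 0 - ∑ j : Fin n, p j.succ / p 0 * z j.succ := by
  have : ∑ j : Fin n, p j.succ / p 0 * z j.succ = (∑ j : Fin n, p j.succ * z j.succ) / p 0 := by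
    rw [Finset.sum_div]; exact Finset.sum_congr rfl fun _ _ => by ring
  rw [Fin.sum_univ_succ, this, ← sub_div, eq_div_iff hp]
  constructor <;> intro h <;> linarith

/-- On the solutions of the pivot equation `z 0` is a function of the other unknowns, and
substituting it into the row `r` gives the shortened row. -/
theorem eliminate_iff {n : ℕ} {p : Fin (n + 1) → ℝ} (hp : p 0 ≠ 0) {t : ℝ} {z : Fin (n + 1) → ℝ}
    (h : ∑ j, p j * z j = t) (r : Fin (n + 1) → ℝ) (ρ : ℝ) :
    ∑ j : Fin n, (r j.succ - r 0 * (p j.succ / p 0)) * z j.succ = ρ - r 0 * (t / p 0) ↔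
      ∑ j, r j * z j = ρ := by
  rw [pivot_iff hp] at h
  rw [Fin.sum_univ_succ, h]
  simp only [sub_mul, Finset.sum_sub_distrib, mul_assoc, ← Finset.mul_sum]
  constructor <;> intro h <;> linarith

/-- The row `r` after elimination of its leading coefficient by means of the row `p`. -/
noncomputable def eliminated {n q : ℕ} (p r : (Fin (n + 1) → ℝ) × (Fin q → ℝ)) :
    (Fin n → ℝ) × (Fin q → ℝ) :=
  (fun j => r.1 j.succ - r.1 0 * (p.1 j.succ / p.1 0), fun l => r.2 l - r.1 0 * (p.2 l / p.1 0))

/-- Undo one elimination step. -/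
noncomputable def backSubstitute {n q : ℕ} (p : (Fin (n + 1) → ℝ) × (Fin q → ℝ))
    (x : Fin n → Fin q → ℝ) : Fin (n + 1) → Fin q → ℝ :=
  Fin.cons (fun l => p.2 l / p.1 0 - ∑ j, p.1 j.succ / p.1 0 * x j l) x

theorem isSolution_backSubstitute_iff {n q : ℕ} {p : (Fin (n + 1) → ℝ) × (Fin q → ℝ)}
    (hp : p.1 0 ≠ 0) {rest : List ((Fin (n + 1) → ℝ) × (Fin q → ℝ))} (x : Fin (n + 1) → Fin q → ℝ) :
    IsSolution (p :: rest) x ↔ IsSolution (rest.map (eliminated p)) (fun j => x j.succ) ∧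
      x = backSubstitute p (fun j => x j.succ) := by
  have h1 : x = backSubstitute p (fun j => x j.succ) ↔ ∀ l, ∑ j, p.1 j * x j l = p.2 l := by
    constructor
    · intro h l
      rw [pivot_iff hp]
      exact congrFun (congrFun h 0) l
    · intro h
      ext j l
      refine Fin.cases ?_ (fun j => rfl) j
      exact (pivot_iff hp _ _).1 (h l)
  rw [h1]
  simp only [IsSolution, List.forall_mem_cons, List.forall_mem_map, eliminated]
  rw [and_comm]
  refine and_congr_left fun h => ?_
  exact forall₂_congr fun r _ => forall_congr' fun l => (eliminate_iff hp (h l) _ _).symm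

theorem trivialKernel_eliminated_iff {n q : ℕ} {p : (Fin (n + 1) → ℝ) × (Fin q → ℝ)}
    (hp : p.1 0 ≠ 0) {rest : List ((Fin (n + 1) → ℝ) × (Fin q → ℝ))} :
    TrivialKernel (rest.map (eliminated p)) ↔ TrivialKernel (p :: rest) := by
  constructor
  · intro h z hz
    rw [List.forall_mem_cons] at hz
    have h0 := h (fun j => z j.succ) (by
      simp only [List.forall_mem_map]
      intro r hr
      simpa [eliminated] using (eliminate_iff hp hz.1 r.1 0).2 (hz.2 r hr))
    have h1 := (pivot_iff hp _ _).1 hz.1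
    have h2 : ∀ j : Fin n, z j.succ = 0 := fun j => congrFun h0 j
    ext j
    refine Fin.cases ?_ h2 j
    simpa [h2] using h1
  · intro h z hz
    have hc : ∑ j, p.1 j * (Fin.cons (-∑ j, p.1 j.succ / p.1 0 * z j) z : Fin (n + 1) → ℝ) j = 0 :=
      (pivot_iff hp _ _).2 (by simp)
    have := h (Fin.cons (-∑ j, p.1 j.succ / p.1 0 * z j) z) (by
      rw [List.forall_mem_cons]
      refine ⟨hc, fun r hr => (eliminate_iff hp hc r.1 0).1 ?_⟩
      simpa [eliminated] using hz _ (List.mem_map_of_mem hr))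
    ext j
    simpa using congrFun this j.succ

/-- Each elimination step preserves solutions and kernel in both directions, so the answer for the
shortened system lifts. The bound is generous: a step costs about `2 * (n + q)` operations per row,
and there are `n` steps. -/
theorem spec_gauss {l : Filter ℝ} {ab : Prop} {q : ℕ} : ∀ (n : ℕ)
    (rows : List ((Fin n → ℝ) × (Fin q → ℝ))), (gauss n rows).Spec l ab
      ((3 * (n + 1) * (rows.length + n + 1) * (n + q + 1) : ℕ) : ℕ∞) (UniqueSolution rows)
  | 0, rows => by
    classical
    rw [gauss]
    refine Spec.cost_le ((runs_allZero _).bind_spec (c' := 0) ?_) ?_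
    · by_cases h : ∀ x ∈ rows.flatMap fun r => List.ofFn r.2, x = 0
      · rw [if_pos (decide_eq_true h)]
        refine Spec.pure ⟨fun x _ => ⟨fun r hr l => ?_, fun z _ => Subsingleton.elim _ _⟩, by simp⟩
        simpa using (h (r.2 l) (List.mem_flatMap.2 ⟨r, hr, List.mem_ofFn.2 ⟨l, rfl⟩⟩)).symm
      · rw [if_neg (by simpa using h)]
        refine Spec.pure ⟨by simp, fun _ _ ⟨x, hx⟩ => h fun y hy => ?_⟩
        simp only [List.mem_flatMap, List.mem_ofFn] at hy
        obtain ⟨r, hr, l, rfl⟩ := hy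
        simpa using (hx r hr l).symm
    · have : (rows.flatMap fun r => List.ofFn r.2).length = rows.length * q := by
        simp [List.length_flatMap]
      rw [this, add_zero]
      norm_cast
      nlinarith
  | n + 1, rows => by
    rw [gauss]
    refine Spec.cost_le (Spec.bind (spec_findPivot rows)
      (c' := ((n + q + rows.length * (2 * (n + q)) + (3 * (n + 1) * (rows.length + n + 1) * (n + q + 1)
        + q * (2 * n + 2)) : ℕ) : ℕ∞)) fun o ho => ?_) ?_
    · rcases ho with ⟨rfl, h0⟩ | ⟨piv, rest, rfl, hp, hperm⟩
      · refine Spec.pure ⟨by simp, fun _ hk => ?_⟩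
        -- If no row involves the first unknown, the first unit vector lies in the kernel.
        have := hk (Pi.single 0 1) fun r hr => by simpa [Pi.single_apply] using h0 r hr
        simpa using congrFun this 0
      · have hlen : rows.length = rest.length + 1 := by simpa using hperm.length_eq
        refine Spec.cost_le ((runs_tabulate_const fun j => runs_div _ _).bind_spec
          ((runs_tabulate_const fun j => runs_div _ _).bind_spec
          ((runs_forEach (c := 2 * (n + q)) (g := eliminated piv) _ fun r => ?_).bind_spec
          ((spec_gauss n (rest.map (eliminated piv))).bind
            (c' := ((q * (2 * n + 2) : ℕ) : ℕ∞)) fun o ho => ?_)))) ?_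
        · refine Runs.cost_le ((runs_tabulate_const fun j => (runs_mul _ _).bind (runs_sub _ _)).bind
            ((runs_tabulate_const fun j => (runs_mul _ _).bind (runs_sub _ _)).bind (Runs.pure _))) ?_
          exact le_of_eq (by ring)
        · cases o with
          | none =>
            refine Spec.pure (uniqueSolution_congr hperm.symm ⟨by simp, fun _ hk ⟨x, hx⟩ => ?_⟩)
            exact ho.2 rfl ((trivialKernel_eliminated_iff hp).2 hk)
              ⟨_, ((isSolution_backSubstitute_iff hp x).1 hx).1⟩
          | some x =>
            refine Spec.cost_le ((runs_tabulate_const fun i =>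
              (runs_sumOver_finRange fun k => runs_mul _ _).bind (runs_sub _ _)).bind_spec
              (c' := 0) (Spec.pure (uniqueSolution_congr hperm.symm ⟨fun y hy => ?_, by simp⟩))) ?_
            · obtain rfl := Option.some.inj hy
              obtain ⟨h1, h2⟩ := ho.1 x rfl
              exact ⟨(isSolution_backSubstitute_iff hp _).2 ⟨h1, rfl⟩,
                (trivialKernel_eliminated_iff hp).1 h2⟩
            · rw [add_zero]; norm_cast; exact le_of_eq (by ring)
        · norm_cast
          rw [List.length_map, hlen]
          nlinarith [Nat.zero_le (rest.length * (n + q)), Nat.zero_le n, Nat.zero_le q]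
    · norm_cast
      nlinarith [Nat.zero_le (rows.length * (n + q)), Nat.zero_le (rows.length * q), Nat.zero_le (n * q), Nat.zero_le (rows.length * n)]

theorem spec_inverse {l : Filter ℝ} {ab : Prop} {d : ℕ} (Q : Fin d → Fin d → ℝ) :
    (inverse Q).Spec l ab ((d * d + 3 * (d + 1) * (d + d + 1) * (d + d + 1) : ℕ) : ℕ∞) (fun o =>
      (∀ X, o = some X → Matrix.of Q * Matrix.of X = 1) ∧ (o = none → ¬ IsUnit (Matrix.of Q))) := by
  rw [inverse]
  refine Spec.cost_le ((runs_tabulate₂ fun i j => runs_delta i j).bind_spec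
    ((spec_gauss d _).imp fun o ho => ?_)) ?_
  · have key : ∀ X : Fin d → Fin d → ℝ, IsSolution ((List.finRange d).map fun i => (Q i,
        fun j => (1 : Matrix (Fin d) (Fin d) ℝ) i j)) X ↔ Matrix.of Q * Matrix.of X = 1 := by
      intro X
      simp only [IsSolution, List.forall_mem_map, List.mem_finRange, true_implies]
      rw [← Matrix.ext_iff]
      simp [Matrix.mul_apply]
    refine ⟨fun X hX => (key X).1 (ho.1 X hX).1, fun h hQ => ho.2 h (fun z hz => ?_)
      ⟨((Matrix.of Q)⁻¹ : Matrix _ _ _), (key ((Matrix.of Q)⁻¹ : Matrix _ _ _)).2 (Matrix.mul_nonsing_inv _ ((Matrix.isUnit_iff_isUnit_det _).1 hQ))⟩⟩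
    refine Matrix.mulVec_injective_of_isUnit hQ ?_
    rw [Matrix.mulVec_zero]
    ext i
    simpa [Matrix.mulVec, dotProduct] using hz (Q i, _) (by simpa using ⟨i, rfl, rfl⟩)
  · norm_cast
    simp

/-! ## Random numbers and matrices -/

/-- Functions that are polynomial along every line. -/
def PolyOnLines {E : Type} [AddCommGroup E] [Module ℝ E] (F : E → ℝ) : Prop :=
  ∀ x y : E, ∃ p : Polynomial ℝ, ∀ t : ℝ, F (x + t • y) = p.eval t

namespace PolyOnLines

variable {E : Type} [AddCommGroup E] [Module ℝ E] {F F' : E → ℝ}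

theorem const (c : ℝ) : PolyOnLines fun _ : E => c := fun _ _ => ⟨Polynomial.C c, by simp⟩

theorem add (h : PolyOnLines F) (h' : PolyOnLines F') : PolyOnLines fun x => F x + F' x :=
  fun x y => by
    obtain ⟨p, hp⟩ := h x y
    obtain ⟨p', hp'⟩ := h' x y
    exact ⟨p + p', by simp [hp, hp']⟩

theorem mul (h : PolyOnLines F) (h' : PolyOnLines F') : PolyOnLines fun x => F x * F' x :=
  fun x y => by
    obtain ⟨p, hp⟩ := h x y
    obtain ⟨p', hp'⟩ := h' x y
    exact ⟨p * p', by simp [hp, hp']⟩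

theorem sub (h : PolyOnLines F) (h' : PolyOnLines F') : PolyOnLines fun x => F x - F' x := by
  simpa [sub_eq_add_neg] using h.add ((const (-1)).mul h')

theorem sum {ι : Type} (s : Finset ι) {F : ι → E → ℝ} (h : ∀ i, PolyOnLines (F i)) :
    PolyOnLines fun x => ∑ i ∈ s, F i x := by
  classical
  induction s using Finset.induction_on with
  | empty => simpa using const 0
  | insert i s hi ih => simpa [Finset.sum_insert hi] using (h i).add ih

theorem prod {ι : Type} (s : Finset ι) {F : ι → E → ℝ} (h : ∀ i, PolyOnLines (F i)) :
    PolyOnLines fun x => ∏ i ∈ s, F i x := by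
  classical
  induction s using Finset.induction_on with
  | empty => simpa using const 1
  | insert i s hi ih => simpa [Finset.prod_insert hi] using (h i).mul ih

/-- Affine maps send lines to lines; `g'` is the linear part of `g`. -/
theorem comp {E' : Type} [AddCommGroup E'] [Module ℝ E'] (h : PolyOnLines F) {g g' : E' → E}
    (hg : ∀ x y (t : ℝ), g (x + t • y) = g x + t • g' y) : PolyOnLines fun x => F (g x) :=
  fun x y => by
    obtain ⟨p, hp⟩ := h (g x) (g' y)
    exact ⟨p, fun t => by simpa only [hg] using hp t⟩

theorem det {n : ℕ} {A : E → Matrix (Fin n) (Fin n) ℝ} (h : ∀ i j, PolyOnLines fun x => A x i j) :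
    PolyOnLines fun x => (A x).det := by
  simp only [Matrix.det_apply']
  exact sum _ fun σ => (const _).mul (prod _ fun i => h _ _)

theorem adjugate {n : ℕ} {A : E → Matrix (Fin n) (Fin n) ℝ}
    (h : ∀ i j, PolyOnLines fun x => A x i j) (i j : Fin n) :
    PolyOnLines fun x => (A x).adjugate i j := by
  simp only [Matrix.adjugate_apply]
  refine det fun k l => ?_
  simp only [Matrix.updateRow_apply]
  split_ifs
  · exact const _
  · exact h k l

theorem entry {m n : ℕ} (i : Fin m) (j : Fin n) :
    PolyOnLines fun x : Matrix (Fin m) (Fin n) ℝ => x i j :=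
  fun x y => ⟨Polynomial.C (x i j) + Polynomial.C (y i j) * Polynomial.X, fun t => by simp [mul_comm t]⟩

end PolyOnLines

/-- A random program is generic if almost surely its result avoids the zeros of a polynomial. -/
def Generic (ν : Measure ℝ) {E : Type} [AddCommGroup E] [Module ℝ E] (p : Prog ℝ E) (c : ℕ) : Prop :=
  ∀ (ab : Prop) (F : E → ℝ), PolyOnLines F → (∃ x, F x ≠ 0) →
    p.Spec (ae ν) ab (c : ℕ∞) (fun x => F x ≠ 0)

/-- A nonzero polynomial in one variable has finitely many roots, and finite sets are null for a law
without atoms. -/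
theorem generic_rand (ν : Measure ℝ) [NullSingletonClass ν] : Generic ν rand 1 := by
  rintro ab F hF ⟨x, hx⟩
  obtain ⟨p, hp⟩ := hF 0 1
  refine ⟨0, by simp, ?_⟩
  have h0 : p ≠ 0 := by
    rintro rfl
    exact hx (by simpa using hp x)
  have : ν {t | p.IsRoot t} = 0 := (Polynomial.finite_setOfPred_isRoot h0).measure_zero ν
  filter_upwards [compl_mem_ae_iff.2 this] with t ht
  have := hp t
  simp only [zero_add, smul_eq_mul, mul_one] at this
  change F t ≠ 0
  rw [this]
  exact ht

/-- A Fubini argument one coordinate at a time: with a nonzero `x` fixed, the first draw avoids the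
zeros of `a ↦ F (a, x₁, ...)`, after which the tail of `x` witnesses that the remaining function is
nonzero. -/
theorem Generic.tabulate {ν : Measure ℝ} {E : Type} [AddCommGroup E] [Module ℝ E] {p : Prog ℝ E}
    {c : ℕ} (h : Generic ν p c) (n : ℕ) : Generic ν (tabulate n fun _ => p) (n * c) := by
  induction n with
  | zero =>
    rintro ab F hF ⟨x, hx⟩
    exact Spec.pure (by rwa [Subsingleton.elim Fin.elim0 x])
  | succ n ih =>
    rintro ab F hF ⟨x, hx⟩
    refine Spec.cost_le ((h ab (fun a => F (Fin.cons a fun i => x i.succ))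
      (hF.comp (g' := fun y => Fin.cons y 0) fun a b t => ?_) ⟨x 0, ?_⟩).bind fun a ha =>
      (ih ab (fun v => F (Fin.cons a v)) (hF.comp (g' := fun y => Fin.cons 0 y) fun u v t => ?_)
        ⟨_, ha⟩).bind (c' := 0) fun v hv => Spec.pure hv) ?_
    · ext i; refine Fin.cases ?_ (fun i => ?_) i <;> simp
    · rwa [show (Fin.cons (x 0) fun i => x i.succ : Fin (n + 1) → E) = x from Fin.cons_self_tail x]
    · ext i; refine Fin.cases ?_ (fun i => ?_) i <;> simp
    · norm_cast; exact le_of_eq (by ring)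

theorem spec_tabulate_rand (l : Filter ℝ) (ab : Prop) (n : ℕ) :
    (tabulate n fun _ => (rand : Prog ℝ ℝ)).Spec l ab n (fun _ => True) :=
  have h : (rand : Prog ℝ ℝ).Spec l ab 1 (fun _ => True) :=
    ⟨0, by simp, .of_forall fun _ => trivial⟩
  (spec_tabulate fun _ => h).mono
    (by simp) (by simp)

theorem spec_tabulate_rand₂ (l : Filter ℝ) (ab : Prop) (m n : ℕ) :
    (tabulate m fun _ => tabulate n fun _ => (rand : Prog ℝ ℝ)).Spec l ab ((m * n : ℕ) : ℕ∞)
      (fun _ => True) :=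
  (spec_tabulate (P := fun _ _ => True) fun _ => spec_tabulate_rand l ab n).mono
    (by simp) (by simp)

/-! ### Random invertible matrices and block matrices -/

theorem always_randGL (m N : ℕ) : (randGL m N).Spec ⊤ True ⊤ (fun W => IsUnit (Matrix.of W)) := by
  induction N with
  | zero => trivial
  | succ N ih =>
    rw [randGL]
    refine Spec.cost_le ((spec_tabulate_rand₂ _ _ m m).bind fun W _ =>
      (spec_inverse W).bind (c' := ⊤) fun o ho => ?_) le_top
    cases o with
    | none => exact ih
    | some X => exact Spec.pure (IsUnit.of_mul_eq_one _ (ho.1 X rfl))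

/-- The determinant is itself a nonzero polynomial, so almost surely the first draw is accepted.
Hence rejection adds nothing to the cost, and budget one suffices. -/
theorem spec_randGL {ν : Measure ℝ} [NullSingletonClass ν] {ab : Prop} {m N : ℕ}
    (hN : N = 0 → ab) {F : Matrix (Fin m) (Fin m) ℝ → ℝ} (hF : PolyOnLines F) (h0 : ∃ W, F W ≠ 0) :
    (randGL m N).Spec (ae ν) ab
      ((m * m + (m * m + 3 * (m + 1) * (m + m + 1) * (m + m + 1)) : ℕ) : ℕ∞)
      (fun W => F (Matrix.of W) ≠ 0) := by
  cases N with
  | zero => exact hN rfl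
  | succ N =>
    rw [randGL]
    have hg := ((generic_rand ν).tabulate m).tabulate m
    rw [mul_one] at hg
    refine Spec.cost_le (((hg ab (fun W => F W) hF h0).and (hg ab (fun W => Matrix.det W)
      (.det .entry) ⟨(1 : Matrix _ _ _), by simp⟩)).bind fun W hW =>
      (spec_inverse W).bind (c' := 0) fun o ho => ?_) ?_
    · cases o with
      | none => exact (ho.2 rfl ((Matrix.isUnit_iff_isUnit_det _).2 (isUnit_iff_ne_zero.2 hW.2))).elim
      | some X => exact Spec.pure hW.1
    · rw [add_zero]; norm_cast

/-- The matrix has the form `I_p ⊕ B`. -/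
def BlockId {d : ℕ} (p : ℕ) (A : Matrix (Fin d) (Fin d) ℝ) : Prop :=
  ∀ i j : Fin d, ((i : ℕ) < p ∨ (j : ℕ) < p) → A i j = (1 : Matrix (Fin d) (Fin d) ℝ) i j

theorem BlockId.one {d p : ℕ} : BlockId p (1 : Matrix (Fin d) (Fin d) ℝ) := fun _ _ _ => rfl

theorem BlockId.mul {d p : ℕ} {A B : Matrix (Fin d) (Fin d) ℝ} (hA : BlockId p A)
    (hB : BlockId p B) : BlockId p (A * B) := by
  rintro i j (h | h)
  · have : ∀ k, A i k = (1 : Matrix (Fin d) (Fin d) ℝ) i k := fun k => hA i k (.inl h)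
    rw [Matrix.mul_apply, ← hB i j (.inl h)]
    simp [this, Matrix.one_apply]
  · have : ∀ k, B k j = (1 : Matrix (Fin d) (Fin d) ℝ) k j := fun k => hB k j (.inr h)
    rw [Matrix.mul_apply, ← hA i j (.inr h)]
    simp [this, Matrix.one_apply]

theorem BlockId.inv {d p : ℕ} {A : Matrix (Fin d) (Fin d) ℝ} (hA : BlockId p A) (hu : IsUnit A) :
    BlockId p A⁻¹ := by
  have hd := (Matrix.isUnit_iff_isUnit_det _).1 hu
  rintro i j (h | h)
  · have : (A * A⁻¹) i j = A⁻¹ i j := by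
      have : ∀ k, A i k = (1 : Matrix (Fin d) (Fin d) ℝ) i k := fun k => hA i k (.inl h)
      rw [Matrix.mul_apply]
      simp [this, Matrix.one_apply]
    rw [← this, Matrix.mul_nonsing_inv _ hd]
  · have : (A⁻¹ * A) i j = A⁻¹ i j := by
      have : ∀ k, A k j = (1 : Matrix (Fin d) (Fin d) ℝ) k j := fun k => hA k j (.inr h)
      rw [Matrix.mul_apply]
      simp [this, Matrix.one_apply]
    rw [← this, Matrix.nonsing_inv_mul _ hd]

theorem sum_of_forall_lt_eq_zero {d p : ℕ} {g : Fin d → ℝ} (h : ∀ k : Fin d, (k : ℕ) < p → g k = 0) :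
    ∑ k, g k = ∑ c : Fin (d - p), g ⟨p + c, by omega⟩ := by
  symm
  refine Finset.sum_of_injOn (fun c : Fin (d - p) => (⟨p + c, by omega⟩ : Fin d)) ?_ ?_ ?_ ?_
  · intro a _ b _ hab
    simp only [Fin.mk.injEq] at hab
    ext; omega
  · intro a _; simp
  · intro k _ hk
    refine h k (not_le.1 fun hpk => hk ⟨⟨k - p, by omega⟩, by simp, ?_⟩)
    ext; simp; omega
  · intro _ _; rfl

/-- The matrix `I_p ⊕ W`. -/
def blockMat {d : ℕ} (p : Fin (d - 1)) (W : Fin (d - p) → Fin (d - p) → ℝ) :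
    Matrix (Fin d) (Fin d) ℝ := fun i j =>
  if h : (p : ℕ) ≤ i ∧ (p : ℕ) ≤ j then W ⟨(i : ℕ) - p, by omega⟩ ⟨(j : ℕ) - p, by omega⟩
  else (1 : Matrix (Fin d) (Fin d) ℝ) i j

theorem blockId_blockMat {d : ℕ} (p : Fin (d - 1)) (W : Fin (d - p) → Fin (d - p) → ℝ) :
    BlockId p (blockMat p W) := fun i j h => dif_neg (by omega)

theorem exists_blockMat_eq {d : ℕ} {p : Fin (d - 1)} {Z : Matrix (Fin d) (Fin d) ℝ}
    (hZ : BlockId p Z) : ∃ W, blockMat p W = Z := by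
  refine ⟨fun i j => Z ⟨p + i, by omega⟩ ⟨p + j, by omega⟩, ?_⟩
  ext i j
  rw [blockMat]
  split_ifs with h
  · congr 1 <;> ext <;> simp <;> omega
  · exact (hZ i j (by omega)).symm

/-- A kernel vector vanishes before `p` because those rows are unit vectors, and its remaining part
lies in the kernel of `W`. -/
theorem isUnit_blockMat {d : ℕ} (p : Fin (d - 1)) {W : Fin (d - p) → Fin (d - p) → ℝ}
    (hW : IsUnit (Matrix.of W)) : IsUnit (blockMat p W) := by
  refine Matrix.mulVec_injective_iff_isUnit.1 fun x y hxy => sub_eq_zero.1 ?_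
  have hz : (blockMat p W).mulVec (x - y) = 0 := by rw [Matrix.mulVec_sub]; exact sub_eq_zero.2 hxy
  generalize x - y = z at hz
  have h1 : ∀ i : Fin d, (i : ℕ) < p → z i = 0 := by
    intro i hi
    have := congrFun hz i
    have e : ∀ k, blockMat p W i k = (1 : Matrix (Fin d) (Fin d) ℝ) i k := fun k =>
      blockId_blockMat p W i k (.inl hi)
    simpa [Matrix.mulVec, dotProduct, e, Matrix.one_apply] using this
  have h2 : (fun i : Fin (d - p) => z ⟨p + i, by omega⟩) = 0 := by
    refine Matrix.mulVec_injective_of_isUnit hW ?_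
    rw [Matrix.mulVec_zero]
    ext i
    have := congrFun hz ⟨p + i, by omega⟩
    rw [Matrix.mulVec, dotProduct, sum_of_forall_lt_eq_zero (p := p) (fun k hk => by simp [h1 k hk])] at this
    simpa [Matrix.mulVec, dotProduct, blockMat] using this
  ext i
  by_cases hi : (i : ℕ) < p
  · exact h1 i hi
  · have := congrFun h2 ⟨i - p, by omega⟩
    simpa [show (p : ℕ) + (i - p) = i by omega] using this

theorem runs_blockMat {d : ℕ} (p : Fin (d - 1)) (W : Fin (d - p) → Fin (d - p) → ℝ) :
    (tabulate d fun i => tabulate d fun j =>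
      if h : (p : ℕ) ≤ i ∧ (p : ℕ) ≤ j then
        (pure (W ⟨(i : ℕ) - p, by omega⟩ ⟨(j : ℕ) - p, by omega⟩) : Prog ℝ ℝ)
      else const (if i = j then 1 else 0)).Runs (d * (d * 1)) (blockMat p W) := by
  refine runs_tabulate₂ fun i j => ?_
  rw [blockMat]
  by_cases h : (p : ℕ) ≤ i ∧ (p : ℕ) ≤ j
  · rw [dif_pos h, dif_pos h]
    exact (Runs.pure _).cost_le (by simp)
  · rw [dif_neg h, dif_neg h]
    exact runs_delta i j

theorem always_randBlock {d : ℕ} (p : Fin (d - 1)) (N : ℕ) :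
    (randBlock p N).Spec ⊤ True ⊤ (fun W => BlockId p (Matrix.of W) ∧ IsUnit (Matrix.of W)) := by
  rw [randBlock]
  exact ((always_randGL _ N).bind fun W hW =>
    (runs_blockMat p W).spec ⟨blockId_blockMat p W, isUnit_blockMat p hW⟩).cost_le le_top

/-- The map `W ↦ I_p ⊕ W` is affine with linear part extension by zero, so `F` pulls back to a
function that is polynomial on lines. A witness of block form shows that the pullback is nonzero. -/
theorem spec_randBlock_one {ν : Measure ℝ} [NullSingletonClass ν] {ab : Prop} {d : ℕ}
    (p : Fin (d - 1)) {N : ℕ} (hN : N = 0 → ab) {F : Matrix (Fin d) (Fin d) ℝ → ℝ}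
    (hF : PolyOnLines F) (h0 : ∃ Z, BlockId p Z ∧ F Z ≠ 0) :
    (randBlock p N).Spec (ae ν) ab ((60 * d ^ 3 : ℕ) : ℕ∞) (fun W =>
      BlockId p (Matrix.of W) ∧ F (Matrix.of W) ≠ 0) := by
  obtain ⟨Z, hZ, hFZ⟩ := h0
  obtain ⟨W₀, rfl⟩ := exists_blockMat_eq hZ
  rw [randBlock]
  refine Spec.cost_le ((spec_randGL hN (F := fun W => F (blockMat p W)) (hF.comp (g' := fun Y i j =>
      if h : (p : ℕ) ≤ i ∧ (p : ℕ) ≤ j then Y ⟨(i : ℕ) - p, by omega⟩ ⟨(j : ℕ) - p, by omega⟩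
      else 0) fun X Y t => ?_) ⟨W₀, hFZ⟩).bind fun W hW => (runs_blockMat p W).spec ⟨blockId_blockMat p W, hW⟩) ?_
  · ext i j
    change _ = blockMat p X i j + t * _
    simp only [blockMat, Matrix.add_apply, Matrix.smul_apply]
    split_ifs <;> simp
  · norm_cast
    have h1 : d - p ≤ d := Nat.sub_le _ _
    have h2 : 1 ≤ d := by have := p.2; omega
    generalize d - (p : ℕ) = m at h1
    calc _ ≤ d * d + (d * d + 3 * (d + d) * (d + d + d) * (d + d + d)) + d * (d * 1) := by gcongr
      _ ≤ 60 * d ^ 3 := by nlinarith [Nat.mul_le_mul_left (d * d) h2]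

/-- A random block matrix is generic. -/
theorem spec_randBlock {ν : Measure ℝ} [NullSingletonClass ν] {ab : Prop} {d : ℕ}
    (p : Fin (d - 1)) {N : ℕ} (hN : N = 0 → ab) {ι : Type} [Finite ι]
    {F : ι → Matrix (Fin d) (Fin d) ℝ → ℝ}
    (hF : ∀ i, PolyOnLines (F i)) (h0 : ∀ i, ∃ Z, BlockId p Z ∧ F i Z ≠ 0) :
    (randBlock p N).Spec (ae ν) ab ((60 * d ^ 3 : ℕ) : ℕ∞) (fun W =>
      BlockId p (Matrix.of W) ∧ IsUnit (Matrix.of W) ∧ ∀ i, F i (Matrix.of W) ≠ 0) := by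
  have h2 := spec_randBlock_one (ν := ν) (ab := ab) p hN (F := Matrix.det) (.det .entry)
    ⟨1, .one, by simp⟩
  have h3 : (randBlock p N).Spec (ae ν) ab ((60 * d ^ 3 : ℕ) : ℕ∞)
      (fun W => ∀ i, F i (Matrix.of W) ≠ 0) := by
    cases isEmpty_or_nonempty ι with
    | inl h => exact h2.imp fun W _ => h.elim
    | inr h => exact Spec.forall h fun i => (spec_randBlock_one p hN (hF i) (h0 i)).imp fun _ h => h.2
  exact (h2.and h3).imp fun W hW => ⟨hW.1.1,
    (Matrix.isUnit_iff_isUnit_det _).2 (isUnit_iff_ne_zero.2 hW.1.2), hW.2⟩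

open Matrix

/-! ## The core tensor as a trilinear form -/

section CoreForm

variable {d : ℕ}

/-- The trilinear form of a tensor. -/
noncomputable def triForm (T : Tensor d ℝ) :
    (Fin d → ℝ) →ₗ[ℝ] (Fin d → ℝ) →ₗ[ℝ] (Fin d → ℝ) →ₗ[ℝ] ℝ :=
  ∑ a, ∑ b, ∑ c, T a b c • (LinearMap.proj a).smulRight
    ((LinearMap.proj b).smulRight (LinearMap.proj c : (Fin d → ℝ) →ₗ[ℝ] ℝ))

theorem triForm_apply (T : Tensor d ℝ) (f g h : Fin d → ℝ) :
    triForm T f g h = ∑ a, ∑ b, ∑ c, T a b c * f a * g b * h c := by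
  simp [triForm, LinearMap.sum_apply, mul_assoc]

theorem congruence_apply (A : Matrix (Fin d) (Fin d) ℝ) (T : Tensor d ℝ) (i j k : Fin d) :
    congruence A T i j k = triForm T (A i) (A j) (A k) := by
  rw [triForm_apply]; rfl

theorem vecMul_eq_sum_rows (f : Fin d → ℝ) (A : Matrix (Fin d) (Fin d) ℝ) :
    f ᵥ* A = ∑ i, f i • A i := by
  ext j; simp [vecMul, dotProduct]

/-- Congruence is the substitution `f ↦ f A` in the trilinear form. This makes it an action and lets
tensor entries be read as values of the core form on rows. -/
theorem triForm_congruence (A : Matrix (Fin d) (Fin d) ℝ) (T : Tensor d ℝ) (f g h : Fin d → ℝ) :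
    triForm (congruence A T) f g h = triForm T (f ᵥ* A) (g ᵥ* A) (h ᵥ* A) := by
  have h₁ : ∀ G H, triForm T (f ᵥ* A) G H = ∑ i, f i * triForm T (A i) G H := fun G H => by
    simp [vecMul_eq_sum_rows, LinearMap.sum_apply]
  have h₂ : ∀ F H, triForm T F (g ᵥ* A) H = ∑ i, g i * triForm T F (A i) H := fun F H => by
    simp [vecMul_eq_sum_rows, LinearMap.sum_apply]
  have h₃ : ∀ F G, triForm T F G (h ᵥ* A) = ∑ i, h i * triForm T F G (A i) := fun F G => by
    simp [vecMul_eq_sum_rows]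
  simp only [triForm_apply (congruence A T), congruence_apply, h₁, h₂, h₃, Finset.mul_sum]
  exact Finset.sum_congr rfl fun a _ => Finset.sum_congr rfl fun b _ =>
      Finset.sum_congr rfl fun c _ => by ring

theorem congruence_mul (A B : Matrix (Fin d) (Fin d) ℝ) (T : Tensor d ℝ) :
    congruence (A * B) T = congruence A (congruence B T) := by
  ext i j k
  rw [congruence_apply, congruence_apply, triForm_congruence]
  rfl

/-- The core form, antisymmetrized in the first two arguments. -/
noncomputable def skewForm (d : ℕ) : (Fin d → ℝ) →ₗ[ℝ] (Fin d → ℝ) →ₗ[ℝ] (Fin d → ℝ) →ₗ[ℝ] ℝ :=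
  triForm fun a b c => coreTensor d a b c - coreTensor d b a c

theorem skewForm_apply (f g h : Fin d → ℝ) : skewForm d f g h =
    triForm (coreTensor d) f g h - triForm (coreTensor d) g f h := by
  rw [skewForm, triForm_apply, triForm_apply, triForm_apply, Finset.sum_comm (f := fun a b =>
    ∑ c, coreTensor d a b c * g a * f b * h c)]
  simp only [← Finset.sum_sub_distrib]
  exact Finset.sum_congr rfl fun a _ => Finset.sum_congr rfl fun b _ =>
    Finset.sum_congr rfl fun c _ => by ring

theorem congruence_sub_swap (A : Matrix (Fin d) (Fin d) ℝ) (i j k : Fin d) :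
    congruence A (coreTensor d) i j k - congruence A (coreTensor d) j i k =
      skewForm d (A i) (A j) (A k) := by
  rw [congruence_apply, congruence_apply, skewForm_apply]

theorem skewForm_swap (f g h : Fin d → ℝ) : skewForm d g f h = -skewForm d f g h := by
  rw [skewForm_apply, skewForm_apply]; ring

theorem skewForm_self (f h : Fin d → ℝ) : skewForm d f f h = 0 := by
  rw [skewForm_apply]; ring

/-- The sum of the entries before the index `j`. -/
def prefixSum (f : Fin d → ℝ) (j : Fin d) : ℝ := ∑ i ∈ Finset.Iio j, f i

/-- The coefficients of the bilinear form `skewForm d · · h`. -/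
def coreWeight (j : Fin d) : (Fin d → ℝ) →ₗ[ℝ] ℝ where
  toFun h := 3 * h j + 6 * ∑ i ∈ Finset.Ioi j, h i
  map_add' f g := by simp [Finset.sum_add_distrib]; ring
  map_smul' c f := by simp [← Finset.mul_sum]; ring

theorem coreWeight_apply (j : Fin d) (h : Fin d → ℝ) :
    coreWeight j h = 3 * h j + 6 * ∑ i ∈ Finset.Ioi j, h i := rfl

/-- For `a < b` the slice of the core tensor depends on `b` only: it is 3 at `c = b` and 6 beyond.
This independence of `a` is what produces prefix sums below. -/
theorem sum_coreTensor_of_lt {a b : Fin d} (hab : a < b) (h : Fin d → ℝ) :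
    ∑ c, coreTensor d a b c * h c = coreWeight b h := by
  have : ∀ c, coreTensor d a b c * h c = (if c = b then 3 * h c else 0) + if b < c then 6 * h c else 0 := by
    intro c
    rcases lt_trichotomy b c with hc | rfl | hc
    · simp [coreTensor, hab.ne, hc, hc.ne, hc.ne', hab]
    · simp [coreTensor, hab.ne, hab]
    · simp [coreTensor, hab.ne, hc.ne, hc.ne', hc.not_gt]
  simp only [this, Finset.sum_add_distrib, Finset.sum_ite_eq', Finset.mem_univ, if_true,
    coreWeight_apply]
  rw [← Finset.sum_filter, Finset.mul_sum]
  congr 2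
  ext; simp

theorem coreTensor_of_gt {a b : Fin d} (hab : b < a) (c : Fin d) : coreTensor d a b c = 0 := by
  simp [coreTensor, hab.ne', hab.not_gt]

/-- The pair `a, b` contributes only for `a < b`, since the core tensor vanishes for decreasing
first indices and the diagonal cancels. Its coefficient is the weight of `b`, so summing over `a`
leaves prefix sums. -/
theorem skewForm_eq_sum (f g h : Fin d → ℝ) : skewForm d f g h =
    ∑ j, coreWeight j h * (prefixSum f j * g j - f j * prefixSum g j) := by
  have key : ∀ a b, ∑ c, (coreTensor d a b c * f a * g b * h c - coreTensor d a b c * g a * f b * h c) =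
      if a < b then coreWeight b h * (f a * g b - f b * g a) else 0 := by
    intro a b
    have : ∀ c, coreTensor d a b c * f a * g b * h c - coreTensor d a b c * g a * f b * h c =
      coreTensor d a b c * h c * (f a * g b - f b * g a) := fun c => by ring
    simp only [this, ← Finset.sum_mul]
    rcases lt_trichotomy a b with hab | rfl | hab
    · rw [sum_coreTensor_of_lt hab, if_pos hab]
    · simp
    · simp [coreTensor_of_gt hab, hab.not_gt]
  rw [skewForm_apply, triForm_apply, triForm_apply]
  simp only [← Finset.sum_sub_distrib, key]
  rw [Finset.sum_comm]
  refine Finset.sum_congr rfl fun b _ => ?_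
  rw [← Finset.sum_filter, ← Finset.mul_sum, Finset.sum_sub_distrib, ← Finset.sum_mul, ← Finset.mul_sum]
  congr 3 <;> (simp only [prefixSum]; congr 1; ext; simp)

/-- The vector vanishes before the index `p`. -/
def VanishesBelow (p : ℕ) (f : Fin d → ℝ) : Prop := ∀ i : Fin d, (i : ℕ) < p → f i = 0

theorem VanishesBelow.single {p : ℕ} {j : Fin d} (hj : p ≤ j) (x : ℝ) :
    VanishesBelow p (Pi.single j x : Fin d → ℝ) := fun i hi => by
  rw [Pi.single_apply, if_neg]; rintro rfl; omega

theorem VanishesBelow.prefixSum {p : ℕ} {f : Fin d → ℝ} (hf : VanishesBelow p f) {j : Fin d}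
    (hj : (j : ℕ) ≤ p) : prefixSum f j = 0 :=
  Finset.sum_eq_zero fun i hi => hf i (by have : i < j := by simpa using hi
                                          omega)

theorem prefixSum_single (i j : Fin d) (x : ℝ) :
    prefixSum (Pi.single i x) j = if i < j then x else 0 := by
  simp [prefixSum, Pi.single_apply]

theorem coreWeight_single_of_lt {i j : Fin d} (h : i < j) (x : ℝ) :
    coreWeight j (Pi.single i x) = 0 := by
  simp [coreWeight_apply, Pi.single_apply, h.ne', h.not_gt]

/-- Up to `p` the prefix sums vanish, and beyond `p` the weights of `e_p` vanish. Thus `e_p` is the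
direction that the linear system detects. -/
theorem skewForm_single_right_eq_zero {p : Fin d} {f g : Fin d → ℝ} (hf : VanishesBelow p f)
    (hg : VanishesBelow p g) (x : ℝ) : skewForm d f g (Pi.single p x) = 0 := by
  rw [skewForm_eq_sum]
  refine Finset.sum_eq_zero fun j _ => ?_
  rcases lt_or_ge p j with h | h
  · rw [coreWeight_single_of_lt h, zero_mul]
  · rw [hf.prefixSum (by simpa using h), hg.prefixSum (by simpa using h)]; ring

theorem skewForm_single_single {i j : Fin d} (hij : i < j) (h : Fin d → ℝ) :
    skewForm d (Pi.single i 1) (Pi.single j 1) h = coreWeight j h := by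
  rw [skewForm_eq_sum, Finset.sum_eq_single j]
  · simp [prefixSum_single, hij, hij.ne]
  · intro k _ hk
    rcases lt_or_ge i k with h | h
    · simp [prefixSum_single, hk, h.ne']
    · simp [prefixSum_single, Pi.single_apply, hk, h.not_gt, (h.trans_lt hij).not_gt]
  · simp

theorem skewForm_single_middle (v h : Fin d → ℝ) (j : Fin d) :
    skewForm d v (Pi.single j 1) h =
      coreWeight j h * prefixSum v j - ∑ i ∈ Finset.Ioi j, coreWeight i h * v i := by
  rw [skewForm_eq_sum]
  simp only [mul_sub, Finset.sum_sub_distrib, prefixSum_single]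
  congr 1
  · simp [Pi.single_apply]
  · simp only [mul_ite, mul_one, mul_zero]
    rw [← Finset.sum_filter]
    congr 1; ext; simp

/-- The weights are triangular with diagonal 3, so back substitution from the last index applies. -/
theorem eq_zero_of_coreWeight_eq_zero {p : Fin d} {h : Fin d → ℝ}
    (h0 : ∀ j, p < j → coreWeight j h = 0) : ∀ j, p < j → h j = 0 := by
  intro j
  induction j using WellFoundedGT.induction with
  | ind j ih =>
    intro hj
    have h1 := h0 j hj
    rw [coreWeight_apply, Finset.sum_eq_zero fun i hi => ih i (by simpa using hi)
      (hj.trans (by simpa using hi))] at h1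
    linarith

/-- Descending in `j`, the equation for `e_j` reduces to weight times prefix sum, which settles `j ≥
p + 2`. At `j = p + 1` the equation for `e_p` supplies weight times `v j` as well; if both factors
vanished, so would the prefix sum at `p + 2`. -/
theorem coreWeight_eq_zero_of_skewForm {p : Fin d} (hp : (p : ℕ) + 2 < d) {v h : Fin d → ℝ}
    (hv : VanishesBelow p v) (hpre : ∀ j : Fin d, (p : ℕ) + 2 ≤ j → prefixSum v j ≠ 0)
    (h0 : ∀ j, p ≤ j → skewForm d v (Pi.single j 1) h = 0) : ∀ j, p < j → coreWeight j h = 0 := by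
  intro j
  induction j using WellFoundedGT.induction with
  | ind j ih =>
    intro hj
    have tail : ∀ i, i ∈ Finset.Ioi j → coreWeight i h * v i = 0 := fun i hi => by
      rw [ih i (by simpa using hi) (hj.trans (by simpa using hi)), zero_mul]
    have h1 := h0 j hj.le
    rw [skewForm_single_middle, Finset.sum_eq_zero tail, sub_zero] at h1
    by_cases hj2 : (p : ℕ) + 2 ≤ j
    · exact (mul_eq_zero.1 h1).resolve_right (hpre j hj2)
    · have hjp : (j : ℕ) = p + 1 := by have : (p : ℕ) < j := hj; omega
      have h2 := h0 p le_rfl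
      rw [skewForm_single_middle, hv.prefixSum le_rfl, mul_zero, zero_sub, neg_eq_zero,
        Finset.sum_eq_single_of_mem j (by simpa using hj)] at h2
      · by_contra hne
        have e1 : prefixSum v j = 0 := (mul_eq_zero.1 h1).resolve_left hne
        have e2 : v j = 0 := (mul_eq_zero.1 h2).resolve_left hne
        refine hpre ⟨p + 2, hp⟩ le_rfl ?_
        have : Finset.Iio (⟨p + 2, hp⟩ : Fin d) = insert j (Finset.Iio j) := by
          ext i; simp [Fin.lt_def]; omega
        rw [prefixSum, this, Finset.sum_insert (by simp), e2, zero_add]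
        exact e1
      · intro i hi hij
        refine tail i ?_
        simp only [Finset.mem_Ioi, Fin.lt_def] at hi ⊢
        have : (i : ℕ) ≠ j := fun h => hij (Fin.ext h)
        omega

end CoreForm

/-! ## Recovering the first row of a block -/

section Blocks

variable {d : ℕ}

theorem BlockId.vanishesBelow {p : ℕ} {B : Matrix (Fin d) (Fin d) ℝ} (hB : BlockId p B) {a : Fin d}
    (ha : p ≤ a) : VanishesBelow p (B a) := fun i hi => by
  rw [hB a i (.inr hi), one_apply_ne]; rintro rfl; omega

theorem BlockId.vanishesBelow_vecMul {p : ℕ} {B : Matrix (Fin d) (Fin d) ℝ} (hB : BlockId p B)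
    {w : Fin d → ℝ} (hw : VanishesBelow p w) : VanishesBelow p (w ᵥ* B) := fun i hi => by
  change ∑ a, w a * B a i = 0
  refine Finset.sum_eq_zero fun a _ => ?_
  rcases lt_or_ge (a : ℕ) p with ha | ha
  · rw [hw a ha, zero_mul]
  · rw [hB.vanishesBelow ha i hi, mul_zero]

theorem VanishesBelow.mono {p q : ℕ} {w : Fin d → ℝ} (hw : VanishesBelow q w) (h : p ≤ q) :
    VanishesBelow p w := fun i hi => hw i (hi.trans_le h)

theorem inv_row_vecMul {B : Matrix (Fin d) (Fin d) ℝ} (hu : IsUnit B) (j : Fin d) :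
    B⁻¹ j ᵥ* B = Pi.single j 1 := by
  have := congrFun (nonsing_inv_mul B ((isUnit_iff_isUnit_det _).1 hu)) j
  refine Eq.trans this ?_
  ext i
  simp [one_apply, Pi.single_apply, eq_comm]

theorem map_vecMul_eq_zero {p : Fin d} {B : Matrix (Fin d) (Fin d) ℝ} {u : Fin d → ℝ}
    (hu : VanishesBelow (p + 1) u) {φ : (Fin d → ℝ) →ₗ[ℝ] ℝ} (h : ∀ b, p < b → φ (B b) = 0) :
    φ (u ᵥ* B) = 0 := by
  rw [vecMul_eq_sum_rows, map_sum]
  refine Finset.sum_eq_zero fun b _ => ?_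
  rw [map_smul]
  rcases lt_or_ge p b with hb | hb
  · rw [h b hb, smul_zero]
  · rw [hu b (by have : (b : ℕ) ≤ p := hb
                 omega), zero_smul]

/-- Row `j` of `B⁻¹` expresses `e_j` by the rows of `B`; subtracting a multiple of row `p` of `B⁻¹`
removes the use of `B p`. So the span of the later rows is described by the ratios `B⁻¹ j p / B⁻¹ p
p`. -/
theorem exists_vecMul_eq_single {p j : Fin d} (hj : p ≤ j) {B : Matrix (Fin d) (Fin d) ℝ}
    (hB : BlockId p B) (hu : IsUnit B) (h0 : B⁻¹ p p ≠ 0) : ∃ u, VanishesBelow (p + 1) u ∧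
      u ᵥ* B = Pi.single j 1 - (B⁻¹ j p / B⁻¹ p p) • (Pi.single p 1 : Fin d → ℝ) := by
  refine ⟨B⁻¹ j - (B⁻¹ j p / B⁻¹ p p) • B⁻¹ p, fun i hi => ?_, ?_⟩
  · rcases Nat.lt_succ_iff_lt_or_eq.1 hi with h | h
    · simp [(hB.inv hu).vanishesBelow (Fin.le_def.1 hj) i h, (hB.inv hu).vanishesBelow le_rfl i h]
    · obtain rfl := Fin.ext h
      simp [h0]
  · rw [sub_vecMul, smul_vecMul, inv_row_vecMul hu, inv_row_vecMul hu]

/-- Vanishing weights make `w B` a multiple of `e_p`, hence `w` a multiple of `B⁻¹ p`; but `w p = 0`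
while `B⁻¹ p p ≠ 0`. -/
theorem eq_zero_of_coreWeight_vecMul {p : Fin d} {B : Matrix (Fin d) (Fin d) ℝ} (hB : BlockId p B)
    (hu : IsUnit B) (h0 : B⁻¹ p p ≠ 0) {w : Fin d → ℝ} (hw : VanishesBelow (p + 1) w)
    (h : ∀ j, p < j → coreWeight j (w ᵥ* B) = 0) : w = 0 := by
  have h1 := eq_zero_of_coreWeight_eq_zero h
  have h2 := hB.vanishesBelow_vecMul (hw.mono (Nat.le_succ _))
  have h3 : w ᵥ* B = (w ᵥ* B) p • (Pi.single p 1 : Fin d → ℝ) := by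
    ext i
    rcases lt_trichotomy i p with hi | rfl | hi
    · rw [h2 i hi]; simp [hi.ne]
    · simp
    · rw [h1 i hi]; simp [hi.ne']
  have h4 : w = (w ᵥ* B) p • B⁻¹ p := by
    have := congrArg (· ᵥ* B⁻¹) h3
    simp only [vecMul_vecMul, mul_nonsing_inv B ((isUnit_iff_isUnit_det _).1 hu), vecMul_one,
      smul_vecMul, single_one_vecMul] at this
    exact this
  have h5 : (w ᵥ* B) p = 0 := by
    have := congrFun h4 p
    rw [hw p (Nat.lt_succ_self _)] at this
    simpa [h0] using this.symm
  rw [h4, h5, zero_smul]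

/-- The rows after `p` span a space on which no nonzero element is annihilated by the core form. -/
def InjectiveAt (p : Fin d) (B : Matrix (Fin d) (Fin d) ℝ) : Prop :=
  ∀ w, VanishesBelow (p + 1) w →
    (∀ a b, p < a → p < b → skewForm d (B a) (B b) (w ᵥ* B) = 0) → w = 0

/-- If `B⁻¹ p p` were zero, `e_p` would be a combination of the later rows and thus an annihilated
element of their span. -/
theorem InjectiveAt.inv_ne_zero {p : Fin d} {B : Matrix (Fin d) (Fin d) ℝ} (h : InjectiveAt p B)
    (hB : BlockId p B) (hu : IsUnit B) : B⁻¹ p p ≠ 0 := by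
  intro h0
  have h1 : B⁻¹ p = 0 := by
    refine h _ (fun i hi => ?_) fun a b ha hb => ?_
    · rcases Nat.lt_succ_iff_lt_or_eq.1 hi with h | h
      · exact (hB.inv hu).vanishesBelow le_rfl i h
      · rwa [Fin.ext h]
    · rw [inv_row_vecMul hu]
      exact skewForm_single_right_eq_zero (hB.vanishesBelow (Fin.le_def.1 ha.le)) (hB.vanishesBelow (Fin.le_def.1 hb.le)) _
  have := congrFun (inv_row_vecMul hu p) p
  simp [h1] at this

/-- The prefix sum at `j` is not identically zero on the later rows: otherwise an element of their
span whose only nonzero weight sits at `j` would be annihilated by all pairs. -/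
theorem InjectiveAt.exists_prefixSum_ne_zero {p : Fin d} {B : Matrix (Fin d) (Fin d) ℝ}
    (h : InjectiveAt p B) (hB : BlockId p B) (hu : IsUnit B) {j : Fin d} (hj : p < j) :
    ∃ a, p < a ∧ prefixSum (B a) j ≠ 0 := by
  by_contra! hpre
  have h0 := h.inv_ne_zero hB hu
  -- This square system prescribes the coordinates of `w` up to `p` and the weights of `w B` after
  -- `p`. It is injective, hence surjective, which produces that element.
  let Ψ : (Fin d → ℝ) →ₗ[ℝ] (Fin d → ℝ) := LinearMap.pi fun i =>
    if (i : ℕ) < p + 1 then LinearMap.proj i else (coreWeight i).comp (Matrix.vecMulLinear B)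
  have hΨ : ∀ w i, Ψ w i = if (i : ℕ) < p + 1 then w i else coreWeight i (w ᵥ* B) := by
    intro w i
    simp only [Ψ, LinearMap.pi_apply]
    split_ifs <;> rfl
  have hlow : ∀ w, (∀ i : Fin d, (i : ℕ) < p + 1 → Ψ w i = 0) → VanishesBelow (p + 1) w := by
    intro w hw i hi
    simpa [hΨ, hi] using hw i hi
  have hweight : ∀ w i, p < i → Ψ w i = coreWeight i (w ᵥ* B) := by
    intro w i hi
    rw [hΨ, if_neg (by have : (p : ℕ) < i := hi
                       omega)]
  have hinj : Function.Injective Ψ := by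
    refine (injective_iff_map_eq_zero Ψ).2 fun w hw => ?_
    refine eq_zero_of_coreWeight_vecMul hB hu h0 (hlow w fun i _ => by rw [hw]; rfl) fun i hi => ?_
    rw [← hweight w i hi, hw]; rfl
  obtain ⟨w, hw⟩ := LinearMap.surjective_of_injective hinj (Pi.single j 1)
  have hw0 : w = 0 := by
    refine h w (hlow w fun i hi => ?_) fun a b ha hb => ?_
    · rw [hw, Pi.single_apply, if_neg]
      rintro rfl
      rw [Fin.lt_def] at hj; omega
    · rw [skewForm_eq_sum]
      refine Finset.sum_eq_zero fun i _ => ?_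
      rcases lt_or_ge p i with hi | hi
      · rw [← hweight w i hi, hw, Pi.single_apply]
        split_ifs with hij
        · rw [hij, hpre a ha, hpre b hb]; ring
        · ring
      · rw [(hB.vanishesBelow (Fin.le_def.1 ha.le)).prefixSum (Fin.le_def.1 hi),
          (hB.vanishesBelow (Fin.le_def.1 hb.le)).prefixSum (Fin.le_def.1 hi)]
        ring
  rw [hw0, map_zero] at hw
  simpa using congrFun hw j

/-- Both `e_p + x` and the normalized row `B⁻¹ p / B⁻¹ p p` have coefficient 1 at `p` and solve the
equations, so injectivity makes them equal. -/
theorem InjectiveAt.eq_of_skewForm {p : Fin d} {B : Matrix (Fin d) (Fin d) ℝ}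
    (h : InjectiveAt p B) (hB : BlockId p B) (hu : IsUnit B) {x : Fin d → ℝ}
    (hx : VanishesBelow (p + 1) x)
    (h0 : ∀ a b, p < a → p < b → skewForm d (B a) (B b) (B p + x ᵥ* B) = 0) :
    B p + x ᵥ* B = (B⁻¹ p p)⁻¹ • (Pi.single p 1 : Fin d → ℝ) := by
  have hne := h.inv_ne_zero hB hu
  have hBp : B p = Pi.single p 1 ᵥ* B := by simp; rfl
  have h1 : Pi.single p 1 + x - (B⁻¹ p p)⁻¹ • B⁻¹ p = 0 := by
    refine h _ (fun i hi => ?_) fun a b ha hb => ?_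
    · rcases Nat.lt_succ_iff_lt_or_eq.1 hi with h | h
      · have : i ≠ p := by rintro rfl; omega
        simp [(hB.inv hu).vanishesBelow le_rfl i h, hx i hi, this]
      · obtain rfl := Fin.ext h
        simp [hne, hx i hi]
    · rw [sub_vecMul, add_vecMul, ← hBp, smul_vecMul, inv_row_vecMul hu, map_sub, h0 a b ha hb,
        map_smul, skewForm_single_right_eq_zero (hB.vanishesBelow (Fin.le_def.1 ha.le)) (hB.vanishesBelow (Fin.le_def.1 hb.le))]
      simp
  have h2 := congrArg (· ᵥ* B) (sub_eq_zero.1 h1)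
  simpa only [add_vecMul, ← hBp, smul_vecMul, inv_row_vecMul hu] using h2

theorem exists_skewForm_eq_zero {p : Fin d} {B : Matrix (Fin d) (Fin d) ℝ}
    (hB : BlockId p B) (hu : IsUnit B) (hne : B⁻¹ p p ≠ 0) : ∃ x, VanishesBelow (p + 1) x ∧
      ∀ a b, p < a → p < b → skewForm d (B a) (B b) (B p + x ᵥ* B) = 0 := by
  have hBp : B p = Pi.single p 1 ᵥ* B := by simp; rfl
  refine ⟨(B⁻¹ p p)⁻¹ • B⁻¹ p - Pi.single p 1, fun i hi => ?_, fun a b ha hb => ?_⟩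
  · rcases Nat.lt_succ_iff_lt_or_eq.1 hi with h | h
    · have : i ≠ p := by rintro rfl; omega
      simp [(hB.inv hu).vanishesBelow le_rfl i h, this]
    · obtain rfl := Fin.ext h
      simp [hne]
  · rw [sub_vecMul, ← hBp, add_sub_cancel, smul_vecMul, inv_row_vecMul hu, map_smul,
      skewForm_single_right_eq_zero (hB.vanishesBelow (Fin.le_def.1 ha.le)) (hB.vanishesBelow (Fin.le_def.1 hb.le)), smul_zero]

/-- Two generic combinations of the equations determine the solution. -/
theorem InjectiveAt.exists_combination {p : Fin d} (hp : (p : ℕ) + 2 < d)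
    {B : Matrix (Fin d) (Fin d) ℝ}
    (h : InjectiveAt p B) (hB : BlockId p B) (hu : IsUnit B) {v : Fin d → ℝ}
    (hv : VanishesBelow (p + 1) v)
    (hpre : ∀ j : Fin d, (p : ℕ) + 2 ≤ j → prefixSum (v ᵥ* B) j ≠ 0) :
    ∃ (φ : (Fin d → ℝ) →ₗ[ℝ] ℝ) (a₀ : Fin d), p < a₀ ∧ φ (B a₀) ≠ 0 ∧ ∀ v', φ v' ≠ 0 →
      ∀ w, VanishesBelow (p + 1) w → (∀ b, p < b → skewForm d (v ᵥ* B) (B b) (w ᵥ* B) = 0) →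
        (∀ b, p < b → skewForm d v' (B b) (w ᵥ* B) = 0) → w = 0 := by
  have hne := h.inv_ne_zero hB hu
  have hvp := hB.vanishesBelow_vecMul (hv.mono (Nat.le_succ _))
  set f := v ᵥ* B with hf
  -- Adding `e_p` to the later rows spans all `e_j` with `j ≥ p`. So a solution of the first family
  -- of equations is determined by the single number `skewForm d f e_p (w B)`, and these solutions
  -- form a space of dimension at most one.
  have key : ∀ w, VanishesBelow (p + 1) w → (∀ b, p < b → skewForm d f (B b) (w ᵥ* B) = 0) →
      skewForm d f (Pi.single p 1) (w ᵥ* B) = 0 → w = 0 := by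
    intro w hw h1 h2
    refine eq_zero_of_coreWeight_vecMul hB hu hne hw (coreWeight_eq_zero_of_skewForm hp hvp hpre ?_)
    intro j hj
    obtain ⟨u, hu', hj'⟩ := exists_vecMul_eq_single hj hB hu hne
    have h3 := map_vecMul_eq_zero (B := B) hu' (φ := (skewForm d f).flip (w ᵥ* B)) h1
    rw [hj', map_sub, map_smul] at h3
    simpa [h2] using h3
  have hex : ∀ w, VanishesBelow (p + 1) w → w ≠ 0 →
      ∃ a b, p < a ∧ p < b ∧ skewForm d (B a) (B b) (w ᵥ* B) ≠ 0 := by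
    intro w hw hw0
    by_contra! hc
    exact hw0 (h w hw hc)
  by_cases hsol : ∃ w, VanishesBelow (p + 1) w ∧ w ≠ 0 ∧
      ∀ b, p < b → skewForm d f (B b) (w ᵥ* B) = 0
  · obtain ⟨w₀, hw₀, hne₀, hs₀⟩ := hsol
    obtain ⟨a, b, ha, hb, hab⟩ := hex w₀ hw₀ hne₀
    refine ⟨((skewForm d).flip (B b)).flip (w₀ ᵥ* B), a, ha, hab, fun v' hv' w hw h1 h2 => ?_⟩
    set μ := skewForm d f (Pi.single p 1) (w ᵥ* B) with hμ
    set μ₀ := skewForm d f (Pi.single p 1) (w₀ ᵥ* B) with hμ₀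
    have hμ₀0 : μ₀ ≠ 0 := fun h => hne₀ (key w₀ hw₀ hs₀ h)
    -- Any other solution is proportional to `w₀`, so it suffices that the second combination
    -- excludes the line of `w₀`.
    have hcomb : μ₀ • w - μ • w₀ = 0 := by
      refine key _ (fun i hi => by simp [hw i hi, hw₀ i hi]) (fun b hb => ?_) ?_
      · rw [sub_vecMul, smul_vecMul, smul_vecMul, map_sub, map_smul, map_smul, h1 b hb, hs₀ b hb]
        simp
      · rw [sub_vecMul, smul_vecMul, smul_vecMul, map_sub, map_smul, map_smul, ← hμ, ← hμ₀]
        simp [mul_comm]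
    have h3 : μ₀ * skewForm d v' (B b) (w ᵥ* B) = μ * skewForm d v' (B b) (w₀ ᵥ* B) := by
      have := congrArg (fun w => skewForm d v' (B b) (w ᵥ* B)) (sub_eq_zero.1 hcomb)
      simpa only [smul_vecMul, map_smul, smul_eq_mul] using this
    rw [h2 b hb, mul_zero] at h3
    have hμ0 : μ = 0 := (mul_eq_zero.1 h3.symm).resolve_right hv'
    exact key w hw h1 hμ0
  -- The first family alone forces `w = 0`. Any functional that is nonzero on a later row will do,
  -- and `e_{p+1}` supplies one.
  · push Not at hsol
    have h1 : VanishesBelow (p + 1) (Pi.single (⟨p + 1, by omega⟩ : Fin d) 1 : Fin d → ℝ) :=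
      .single (j := ⟨p + 1, by omega⟩) le_rfl 1
    obtain ⟨a, b, ha, hb, hab⟩ := hex _ h1 (by simp)
    refine ⟨((skewForm d).flip (B b)).flip _, a, ha, hab, fun v' _ w hw h1 _ => ?_⟩
    by_contra hw0
    obtain ⟨b, hb, hb0⟩ := hsol w hw hw0
    exact hb0 (h1 b hb)

/-- The vectors `e_j - r j e_p` lie in the span of the later rows, so an annihilated element yields
linear relations between its weights. Three later indices are needed to eliminate two of them, which
is why these steps stop at four remaining indices. -/
theorem injectiveAt_of_inv {p i₁ i₃ : Fin d} (h₁ : (i₁ : ℕ) = p + 1) (h₃ : (i₃ : ℕ) = p + 3)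
    {B : Matrix (Fin d) (Fin d) ℝ} (hB : BlockId p B) (hu : IsUnit B)
    (hne : B⁻¹ p p ≠ 0) (hne₁ : B⁻¹ i₁ p ≠ B⁻¹ p p) (hne₃ : B⁻¹ i₃ p ≠ 0) : InjectiveAt p B := by
  intro w hw h
  refine eq_zero_of_coreWeight_vecMul hB hu hne hw ?_
  set h' := w ᵥ* B
  set n := fun j => coreWeight j h'
  set r := fun j => B⁻¹ j p / B⁻¹ p p
  -- This is the form on `e_i - r i e_p` and `e_j - r j e_p`, expanded with `skewForm d e_i e_j h' =
  -- n j` for `i < j`.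
  have key : ∀ i j, p < i → i < j → n j + r j * n i - r i * n j = 0 := by
    intro i j hi hj
    obtain ⟨u, hu₁, hi'⟩ := exists_vecMul_eq_single hi.le hB hu hne
    obtain ⟨v, hv₁, hj'⟩ := exists_vecMul_eq_single (hi.trans hj).le hB hu hne
    have h1 : skewForm d (u ᵥ* B) (v ᵥ* B) h' = 0 :=
      map_vecMul_eq_zero (φ := (skewForm d (u ᵥ* B)).flip h') hv₁ fun b hb =>
        map_vecMul_eq_zero (φ := ((skewForm d).flip (B b)).flip h') hu₁ fun a ha => h a b ha hb
    rw [hi', hj'] at h1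
    simp only [map_sub, map_smul, LinearMap.sub_apply, LinearMap.smul_apply, smul_eq_mul,
      skewForm_single_single hj, skewForm_single_single (hi.trans hj), skewForm_self,
      skewForm_swap (Pi.single p 1) (Pi.single i 1), skewForm_single_single hi] at h1
    simp only [n, r]
    linarith
  have hr₁ : 1 - r i₁ ≠ 0 := by
    intro h
    exact hne₁ (by have := (eq_div_iff hne).1 (sub_eq_zero.1 h); linarith)
  have hr₃ : r i₃ ≠ 0 := div_ne_zero hne₃ hne
  have l1 : p < i₁ := by rw [Fin.lt_def]; omega
  let i₂ : Fin d := ⟨p + 2, by have := i₃.2; omega⟩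
  have l2 : i₁ < i₂ := by rw [Fin.lt_def]; simp only [i₂]; omega
  have l3 : i₂ < i₃ := by rw [Fin.lt_def]; simp only [i₂]; omega
  have e1 := key i₁ i₂ l1 l2
  have e2 := key i₁ i₃ l1 (l2.trans l3)
  have e3 := key i₂ i₃ (l1.trans l2) l3
  have hn₁ : n i₁ = 0 := by
    have : r i₃ * n i₁ = 0 := by
      linear_combination (1 - r i₂) * e2 + r i₃ * e1 - (1 - r i₁) * e3
    exact (mul_eq_zero.1 this).resolve_left hr₃
  intro j hj
  rcases eq_or_ne j i₁ with rfl | hj₁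
  · exact hn₁
  · have hlt : i₁ < j := by
      rw [Fin.lt_def] at hj ⊢
      have : (j : ℕ) ≠ i₁ := fun h => hj₁ (Fin.ext h)
      omega
    have e := key i₁ j l1 hlt
    rw [hn₁, mul_zero, add_zero] at e
    have : (1 - r i₁) * n j = 0 := by linarith
    exact (mul_eq_zero.1 this).resolve_left hr₁

end Blocks

/-! ## Solving the linear system -/

section System

variable {n : ℕ}

theorem mem_pairs (ab : Fin n × Fin n) : ab ∈ pairs n := by
  simp [pairs]

theorem length_pairs : (pairs n).length = n * n := by
  simp [pairs, List.length_flatMap]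

/-- The vector is a solution of `∑ c, M a b c * x c = B a b`, and the solution is unique. -/
def Solves (M : Fin n → Fin n → Fin n → ℝ) (B : Fin n → Fin n → ℝ) (x : Fin n → ℝ) : Prop :=
  (∀ a b, ∑ c, M a b c * x c = B a b) ∧
    ∀ z : Fin n → ℝ, (∀ a b, ∑ c, M a b c * z c = 0) → z = 0

/-- The combination of the equations with the coefficients `u`. -/
noncomputable def combination (M : Fin n → Fin n → Fin n → ℝ) (B : Fin n → Fin n → ℝ)
    (u : Fin n → ℝ) (b : Fin n) : (Fin n → ℝ) × (Fin 1 → ℝ) :=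
  (fun c => ∑ a, u a * M a b c, fun _ => ∑ a, u a * B a b)

theorem combination_eq {M : Fin n → Fin n → Fin n → ℝ} {B : Fin n → Fin n → ℝ}
    {x : Fin n → ℝ} (hx : ∀ a b, ∑ c, M a b c * x c = B a b) (u : Fin n → ℝ) (b : Fin n) :
    ∑ c, (combination M B u b).1 c * x c = (combination M B u b).2 0 := by
  simp only [combination, Finset.sum_mul, ← hx, Finset.mul_sum]
  rw [Finset.sum_comm]
  simp only [mul_assoc]

theorem runs_combine (M : Fin n → Fin n → Fin n → ℝ) (B : Fin n → Fin n → ℝ) (u : Fin n → ℝ) :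
    (forEach (fun b => do
      let m ← tabulate n fun c => sumOver (fun a => mul (u a) (M a b c)) (List.finRange n)
      let r ← sumOver (fun a => mul (u a) (B a b)) (List.finRange n)
      pure (m, fun _ => r)) (List.finRange n)).Runs
      (n * (n * (n * 2 + 1) + (n * 2 + 1))) ((List.finRange n).map (combination M B u)) := by
  refine Runs.cost_le (runs_forEach _ fun b => ?_) (by rw [List.length_finRange])
  exact Runs.val (Runs.bind (runs_tabulate_const fun c => runs_sumOver_finRange fun a => runs_mul _ _)
    (Runs.cost_le (Runs.bind (runs_sumOver_finRange fun a => runs_mul _ _) (Runs.pure _)) le_rfl)) rfl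

open Classical in
theorem runs_test (M : Fin n → Fin n → Fin n → ℝ) (B : Fin n → Fin n → ℝ)
    (x : Fin n → Fin 1 → ℝ) : (do
      let res ← forEach (fun ab : Fin n × Fin n => do
        let t ← sumOver (fun c => mul (M ab.1 ab.2 c) (x c 0)) (List.finRange n)
        sub t (B ab.1 ab.2)) (pairs n)
      let ok ← allZero res
      pure (if ok then some (fun c => x c 0) else none)).Runs (n * n * (n * 2 + 1 + 1) + n * n)
      (if ∀ a b, ∑ c, M a b c * x c 0 = B a b then some (fun c => x c 0) else none) := by
  refine Runs.cost_le (Runs.val (Runs.bind (runs_forEach _ fun ab =>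
    Runs.bind (runs_sumOver_finRange fun c => runs_mul _ _) (runs_sub _ _))
    (Runs.bind (runs_allZero _) (Runs.pure _))) ?_) ?_
  · have : (∀ y ∈ (pairs n).map fun ab : Fin n × Fin n =>
        ∑ c, M ab.1 ab.2 c * x c 0 - B ab.1 ab.2, y = 0) ↔
        ∀ a b, ∑ c, M a b c * x c 0 = B a b := by
      simp only [List.forall_mem_map, mem_pairs, true_implies, Prod.forall, sub_eq_zero]
    by_cases h : ∀ a b, ∑ c, M a b c * x c 0 = B a b
    · rw [if_pos h, if_pos (decide_eq_true (this.2 h))]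
    · rw [if_neg h, if_neg (by simpa only [decide_eq_true_eq] using mt this.1 h)]
  · rw [List.length_map, length_pairs, add_zero]

theorem trivialKernel_combinations {M : Fin n → Fin n → Fin n → ℝ} {B : Fin n → Fin n → ℝ}
    {v v' : Fin n → ℝ} : TrivialKernel ((List.finRange n).map (combination M B v) ++
      (List.finRange n).map (combination M B v')) ↔
    ∀ z : Fin n → ℝ, (∀ b, ∑ c, (∑ a, v a * M a b c) * z c = 0) →
      (∀ b, ∑ c, (∑ a, v' a * M a b c) * z c = 0) → z = 0 := by
  refine forall_congr' fun z => ?_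
  simp only [List.forall_mem_append, List.forall_mem_map, List.mem_finRange, true_implies,
    combination, and_imp]

theorem spec_gauss_combinations {l : Filter ℝ} {ab : Prop} (M : Fin n → Fin n → Fin n → ℝ)
    (B : Fin n → Fin n → ℝ) (v v' : Fin n → ℝ) :
    (gauss n ((List.finRange n).map (combination M B v) ++
      (List.finRange n).map (combination M B v'))).Spec l ab
      ((3 * (n + 1) * (n + n + n + 1) * (n + 1 + 1) : ℕ) : ℕ∞)
      (UniqueSolution ((List.finRange n).map (combination M B v) ++
        (List.finRange n).map (combination M B v'))) := by
  simpa using spec_gauss (l := l) (ab := ab) n ((List.finRange n).map (combination M B v) ++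
        (List.finRange n).map (combination M B v'))

/-- Holds for arbitrary random vectors. Only a returned solution has to be right: a kernel vector of
all equations is one of the combinations, so uniqueness for the combinations carries over. The
fourth power comes from elimination on all `n * n` equations. -/
theorem spec_solveSystem {l : Filter ℝ} {ab : Prop} {d : ℕ} (hn : n ≤ d) (hd : 1 ≤ d)
    (M : Fin n → Fin n → Fin n → ℝ) (B : Fin n → Fin n → ℝ) :
    (solveSystem M B).Spec l ab ((200 * d ^ 4 : ℕ) : ℕ∞) (fun o => ∀ x, o = some x → Solves M B x) := by
  classical
  rw [solveSystem]
  refine Spec.cost_le ((spec_tabulate_rand l ab n).bind fun v _ => (spec_tabulate_rand l ab n).bind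
    fun v' _ => (runs_combine M B v).bind_spec ((runs_combine M B v').bind_spec
    (Spec.bind (spec_gauss_combinations M B v v') (c' := ((n * n * (n * 2 + 1 + 1) + n * n +
      3 * (n + 1) * (n * n + n + 1) * (n + 1 + 1) : ℕ) : ℕ∞)) fun o ho => ?_))) ?_
  · cases o with
    | none =>
      refine Spec.cost_le (Spec.bind (spec_gauss n _) (c' := 0) fun o ho => Spec.pure fun x hx => ?_) ?_
      · cases o with
        | none => simp at hx
        | some y =>
          obtain rfl : (fun c => y c 0) = x := by simpa using hx
          obtain ⟨h1, h2⟩ := ho.1 y rfl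
          refine ⟨fun a b => h1 _ (List.mem_map_of_mem (mem_pairs (a, b))) 0, fun z hz => h2 z ?_⟩
          rw [List.forall_mem_map]
          exact fun ab _ => hz ab.1 ab.2
      · rw [add_zero, List.length_map, length_pairs]
        norm_cast; omega
    | some y =>
      refine (Runs.cost_le (runs_test M B y) (Nat.le_add_right _ _)).spec fun x hx => ?_
      split_ifs at hx with h
      obtain rfl : (fun c => y c 0) = x := by simpa using hx
      refine ⟨h, fun z hz => (ho.1 y rfl).2 z ?_⟩
      simp only [List.forall_mem_append, List.forall_mem_map]
      have := fun u b => combination_eq (B := fun _ _ => 0) hz u b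
      simp only [combination, mul_zero, Finset.sum_const_zero] at this
      exact ⟨fun b _ => this v b, fun b _ => this v' b⟩
  · norm_cast
    have e1 : d ≤ d ^ 4 := Nat.le_self_pow (by norm_num) d
    have e2 : d ^ 2 ≤ d ^ 4 := Nat.pow_le_pow_right hd (by norm_num)
    have e3 : d ^ 3 ≤ d ^ 4 := Nat.pow_le_pow_right hd (by norm_num)
    have e0 : 1 ≤ d ^ 4 := Nat.one_le_pow _ _ hd
    calc _ ≤ d + (d + (d * (d * (d * 2 + 1) + (d * 2 + 1)) + (d * (d * (d * 2 + 1) + (d * 2 + 1)) +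
          (3 * (d + 1) * (d + d + d + 1) * (d + 1 + 1) + (d * d * (d * 2 + 1 + 1) + d * d +
            3 * (d + 1) * (d * d + d + 1) * (d + 1 + 1)))))) := by gcongr
      _ ≤ 200 * d ^ 4 := by ring_nf at *; linarith

/-- If the `2 * n` combinations have full rank, their solution is the true one, so the test succeeds
and full elimination is never reached. The two draws are separated since genericity of `v'` depends
on `v`. -/
theorem spec_solveSystem_of_generic {l : Filter ℝ} {ab : Prop} {d : ℕ} (hn : n ≤ d) (hd : 1 ≤ d)
    {M : Fin n → Fin n → Fin n → ℝ} {B : Fin n → Fin n → ℝ} {x : Fin n → ℝ} (hx : Solves M B x)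
    {good : (Fin n → ℝ) → Prop} (h₁ : (tabulate n fun _ => rand).Spec l ab n good)
    (h₂ : ∀ v, good v → (tabulate n fun _ => rand).Spec l ab n fun v' =>
      ∀ z : Fin n → ℝ, (∀ b, ∑ c, (∑ a, v a * M a b c) * z c = 0) →
      (∀ b, ∑ c, (∑ a, v' a * M a b c) * z c = 0) → z = 0) :
    (solveSystem M B).Spec l ab ((200 * d ^ 3 : ℕ) : ℕ∞) (fun o => o = some x) := by
  classical
  rw [solveSystem]
  refine Spec.cost_le (h₁.bind fun v hv => (h₂ v hv).bind
    fun v' hv' => (runs_combine M B v).bind_spec ((runs_combine M B v').bind_spec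
    (Spec.bind (spec_gauss_combinations M B v v') (c' := ((n * n * (n * 2 + 1 + 1) + n * n : ℕ) : ℕ∞)) fun o ho => ?_))) ?_
  · have hk := trivialKernel_combinations (B := B).2 hv'
    have hs : IsSolution ((List.finRange n).map (combination M B v) ++
        (List.finRange n).map (combination M B v')) (fun c _ => x c) := by
      simp only [IsSolution, List.forall_mem_append, List.forall_mem_map]
      exact ⟨fun b _ _ => combination_eq hx.1 v b, fun b _ _ => combination_eq hx.1 v' b⟩
    cases o with
    | none => exact (ho.2 rfl hk ⟨_, hs⟩).elim
    | some y =>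
      have hy : (fun c => y c 0) = x := by
        refine sub_eq_zero.1 (hk _ fun r hr => ?_)
        have h1 := (ho.1 y rfl).1 r hr 0
        have h2 := hs r hr 0
        simp [mul_sub, Finset.sum_sub_distrib, h1, h2]
      refine (runs_test M B y).spec ?_
      rw [hy, if_pos]
      intro a b
      simpa [← hy] using hx.1 a b
  · norm_cast
    have e1 : d ≤ d ^ 3 := Nat.le_self_pow (by norm_num) d
    have e2 : d ^ 2 ≤ d ^ 3 := Nat.pow_le_pow_right hd (by norm_num)
    have e0 : 1 ≤ d ^ 3 := Nat.one_le_pow _ _ hd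
    calc _ ≤ d + (d + (d * (d * (d * 2 + 1) + (d * 2 + 1)) + (d * (d * (d * 2 + 1) + (d * 2 + 1)) +
          (3 * (d + 1) * (d + d + d + 1) * (d + 1 + 1) + (d * d * (d * 2 + 1 + 1) + d * d))))) := by gcongr
      _ ≤ 200 * d ^ 3 := by ring_nf at *; linarith

end System

/-! ## The upper transformations -/

theorem PolyOnLines.linear {E : Type} [AddCommGroup E] [Module ℝ E] (f : E →ₗ[ℝ] ℝ) :
    PolyOnLines f := fun x y =>
  ⟨Polynomial.C (f x) + Polynomial.C (f y) * Polynomial.X, fun t => by simp [mul_comm t]⟩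

section Up

variable {d : ℕ}

theorem pivot_lt_tail (p : Fin (d - 1)) (c : Fin (d - (p + 1))) : pivot p < tail p c := by
  rw [Fin.lt_def]; simp only [pivot, tail]; omega

theorem exists_tail_eq {p : Fin (d - 1)} {a : Fin d} (ha : pivot p < a) : ∃ c, tail p c = a := by
  rw [Fin.lt_def] at ha
  simp only [pivot] at ha
  exact ⟨⟨a - (p + 1), by omega⟩, Fin.ext (by simp only [tail]; omega)⟩

/-- Extend a vector by zeros. -/
def tailLift (p : Fin (d - 1)) (x : Fin (d - (p + 1)) → ℝ) : Fin d → ℝ := fun j =>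
  if h : (p : ℕ) < j then x ⟨(j : ℕ) - (p + 1), by omega⟩ else 0

theorem vanishesBelow_tailLift (p : Fin (d - 1)) (x : Fin (d - (p + 1)) → ℝ) :
    VanishesBelow (pivot p + 1) (tailLift p x) := fun i hi =>
  dif_neg (by simp only [pivot] at hi; omega)

theorem tailLift_tail (p : Fin (d - 1)) (x : Fin (d - (p + 1)) → ℝ) (c : Fin (d - (p + 1))) :
    tailLift p x (tail p c) = x c := by
  rw [tailLift, dif_pos (by simp only [tail]; omega)]
  congr 1; ext; simp [tail]

theorem tailLift_of_vanishesBelow {p : Fin (d - 1)} {w : Fin d → ℝ}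
    (hw : VanishesBelow (pivot p + 1) w) : tailLift p (fun c => w (tail p c)) = w := by
  ext i
  rcases lt_or_ge (pivot p) i with h | h
  · obtain ⟨c, rfl⟩ := exists_tail_eq h
    rw [tailLift_tail]
  · rw [Fin.le_def] at h
    rw [vanishesBelow_tailLift p _ i (by omega), hw i (by omega)]

/-- Linear combinations of the rows after the pivot. -/
noncomputable def tailComb (p : Fin (d - 1)) (B : Matrix (Fin d) (Fin d) ℝ) :
    (Fin (d - (p + 1)) → ℝ) →ₗ[ℝ] (Fin d → ℝ) :=
  Fintype.linearCombination ℝ fun c => B (tail p c)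

theorem tailComb_apply (p : Fin (d - 1)) (B : Matrix (Fin d) (Fin d) ℝ)
    (x : Fin (d - (p + 1)) → ℝ) : tailComb p B x = ∑ c, x c • B (tail p c) := rfl

theorem tailLift_vecMul (p : Fin (d - 1)) (B : Matrix (Fin d) (Fin d) ℝ)
    (x : Fin (d - (p + 1)) → ℝ) : tailLift p x ᵥ* B = tailComb p B x := by
  ext j
  rw [vecMul_eq_sum_rows, tailComb_apply, Finset.sum_apply, Finset.sum_apply,
    sum_of_forall_lt_eq_zero (p := p + 1)
    fun i hi => by rw [vanishesBelow_tailLift p x i hi]; simp]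
  exact Finset.sum_congr rfl fun c _ => congrArg (· * B (tail p c) j) (tailLift_tail p x c)

/-- The coefficients of the linear system of the upper transformation. -/
noncomputable def systemMatrix (p : Fin (d - 1)) (G : Tensor d ℝ) (a b c : Fin (d - (p + 1))) : ℝ :=
  G (tail p a) (tail p b) (tail p c) - G (tail p b) (tail p a) (tail p c)

/-- The right-hand sides of the linear system of the upper transformation. -/
noncomputable def systemRhs (p : Fin (d - 1)) (G : Tensor d ℝ) (a b : Fin (d - (p + 1))) : ℝ :=
  G (tail p b) (tail p a) (pivot p) - G (tail p a) (tail p b) (pivot p)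

variable {p : Fin (d - 1)} {B : Matrix (Fin d) (Fin d) ℝ}

theorem sum_systemMatrix (x : Fin (d - (p + 1)) → ℝ) (a b : Fin (d - (p + 1))) :
    ∑ c, systemMatrix p (congruence B (coreTensor d)) a b c * x c =
      skewForm d (B (tail p a)) (B (tail p b)) (tailComb p B x) := by
  simp [systemMatrix, congruence_sub_swap, tailComb_apply, mul_comm]

theorem sum_systemMatrix_combination (v x : Fin (d - (p + 1)) → ℝ) (b : Fin (d - (p + 1))) :
    ∑ c, (∑ a, v a * systemMatrix p (congruence B (coreTensor d)) a b c) * x c =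
      skewForm d (tailComb p B v) (B (tail p b)) (tailComb p B x) := by
  simp only [Finset.sum_mul]
  rw [Finset.sum_comm]
  simp only [mul_assoc, ← Finset.mul_sum, sum_systemMatrix]
  rw [tailComb_apply p B v]
  simp [LinearMap.sum_apply]

theorem systemRhs_eq (a b : Fin (d - (p + 1))) :
    systemRhs p (congruence B (coreTensor d)) a b =
      -skewForm d (B (tail p a)) (B (tail p b)) (B (pivot p)) := by
  rw [systemRhs, congruence_sub_swap, skewForm_swap]

theorem forall_tail {P : Fin d → Prop} : (∀ a, pivot p < a → P a) ↔ ∀ c, P (tail p c) :=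
  ⟨fun h c => h _ (pivot_lt_tail p c), fun h a ha => by
    obtain ⟨c, rfl⟩ := exists_tail_eq ha
    exact h c⟩

/-- Translates the system, known to the program only through tensor entries, into the geometry of
the rows of `B`. -/
theorem solves_iff (x : Fin (d - (p + 1)) → ℝ) :
    Solves (systemMatrix p (congruence B (coreTensor d))) (systemRhs p (congruence B (coreTensor d))) x ↔
      (∀ a b, pivot p < a → pivot p < b →
        skewForm d (B a) (B b) (B (pivot p) + tailLift p x ᵥ* B) = 0) ∧
      InjectiveAt (pivot p) B := by
  have comm : ∀ Q : Fin d → Fin d → Prop, (∀ a b, pivot p < a → pivot p < b → Q a b) ↔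
      ∀ a b, Q (tail p a) (tail p b) := fun Q => by
    constructor
    · exact fun h a b => h _ _ (pivot_lt_tail p a) (pivot_lt_tail p b)
    · intro h a b ha hb
      obtain ⟨a, rfl⟩ := exists_tail_eq ha
      obtain ⟨b, rfl⟩ := exists_tail_eq hb
      exact h a b
  refine and_congr ?_ ?_
  · rw [comm]
    refine forall₂_congr fun a b => ?_
    rw [sum_systemMatrix, systemRhs_eq, tailLift_vecMul, map_add, eq_neg_iff_add_eq_zero, add_comm]
  · simp only [sum_systemMatrix]
    constructor
    · intro h w hw h'
      rw [← tailLift_of_vanishesBelow hw, tailLift_vecMul, comm] at h'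
      have := h _ h'
      rw [← tailLift_of_vanishesBelow hw, this]
      ext i
      simp [tailLift]
    · intro h z hz
      have := h (tailLift p z) (vanishesBelow_tailLift p z) ((comm _).2 fun a b => by
        rw [tailLift_vecMul]; exact hz a b)
      ext c
      rw [← tailLift_tail p z c, this]; rfl

theorem InjectiveAt.exists_solves (h : InjectiveAt (pivot p) B) (hB : BlockId p B) (hu : IsUnit B) :
    ∃ x, Solves (systemMatrix p (congruence B (coreTensor d)))
      (systemRhs p (congruence B (coreTensor d))) x := by
  obtain ⟨x, hx, hx'⟩ := exists_skewForm_eq_zero (p := pivot p) hB hu (h.inv_ne_zero hB hu)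
  refine ⟨_, (solves_iff fun c => x (tail p c)).2 ⟨?_, h⟩⟩
  rwa [tailLift_of_vanishesBelow hx]

theorem generic_tabulate_rand (ν : Measure ℝ) [NullSingletonClass ν] (n : ℕ) :
    Generic ν (tabulate n fun _ => rand) n := by
  simpa using (generic_rand ν).tabulate n

/-- The random combinations of the equations almost surely have a unique solution if the equations
have one. -/
theorem spec_solveSystem_of_injectiveAt {ν : Measure ℝ} [NullSingletonClass ν] {ab : Prop}
    (hp : (p : ℕ) + 4 ≤ d) (h : InjectiveAt (pivot p) B) (hB : BlockId p B) (hu : IsUnit B) :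
    (solveSystem (systemMatrix p (congruence B (coreTensor d)))
      (systemRhs p (congruence B (coreTensor d)))).Spec (ae ν) ab ((200 * d ^ 3 : ℕ) : ℕ∞)
      (fun o => ∃ x, o = some x ∧ Solves (systemMatrix p (congruence B (coreTensor d)))
        (systemRhs p (congruence B (coreTensor d))) x) := by
  obtain ⟨x, hx⟩ := h.exists_solves hB hu
  have entry : ∀ i, PolyOnLines fun v => tailComb p B v i := fun i =>
    .linear ((LinearMap.proj i).comp (tailComb p B))
  have hsingle : ∀ c, tailComb p B (Pi.single c 1) = B (tail p c) := fun c => by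
    simp [tailComb_apply, Pi.single_apply]
  have hgen := generic_tabulate_rand ν (d - (p + 1))
  refine (spec_solveSystem_of_generic (Nat.sub_le _ _) (by omega) hx
    -- The requirement of `InjectiveAt.exists_combination`: finitely many linear forms in `v`, none
    -- of them zero by `InjectiveAt.exists_prefixSum_ne_zero`.
    (good := fun v => ∀ j : {j : Fin d // (p : ℕ) + 2 ≤ j}, prefixSum (tailComb p B v) j ≠ 0)
    (Spec.forall ⟨⟨⟨p + 2, by omega⟩, le_rfl⟩⟩ fun j => hgen ab _
      (.sum _ entry) ?_) fun v hv => ?_).imp fun o ho => ⟨x, ho, hx⟩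
  · obtain ⟨a, ha, ha'⟩ := h.exists_prefixSum_ne_zero hB hu (j := j) (by
      have := j.2
      rw [Fin.lt_def]; simp only [pivot]; omega)
    obtain ⟨c, rfl⟩ := exists_tail_eq ha
    exact ⟨Pi.single c 1, by rwa [hsingle]⟩
  · obtain ⟨φ, a, ha, ha', hφ⟩ := h.exists_combination (by simp only [pivot]; omega) hB hu
      (vanishesBelow_tailLift p v) (fun j hj => by
        rw [tailLift_vecMul]; exact hv ⟨j, hj⟩)
    obtain ⟨c, rfl⟩ := exists_tail_eq ha
    refine (hgen ab _ (.linear (φ.comp (tailComb p B))) ⟨Pi.single c 1, by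
      rw [LinearMap.comp_apply, hsingle]; exact ha'⟩).imp fun v' hv' z h1 h2 => ?_
    have := hφ _ hv' (tailLift p z) (vanishesBelow_tailLift p z)
      (forall_tail.2 fun b => by
        rw [tailLift_vecMul, tailLift_vecMul, ← sum_systemMatrix_combination]; exact h1 b)
      (forall_tail.2 fun b => by
        rw [tailLift_vecMul, ← sum_systemMatrix_combination]; exact h2 b)
    ext c
    rw [← tailLift_tail p z c, this]; rfl

/-- An upper transformation turns the row `p` into a multiple of a unit vector. -/
def IsUpper (p : Fin d) (B Q : Matrix (Fin d) (Fin d) ℝ) : Prop :=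
  BlockId p Q ∧ IsUnit Q ∧ ∀ j, p < j → (Q * B) p j = 0

/-- Justifies the recursion after a random change of coordinates `W`. -/
theorem IsUpper.mul {p : Fin d} {W Q : Matrix (Fin d) (Fin d) ℝ} (h : IsUpper p (W * B) Q)
    (hW : BlockId p W) (hu : IsUnit W) : IsUpper p B (Q * W) :=
  ⟨h.1.mul hW, h.2.1.mul hu, by rw [Matrix.mul_assoc]; exact h.2.2⟩

/-- The matrix `U^{(s,x)}`. -/
def upperMat (p : Fin (d - 1)) (x : Fin (d - (p + 1)) → ℝ) : Matrix (Fin d) (Fin d) ℝ := fun i j =>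
  if h : (i : ℕ) = p ∧ (p : ℕ) < j then x ⟨(j : ℕ) - (p + 1), by omega⟩
  else (1 : Matrix (Fin d) (Fin d) ℝ) i j

theorem runs_upperGauss (p : Fin (d - 1)) (x : Fin (d - (p + 1)) → ℝ) :
    (upperGauss p x).Runs (d * (d * 1)) (upperMat p x) := by
  refine runs_tabulate₂ fun i j => ?_
  rw [upperMat]
  by_cases h : (i : ℕ) = p ∧ (p : ℕ) < j
  · rw [dif_pos h, dif_pos h]
    exact (Runs.pure _).cost_le (by simp)
  · rw [dif_neg h, dif_neg h]
    exact runs_delta i j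

theorem upperMat_pivot (x : Fin (d - (p + 1)) → ℝ) :
    upperMat p x (pivot p) = Pi.single (pivot p) 1 + tailLift p x := by
  ext j
  rw [upperMat, Pi.add_apply, tailLift]
  by_cases h : (p : ℕ) < j
  · rw [dif_pos ⟨rfl, h⟩, dif_pos h, Pi.single_apply, if_neg, zero_add]
    rintro rfl; simp [pivot] at h
  · rw [dif_neg (by tauto), dif_neg h, add_zero, one_apply, Pi.single_apply]
    simp only [eq_comm]

theorem upperMat_of_ne (x : Fin (d - (p + 1)) → ℝ) {i : Fin d} (hi : i ≠ pivot p) (j : Fin d) :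
    upperMat p x i j = (1 : Matrix (Fin d) (Fin d) ℝ) i j :=
  dif_neg fun h => hi (Fin.ext h.1)

theorem det_upperMat (x : Fin (d - (p + 1)) → ℝ) : (upperMat p x).det = 1 := by
  rw [det_of_isUpperTriangular]
  · exact Finset.prod_eq_one fun i _ => by rw [upperMat, dif_neg (by omega), one_apply_eq]
  · intro i j hij
    simp only [id] at hij
    rw [Fin.lt_def] at hij
    rw [upperMat, dif_neg (by omega), one_apply_ne]
    rintro rfl; omega

theorem isUpper_upperMat (hB : BlockId p B) (hu : IsUnit B) {x : Fin (d - (p + 1)) → ℝ}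
    (hx : Solves (systemMatrix p (congruence B (coreTensor d)))
      (systemRhs p (congruence B (coreTensor d))) x) : IsUpper (pivot p) B (upperMat p x) := by
  refine ⟨fun i j h => dif_neg (by simp only [pivot] at h; omega),
    (isUnit_iff_isUnit_det _).2 (by simp [det_upperMat]), fun j hj => ?_⟩
  obtain ⟨h1, h2⟩ := (solves_iff x).1 hx
  have h3 := h2.eq_of_skewForm hB hu (vanishesBelow_tailLift p x) h1
  have h4 : (upperMat p x * B) (pivot p) = B (pivot p) + tailLift p x ᵥ* B := by
    change upperMat p x (pivot p) ᵥ* B = _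
    rw [upperMat_pivot, add_vecMul]
    congr 1
    simp; rfl
  rw [h4, h3]
  simp [hj.ne']

theorem runs_system (p : Fin (d - 1)) (G : Tensor d ℝ) {α : Type} {l : Filter ℝ} {ab : Prop}
    {c : ℕ∞} {f : (Fin (d - (p + 1)) → Fin (d - (p + 1)) → Fin (d - (p + 1)) → ℝ) →
      (Fin (d - (p + 1)) → Fin (d - (p + 1)) → ℝ) → Prog ℝ α} {P : α → Prop}
    (h : (f (systemMatrix p G) (systemRhs p G)).Spec l ab c P) : Spec l ab (do
      let M ← tabulate (d - (p + 1)) fun a => tabulate (d - (p + 1)) fun b =>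
        tabulate (d - (p + 1)) fun c =>
          sub (G (tail p a) (tail p b) (tail p c)) (G (tail p b) (tail p a) (tail p c))
      let B ← tabulate (d - (p + 1)) fun a => tabulate (d - (p + 1)) fun b =>
        sub (G (tail p b) (tail p a) (pivot p)) (G (tail p a) (tail p b) (pivot p))
      f M B) (((2 * d ^ 3 : ℕ) : ℕ∞) + c) P := by
  refine Spec.cost_le (Runs.bind_spec (runs_tabulate_const fun a => runs_tabulate₂ fun b c =>
    runs_sub _ _) (Runs.bind_spec (runs_tabulate₂ fun a b => runs_sub _ _) h)) ?_
  rw [← add_assoc]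
  gcongr
  norm_cast
  have h1 : d - (p + 1) ≤ d := Nat.sub_le _ _
  have h2 : 1 ≤ d := by have := p.2; omega
  generalize d - ((p : ℕ) + 1) = m at h1
  calc _ ≤ d * (d * (d * 1)) + d * (d * 1) := by gcongr
    _ ≤ 2 * d ^ 3 := by nlinarith [Nat.mul_le_mul_left (d * d) h2]

theorem always_up4 (N : ℕ) (hB : BlockId p B) (hu : IsUnit B) :
    (up4 p N (congruence B (coreTensor d))).Spec ⊤ True ⊤ (fun Q => IsUpper (pivot p) B (Matrix.of Q)) := by
  induction N generalizing B with
  | zero => trivial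
  | succ N ih =>
    rw [up4]
    have hd : 1 ≤ d := by have := p.2; omega
    refine Spec.cost_le (runs_system p _ (Spec.bind (spec_solveSystem (Nat.sub_le d (p + 1)) hd _ _)
      (c' := ⊤) fun o ho => ?_)) le_top
    cases o with
    | some x =>
      exact ((runs_upperGauss p x).spec (isUpper_upperMat hB hu (ho x rfl))).cost_le le_top
    | none =>
      refine Spec.cost_le ((always_randBlock p N).bind fun W hW => (runs_applyCongruence W _).bind_spec
        (c' := ⊤) ?_) le_top
      rw [← congruence_mul]
      refine Spec.cost_le ((ih (hW.1.mul hB) (hW.2.mul hu)).bind fun Q hQ =>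
        (runs_matMul Q W).spec (hQ.mul hW.1 hW.2)) le_top

/-- The first attempt succeeds. That `Q` alters row `p` only is recorded for two reasons: it is
sparse, and it preserves the genericity of later steps. -/
theorem spec_up4_of_injectiveAt {ν : Measure ℝ} [NullSingletonClass ν] {ab : Prop} {N : ℕ}
    (hN : N = 0 → ab)
    (hp : (p : ℕ) + 4 ≤ d) (h : InjectiveAt (pivot p) B) (hB : BlockId p B) (hu : IsUnit B) :
    (up4 p N (congruence B (coreTensor d))).Spec (ae ν) ab ((210 * d ^ 3 : ℕ) : ℕ∞)
      (fun Q => IsUpper (pivot p) B (Matrix.of Q) ∧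
        ∀ i j, i ≠ pivot p → Q i j = (1 : Matrix (Fin d) (Fin d) ℝ) i j) := by
  cases N with
  | zero => exact hN rfl
  | succ N =>
    rw [up4]
    refine Spec.cost_le (runs_system p _ (Spec.bind (spec_solveSystem_of_injectiveAt hp h hB hu)
      (c' := ((d * (d * 1) : ℕ) : ℕ∞)) fun o ho => ?_)) ?_
    · obtain ⟨x, rfl, hx⟩ := ho
      exact (runs_upperGauss p x).spec ⟨isUpper_upperMat hB hu hx, fun i j hi => upperMat_of_ne x hi j⟩
    · norm_cast
      have : 1 ≤ d := by omega
      nlinarith [Nat.mul_le_mul_left (d * d) this]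

end Up

/-! ## Generic matrices -/

section Genericity

variable {d : ℕ}

/-- Replace the first rows and columns by those of the identity matrix. -/
def trunc (q : ℕ) (B : Matrix (Fin d) (Fin d) ℝ) : Matrix (Fin d) (Fin d) ℝ := fun i j =>
  if (i : ℕ) < q ∨ (j : ℕ) < q then (1 : Matrix (Fin d) (Fin d) ℝ) i j else B i j

theorem blockId_trunc (q : ℕ) (B : Matrix (Fin d) (Fin d) ℝ) : BlockId q (trunc q B) :=
  fun _ _ h => if_pos h

theorem BlockId.trunc_eq {q : ℕ} {B : Matrix (Fin d) (Fin d) ℝ} (hB : BlockId q B) :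
    trunc q B = B := by
  ext i j
  rw [trunc]
  split_ifs with h
  · exact (hB i j h).symm
  · rfl

theorem BlockId.mono {p q : ℕ} {B : Matrix (Fin d) (Fin d) ℝ} (hB : BlockId q B) (h : p ≤ q) :
    BlockId p B := fun i j hij => hB i j (by omega)

theorem trunc_congr {q : ℕ} {B B' : Matrix (Fin d) (Fin d) ℝ}
    (h : ∀ i j : Fin d, q ≤ i → q ≤ j → B i j = B' i j) : trunc q B = trunc q B' := by
  ext i j
  rw [trunc, trunc]
  split_ifs with hij
  · rfl
  · exact h i j (by omega) (by omega)

/-- The polynomials that have to be nonzero so that the step with pivot `q` succeeds. -/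
noncomputable def stepPoly (q : Fin d) (hq : (q : ℕ) + 3 < d) (k : Fin 3)
    (B : Matrix (Fin d) (Fin d) ℝ) : ℝ :=
  match k with
  | 0 => (trunc q B).adjugate q q
  | 1 => (trunc q B).adjugate ⟨q + 1, by omega⟩ q - (trunc q B).adjugate q q
  | 2 => (trunc q B).adjugate ⟨q + 3, hq⟩ q

/-- All steps from `p` on succeed. -/
def GenericFrom (p : ℕ) (B : Matrix (Fin d) (Fin d) ℝ) : Prop :=
  ∀ (q : {q : Fin d // p ≤ q ∧ (q : ℕ) + 3 < d}) (k : Fin 3), stepPoly q.1 q.2.2 k B ≠ 0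

/-- Genericity is phrased through trailing blocks precisely so that it survives operations that
leave the block from `p` on unchanged. -/
theorem GenericFrom.congr {p : ℕ} {B B' : Matrix (Fin d) (Fin d) ℝ} (h : GenericFrom p B)
    (hBB : ∀ i j : Fin d, p ≤ i → p ≤ j → B i j = B' i j) : GenericFrom p B' := by
  intro q k
  have : trunc q B = trunc q B' := trunc_congr fun i j hi hj =>
    hBB i j (q.2.1.trans hi) (q.2.1.trans hj)
  have h := h q k
  fin_cases k <;> simpa only [stepPoly, this] using h

theorem GenericFrom.mono {p p' : ℕ} {B : Matrix (Fin d) (Fin d) ℝ} (h : GenericFrom p B)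
    (hp : p ≤ p') : GenericFrom p' B := fun q k => h ⟨q.1, hp.trans q.2.1, q.2.2⟩ k

/-- Inverse and adjugate differ by the nonzero factor `1 / det B`, so the three polynomials at `p`
are the inequalities of `injectiveAt_of_inv`. -/
theorem GenericFrom.injectiveAt {p : Fin d} {B : Matrix (Fin d) (Fin d) ℝ}
    (h : GenericFrom p B) (hp : (p : ℕ) + 3 < d) (hB : BlockId p B) (hu : IsUnit B) :
    InjectiveAt p B := by
  have hdet : Ring.inverse B.det ≠ 0 := by
    have := (isUnit_iff_isUnit_det _).1 hu
    rw [Ring.inverse_eq_inv]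
    exact inv_ne_zero this.ne_zero
  have hinv : ∀ i, B⁻¹ i p = Ring.inverse B.det * (trunc p B).adjugate i p := fun i => by
    rw [inv_def, hB.trunc_eq]; rfl
  have h0 := h ⟨p, le_rfl, hp⟩ 0
  have h1 := h ⟨p, le_rfl, hp⟩ 1
  have h2 := h ⟨p, le_rfl, hp⟩ 2
  simp only [stepPoly] at h0 h1 h2
  refine injectiveAt_of_inv (i₁ := ⟨p + 1, by omega⟩) (i₃ := ⟨p + 3, hp⟩) rfl rfl hB hu ?_ ?_ ?_
  · rw [hinv]; exact mul_ne_zero hdet h0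
  · rw [hinv, hinv]
    exact fun h => h1 (sub_eq_zero.2 (mul_left_cancel₀ hdet h))
  · rw [hinv]; exact mul_ne_zero hdet h2

theorem PolyOnLines.matrix_mul (B : Matrix (Fin d) (Fin d) ℝ) (i j : Fin d) :
    PolyOnLines fun W : Matrix (Fin d) (Fin d) ℝ => (W * B) i j := by
  simp only [mul_apply]
  exact .sum _ fun k => (entry i k).mul (const _)

theorem polyOnLines_stepPoly (q : Fin d) (hq : (q : ℕ) + 3 < d) (k : Fin 3)
    (B : Matrix (Fin d) (Fin d) ℝ) : PolyOnLines fun W => stepPoly q hq k (W * B) := by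
  have : ∀ i j, PolyOnLines fun W : Matrix (Fin d) (Fin d) ℝ => trunc q (W * B) i j := by
    intro i j
    simp only [trunc]
    split_ifs
    · exact .const _
    · exact .matrix_mul B i j
  fin_cases k
  · exact .adjugate this _ _
  · exact (PolyOnLines.adjugate this _ _).sub (.adjugate this _ _)
  · exact .adjugate this _ _

/-- The identity serves for the first two polynomials. The third wants an off-diagonal entry of the
adjugate, which a transvection provides, its inverse having entry -1 there. -/
theorem exists_stepPoly_ne_zero {p : ℕ} (q : Fin d) (hpq : p ≤ q) (hq : (q : ℕ) + 3 < d) (k : Fin 3) :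
    ∃ Z, BlockId p Z ∧ stepPoly q hq k Z ≠ 0 := by
  have hne : (⟨q + 1, by omega⟩ : Fin d) ≠ q := fun h => by simpa using congrArg Fin.val h
  have hne₃ : (⟨q + 3, hq⟩ : Fin d) ≠ q := fun h => by simpa using congrArg Fin.val h
  fin_cases k
  · exact ⟨1, .one, by simp [stepPoly, BlockId.one.trunc_eq]⟩
  · exact ⟨1, .one, by simp [stepPoly, BlockId.one.trunc_eq, one_apply_ne hne]⟩
  · have hb : BlockId q (Matrix.transvection (⟨q + 3, hq⟩ : Fin d) q (1 : ℝ)) := by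
      intro i j h
      rw [Matrix.transvection, Matrix.add_apply, single_apply_of_ne, add_zero]
      rintro ⟨rfl, rfl⟩
      simp at h
    refine ⟨_, hb.mono hpq, ?_⟩
    simp only [stepPoly, hb.trunc_eq]
    have h1 := adjugate_mul (Matrix.transvection (⟨q + 3, hq⟩ : Fin d) q (1 : ℝ))
    rw [det_transvection_of_ne _ _ hne₃, one_smul] at h1
    have h2 : (Matrix.transvection (⟨q + 3, hq⟩ : Fin d) q (1 : ℝ)).adjugate =
        Matrix.transvection (⟨q + 3, hq⟩ : Fin d) q (-1 : ℝ) := by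
      have h3 := transvection_mul_transvection_same _ _ hne₃ (1 : ℝ) (-1)
      rw [add_neg_cancel, transvection_zero] at h3
      exact left_inv_eq_right_inv h1 h3
    rw [h2, Matrix.transvection, Matrix.add_apply, single_apply_same, one_apply_ne hne₃]
    simp

variable {p : Fin (d - 1)} {B : Matrix (Fin d) (Fin d) ℝ}

/-- Transports a witness for `Z` to one for `W * B`, so nonvanishing need only be checked at
convenient matrices. -/
theorem exists_blockId_mul_eq {q : ℕ} {Z : Matrix (Fin d) (Fin d) ℝ} (hB : BlockId q B) (hu : IsUnit B)
    (hZ : BlockId q Z) : ∃ W, BlockId q W ∧ W * B = Z :=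
  ⟨Z * B⁻¹, hZ.mul (hB.inv hu),
    nonsing_inv_mul_cancel_right B Z ((isUnit_iff_isUnit_det _).1 hu)⟩

theorem spec_randBlock_generic {ν : Measure ℝ} [NullSingletonClass ν] {ab : Prop} {N : ℕ}
    (hN : N = 0 → ab) (hB : BlockId p B) (hu : IsUnit B) :
    (randBlock p N).Spec (ae ν) ab ((60 * d ^ 3 : ℕ) : ℕ∞) (fun W =>
      BlockId p (Matrix.of W) ∧ IsUnit (Matrix.of W) ∧ GenericFrom p (Matrix.of W * B)) := by
  refine (spec_randBlock p hN
    (ι := {q : Fin d // (p : ℕ) ≤ q ∧ (q : ℕ) + 3 < d} × Fin 3)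
    (F := fun qk W => stepPoly qk.1.1 qk.1.2.2 qk.2 (W * B))
    (fun qk => polyOnLines_stepPoly _ _ _ _) fun qk => ?_).imp
    fun W hW => ⟨hW.1, hW.2.1, fun q k => hW.2.2 (q, k)⟩
  obtain ⟨Z, hZ, hZ'⟩ := exists_stepPoly_ne_zero qk.1.1 qk.1.2.1 qk.1.2.2 qk.2
  obtain ⟨W, hW, rfl⟩ := exists_blockId_mul_eq hB hu hZ
  exact ⟨W, hW, hZ'⟩

/-- The one expensive event. The solver must answer `none`; almost surely the random `W` makes `W *
B` generic for this and all later steps, so the second attempt succeeds and a budget of two is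
enough. -/
theorem spec_up4_of_not_injectiveAt {ν : Measure ℝ} [NullSingletonClass ν] {ab : Prop} {N : ℕ}
    (hN : N < 2 → ab)
    (hp : (p : ℕ) + 4 ≤ d) (h : ¬ InjectiveAt (pivot p) B) (hB : BlockId p B) (hu : IsUnit B) :
    (up4 p N (congruence B (coreTensor d))).Spec (ae ν) ab ((1000 * d ^ 4 : ℕ) : ℕ∞)
      (fun Q => IsUpper (pivot p) B (Matrix.of Q) ∧ GenericFrom (p + 1) (Matrix.of Q * B)) := by
  cases N with
  | zero => exact hN zero_lt_two
  | succ N =>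
    rw [up4]
    have hd : 1 ≤ d := by omega
    refine Spec.cost_le (runs_system p _ (Spec.bind (spec_solveSystem (Nat.sub_le d (p + 1)) hd _ _)
      (c' := ((700 * d ^ 4 : ℕ) : ℕ∞)) fun o ho => ?_)) ?_
    · cases o with
      | some x => exact (h ((solves_iff x).1 (ho x rfl)).2).elim
      | none =>
        refine Spec.cost_le ((spec_randBlock_generic (fun h => hN (by omega)) hB hu).bind
          (c' := ((600 * d ^ 4 : ℕ) : ℕ∞)) fun W hW => ?_) ?_
        · refine Spec.cost_le (Runs.bind_spec (Runs.cost_le (runs_applyCongruence W _)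
            (c' := d * d + 3 * (d * d * (2 * (d * d) + d))) (by gcongr; exact nnz_le W)) ?_
            (c' := ((500 * d ^ 4 : ℕ) : ℕ∞))) ?_
          · rw [← congruence_mul]
            have hB' := hW.1.mul hB
            have hu' := hW.2.1.mul hu
            refine Spec.cost_le ((spec_up4_of_injectiveAt (fun h => hN (by omega)) hp
              (hW.2.2.injectiveAt (p := pivot p) (by simp only [pivot]; omega) hB' hu') hB' hu').bind fun Q hQ =>
              (runs_matMul Q W).spec ⟨hQ.1.mul hW.1 hW.2.1, ?_⟩) ?_
            · rw [show Matrix.of (Matrix.of Q * Matrix.of W) * B = Matrix.of Q * (Matrix.of W * B) from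
                Matrix.mul_assoc (Matrix.of Q) (Matrix.of W) B]
              -- `Q` changes row `p` only, so the block from `p + 1` on is still that of `W * B`.
              refine (hW.2.2.mono (Nat.le_succ _)).congr fun i j hi _ => ?_
              have hip : i ≠ pivot p := by
                rintro rfl; simp [pivot] at hi
              rw [mul_apply (M := Matrix.of Q)]
              simp [hQ.2 i _ hip, one_apply]
            · norm_cast
              have e0 : 1 ≤ d ^ 4 := Nat.one_le_pow _ _ hd
              have e3 : d ^ 3 ≤ d ^ 4 := Nat.pow_le_pow_right hd (by norm_num)
              have e2 : d ^ 2 ≤ d ^ 4 := Nat.pow_le_pow_right hd (by norm_num)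
              ring_nf at *; linarith
          · norm_cast
            have e0 : 1 ≤ d ^ 4 := Nat.one_le_pow _ _ hd
            have e3 : d ^ 3 ≤ d ^ 4 := Nat.pow_le_pow_right hd (by norm_num)
            have e2 : d ^ 2 ≤ d ^ 4 := Nat.pow_le_pow_right hd (by norm_num)
            ring_nf at *; linarith
        · norm_cast
          have e0 : 1 ≤ d ^ 4 := Nat.one_le_pow _ _ hd
          have e3 : d ^ 3 ≤ d ^ 4 := Nat.pow_le_pow_right hd (by norm_num)
          linarith
    · norm_cast
      have e0 : 1 ≤ d ^ 4 := Nat.one_le_pow _ _ hd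
      have e3 : d ^ 3 ≤ d ^ 4 := Nat.pow_le_pow_right hd (by norm_num)
      linarith

end Genericity

/-! ## The last two upper transformations -/

section LastSteps

variable {d : ℕ}

theorem sum_last_three {p : ℕ} (hp : p + 3 = d) {g : Fin d → ℝ}
    (h : ∀ i : Fin d, (i : ℕ) < p → g i = 0) :
    ∑ i, g i = g ⟨p, by omega⟩ + g ⟨p + 1, by omega⟩ + g ⟨p + 2, by omega⟩ := by
  subst hp
  rw [Fin.sum_univ_castSucc, Fin.sum_univ_castSucc, Fin.sum_univ_castSucc,
    Finset.sum_eq_zero fun i _ => h _ (by simp), zero_add]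
  rfl

theorem sum_last_two {p : ℕ} (hp : p + 2 = d) {g : Fin d → ℝ}
    (h : ∀ i : Fin d, (i : ℕ) < p → g i = 0) :
    ∑ i, g i = g ⟨p, by omega⟩ + g ⟨p + 1, by omega⟩ := by
  subst hp
  rw [Fin.sum_univ_castSucc, Fin.sum_univ_castSucc,
    Finset.sum_eq_zero fun i _ => h _ (by simp), zero_add]
  rfl

theorem prefixSum_eq_sum_ite (f : Fin d → ℝ) (j : Fin d) :
    prefixSum f j = ∑ i, if i < j then f i else 0 := by
  rw [prefixSum, ← Finset.sum_filter]
  congr 1; ext; simp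

theorem coreWeight_eq_sum_ite (h : Fin d → ℝ) (j : Fin d) :
    coreWeight j h = 3 * h j + 6 * ∑ i, if j < i then h i else 0 := by
  rw [coreWeight_apply, ← Finset.sum_filter]
  congr 3; ext; simp

/-- The antisymmetrized core form in dimension three. -/
def skewThree (u₀ u₁ u₂ v₀ v₁ v₂ w₁ w₂ : ℝ) : ℝ :=
  (3 * w₁ + 6 * w₂) * (u₀ * v₁ - u₁ * v₀) + 3 * w₂ * ((u₀ + u₁) * v₂ - u₂ * (v₀ + v₁))

theorem skewForm_last_three {p : ℕ} (hp : p + 3 = d) {f g : Fin d → ℝ} (h : Fin d → ℝ)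
    (hf : VanishesBelow p f) (hg : VanishesBelow p g) :
    skewForm d f g h = skewThree (f ⟨p, by omega⟩) (f ⟨p + 1, by omega⟩) (f ⟨p + 2, by omega⟩)
      (g ⟨p, by omega⟩) (g ⟨p + 1, by omega⟩) (g ⟨p + 2, by omega⟩)
      (h ⟨p + 1, by omega⟩) (h ⟨p + 2, by omega⟩) := by
  have pre : ∀ f : Fin d → ℝ, VanishesBelow p f → ∀ j, prefixSum f j =
      (if ⟨p, by omega⟩ < j then f ⟨p, by omega⟩ else 0) +
      (if ⟨p + 1, by omega⟩ < j then f ⟨p + 1, by omega⟩ else 0) +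
      (if ⟨p + 2, by omega⟩ < j then f ⟨p + 2, by omega⟩ else 0) := fun f hf j => by
    rw [prefixSum_eq_sum_ite, sum_last_three hp fun i hi => by rw [hf i hi, ite_self]]
  have weight : ∀ j : Fin d, p ≤ j → coreWeight j h = 3 * h j + 6 *
      ((if j < ⟨p, by omega⟩ then h ⟨p, by omega⟩ else 0) +
      (if j < ⟨p + 1, by omega⟩ then h ⟨p + 1, by omega⟩ else 0) +
      (if j < ⟨p + 2, by omega⟩ then h ⟨p + 2, by omega⟩ else 0)) := fun j hj => by
    rw [coreWeight_eq_sum_ite, sum_last_three hp fun i hi => if_neg (by rw [Fin.lt_def]; omega)]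
  rw [skewForm_eq_sum, sum_last_three hp fun i hi => by rw [hf i hi, hg i hi]; ring,
    pre f hf, pre f hf, pre f hf, pre g hg, pre g hg, pre g hg,
    weight ⟨p + 1, by omega⟩ (Nat.le_succ _), weight ⟨p + 2, by omega⟩ (by simp)]
  simp [Fin.lt_def, skewThree]

theorem skewForm_last_two {p : ℕ} (hp : p + 2 = d) {f g : Fin d → ℝ} (h : Fin d → ℝ)
    (hf : VanishesBelow p f) (hg : VanishesBelow p g) :
    skewForm d f g h = 3 * h ⟨p + 1, by omega⟩ * (f ⟨p, by omega⟩ * g ⟨p + 1, by omega⟩ -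
      f ⟨p + 1, by omega⟩ * g ⟨p, by omega⟩) := by
  have pre : ∀ f : Fin d → ℝ, VanishesBelow p f → ∀ j, prefixSum f j =
      (if ⟨p, by omega⟩ < j then f ⟨p, by omega⟩ else 0) +
      (if ⟨p + 1, by omega⟩ < j then f ⟨p + 1, by omega⟩ else 0) := fun f hf j => by
    rw [prefixSum_eq_sum_ite, sum_last_two hp fun i hi => by rw [hf i hi, ite_self]]
  have weight : coreWeight ⟨p + 1, by omega⟩ h = 3 * h ⟨p + 1, by omega⟩ := by
    rw [coreWeight_eq_sum_ite, Finset.sum_eq_zero fun i _ => if_neg (by rw [Fin.lt_def]; simp only; omega)]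
    ring
  rw [skewForm_eq_sum, sum_last_two hp fun i hi => by rw [hf i hi, hg i hi]; ring,
    pre f hf, pre f hf, pre g hg, pre g hg, weight]
  simp [Fin.lt_def]

/-- Write `ω(u, v, w)` for the form. In dimension three it equals `⟨k(w), u × v⟩` with `k(w) = (3
w₂, -3 w₂, 3 w₁ + 6 w₂)`, and Cramer's rule gives `ω(g, h, w) f + ω(h, f, w) g + ω(f, g, w) h = Δ
k(w)`, where `Δ` is the determinant of `f, g, h`. The goal is `k(f) = 0`. -/
theorem skewThree_eliminated {f₀ f₁ f₂ g₀ g₁ g₂ h₀ h₁ h₂ : ℝ}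
    (k₁ : skewThree g₀ g₁ g₂ h₀ h₁ h₂ f₁ f₂ = 0) (k₂ : skewThree g₀ g₁ g₂ h₀ h₁ h₂ g₁ g₂ = 0)
    (k₃ : skewThree f₀ f₁ f₂ g₀ g₁ g₂ f₁ f₂ = 0) (n₁ : skewThree g₀ g₁ g₂ h₀ h₁ h₂ h₁ h₂ ≠ 0)
    (n₂ : skewThree f₀ f₁ f₂ g₀ g₁ g₂ g₁ g₂ ≠ 0) : f₁ = 0 ∧ f₂ = 0 := by
  set N := skewThree f₀ f₁ f₂ g₀ g₁ g₂ g₁ g₂ with hN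
  -- For `w = g` and zero determinant the identity makes `N h` a multiple of `g`, so `N` times `ω(g,
  -- h, h)` vanishes, against `n₁` and `n₂`.
  have hΔ : f₀ * (g₁ * h₂ - g₂ * h₁) - f₁ * (g₀ * h₂ - g₂ * h₀) + f₂ * (g₀ * h₁ - g₁ * h₀) ≠ 0 := by
    intro hΔ
    have e₀ : N * h₀ - skewThree f₀ f₁ f₂ h₀ h₁ h₂ g₁ g₂ * g₀ = 0 := by
      rw [hN]; simp only [skewThree] at k₂ ⊢
      linear_combination 3 * g₂ * hΔ - f₀ * k₂
    have e₁ : N * h₁ - skewThree f₀ f₁ f₂ h₀ h₁ h₂ g₁ g₂ * g₁ = 0 := by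
      rw [hN]; simp only [skewThree] at k₂ ⊢
      linear_combination -3 * g₂ * hΔ - f₁ * k₂
    have e₂ : N * h₂ - skewThree f₀ f₁ f₂ h₀ h₁ h₂ g₁ g₂ * g₂ = 0 := by
      rw [hN]; simp only [skewThree] at k₂ ⊢
      linear_combination (3 * g₁ + 6 * g₂) * hΔ - f₂ * k₂
    have : N * skewThree g₀ g₁ g₂ h₀ h₁ h₂ h₁ h₂ = 0 := by
      simp only [skewThree] at e₀ e₁ e₂ ⊢
      linear_combination (-(3 * h₁ + 6 * h₂) * g₁ - 3 * h₂ * g₂) * e₀ +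
        ((3 * h₁ + 6 * h₂) * g₀ - 3 * h₂ * g₂) * e₁ + 3 * h₂ * (g₀ + g₁) * e₂
    exact (mul_ne_zero n₂ n₁) this
  set Δ := f₀ * (g₁ * h₂ - g₂ * h₁) - f₁ * (g₀ * h₂ - g₂ * h₀) + f₂ * (g₀ * h₁ - g₁ * h₀)
  set E := -skewThree f₀ f₁ f₂ h₀ h₁ h₂ f₁ f₂ with hE
  -- The coordinates of the identity for `w = f`: by `k₁` and `k₃` it reads `Δ k(f) = E g`.
  have r₀ : Δ * (3 * f₂) = E * g₀ := by
    simp only [hE, Δ, skewThree] at k₁ k₃ ⊢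
    linear_combination f₀ * k₁ + h₀ * k₃
  have r₁ : Δ * (-3 * f₂) = E * g₁ := by
    simp only [hE, Δ, skewThree] at k₁ k₃ ⊢
    linear_combination f₁ * k₁ + h₁ * k₃
  have r₂ : Δ * (3 * f₁ + 6 * f₂) = E * g₂ := by
    simp only [hE, Δ, skewThree] at k₁ k₃ ⊢
    linear_combination f₂ * k₁ + h₂ * k₃
  by_cases hE0 : E = 0
  · rw [hE0, zero_mul] at r₀ r₂
    have h2 := (mul_eq_zero.1 r₀).resolve_left hΔ
    have h1 := (mul_eq_zero.1 r₂).resolve_left hΔ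
    constructor <;> linarith
  -- Otherwise `g` is proportional to `k(f)`, whose first two coordinates are opposite. Then `ω(g,
  -- h, g)` and `ω(f, g, g)` share the quadratic factor in `hk`; `k₂` forces it to vanish,
  -- contradicting `n₂`.
  · have hg : g₁ = -g₀ := by
      have : E * (g₀ + g₁) = 0 := by linear_combination -r₀ - r₁
      linarith [(mul_eq_zero.1 this).resolve_left hE0]
    have hh : h₀ + h₁ ≠ 0 := by
      intro h
      apply n₁
      rw [hg, show h₀ = -h₁ by linarith, skewThree]; ring
    have hk : (-3 * g₀ + 6 * g₂) * g₀ - 3 * g₂ * g₂ = 0 := by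
      refine (mul_eq_zero.1 (?_ : (h₀ + h₁) * _ = 0)).resolve_left hh
      rw [hg, skewThree] at k₂
      linear_combination k₂
    refine (n₂ ?_).elim
    rw [hN, hg, skewThree]
    linear_combination -(f₀ + f₁) * hk

theorem eq_zero_after_first {p : ℕ} (hp : p + 3 = d) {a b c : Fin d}
    (ha : (a : ℕ) = p) (hb : (b : ℕ) = p + 1) (hc : (c : ℕ) = p + 2) {f g h : Fin d → ℝ}
    (hf : VanishesBelow p f) (hg : VanishesBelow p g) (hh : VanishesBelow p h)
    (k₁ : skewForm d g h f = 0) (k₂ : skewForm d g h g = 0) (k₃ : skewForm d f g f = 0)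
    (n₁ : skewForm d g h h ≠ 0) (n₂ : skewForm d f g g ≠ 0) : ∀ j, a < j → f j = 0 := by
  rw [skewForm_last_three hp _ hf hg] at k₃ n₂
  rw [skewForm_last_three hp _ hg hh] at k₁ k₂ n₁
  obtain ⟨h1, h2⟩ := skewThree_eliminated k₁ k₂ k₃ n₁ n₂
  intro j hj
  rw [Fin.lt_def] at hj
  rcases Nat.lt_or_ge (p + 1) j with h | h
  · rwa [show j = ⟨p + 2, by omega⟩ from Fin.ext (by simp only; omega)]
  · rwa [show j = ⟨p + 1, by omega⟩ from Fin.ext (by simp only; omega)]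

theorem row_eq_smul_single {p : Fin d} {X : Matrix (Fin d) (Fin d) ℝ} (hX : BlockId p X)
    (h : ∀ j, p < j → X p j = 0) : X p = X p p • (Pi.single p 1 : Fin d → ℝ) := by
  ext i
  rcases lt_trichotomy i p with hi | rfl | hi
  · rw [hX.vanishesBelow le_rfl i hi]; simp [hi.ne]
  · simp
  · rw [h i hi]; simp [hi.ne']

theorem diag_ne_zero {p : Fin d} {X : Matrix (Fin d) (Fin d) ℝ} (hX : BlockId p X)
    (hu : IsUnit X) (h : ∀ j, p < j → X p j = 0) : X p p ≠ 0 := by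
  intro h0
  refine ((isUnit_iff_isUnit_det _).1 hu).ne_zero (det_eq_zero_of_row_eq_zero p fun j => ?_)
  have := congrFun (row_eq_smul_single hX h) j
  rwa [h0, zero_smul] at this

/-- Since `C p b p` vanishes for `b ≠ p`, once row `p` is a multiple of `e_p` the entries at `(p, j,
p)` expose column `p`. -/
theorem triForm_single_middle (p : Fin d) (g : Fin d → ℝ) :
    triForm (coreTensor d) (Pi.single p 1) g (Pi.single p 1) = g p := by
  have : ∀ b, coreTensor d p b p = if b = p then 1 else 0 := by
    intro b
    rcases lt_trichotomy b p with h | rfl | h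
    · simp [coreTensor, h.ne, h.ne', h.not_gt]
    · simp [coreTensor]
    · simp [coreTensor, h.ne, h.ne', h.not_gt]
  rw [triForm_apply, Finset.sum_eq_single p]
  · simp [Pi.single_apply, this]
  · intro a _ ha; simp [ha]
  · simp

theorem runs_transvection {a b : Fin d} (hab : a ≠ b) (x : ℝ) :
    (transvection a b x).Runs (d * (d * 1)) (Matrix.transvection a b x) := by
  refine runs_tabulate₂ fun i j => ?_
  by_cases h : i = a ∧ j = b
  · rw [if_pos h, h.1, h.2]
    exact (Runs.pure x).cost_le (by simp) |>.val (by
      rw [Matrix.transvection, Matrix.add_apply, single_apply_same, one_apply_ne hab, zero_add])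
  · rw [if_neg h]
    exact (runs_delta i j).val (by
      rw [Matrix.transvection, Matrix.add_apply, single_apply_of_ne _ _ _ _ _ (by tauto), add_zero])

theorem transvection_mul_row_same (a b : Fin d) (x : ℝ) (B : Matrix (Fin d) (Fin d) ℝ) :
    (Matrix.transvection a b x * B) a = B a + x • B b := by
  ext j; simp

theorem transvection_mul_row_of_ne {a i : Fin d} (hi : i ≠ a) (b : Fin d) (x : ℝ)
    (B : Matrix (Fin d) (Fin d) ℝ) : (Matrix.transvection a b x * B) i = B i := by
  ext j; simp [hi]

theorem blockId_transvection {p : ℕ} {a b : Fin d} (ha : p ≤ a) (hb : p ≤ b) (x : ℝ) :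
    BlockId p (Matrix.transvection a b x) := by
  intro i j h
  rw [Matrix.transvection, Matrix.add_apply, single_apply_of_ne, add_zero]
  rintro ⟨rfl, rfl⟩
  omega

theorem isUnit_transvection {a b : Fin d} (hab : a ≠ b) (x : ℝ) :
    IsUnit (Matrix.transvection a b x) :=
  (isUnit_iff_isUnit_det _).2 (by simp [det_transvection_of_ne _ _ hab])

theorem runs_applyCongruence_dense (hd : 1 ≤ d) (A : Fin d → Fin d → ℝ) (T : Tensor d ℝ) :
    (applyCongruence A T).Runs (10 * d ^ 4) (congruence (Matrix.of A) T) := by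
  refine (runs_applyCongruence A T).cost_le ?_
  have e3 : d ^ 3 ≤ d ^ 4 := Nat.pow_le_pow_right hd (by norm_num)
  have e2 : d ^ 2 ≤ d ^ 4 := Nat.pow_le_pow_right hd (by norm_num)
  calc _ ≤ d * d + 3 * (d * d * (2 * (d * d) + d)) := by gcongr; exact nnz_le A
    _ ≤ 10 * d ^ 4 := by ring_nf at *; linarith

theorem runs_matMul_le (hd : 1 ≤ d) (A B : Fin d → Fin d → ℝ) :
    (matMul A B).Runs (3 * d ^ 3) (Matrix.of A * Matrix.of B) := by
  refine (runs_matMul A B).cost_le ?_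
  have e2 : d ^ 2 ≤ d ^ 3 := Nat.pow_le_pow_right hd (by norm_num)
  ring_nf at *; linarith

/-- The first polynomial that has to be nonzero in the step with three remaining indices. -/
noncomputable def firstPoly (b c : Fin d) (B : Matrix (Fin d) (Fin d) ℝ) : ℝ :=
  skewForm d (B b) (B c) (B c)

/-- The second polynomial that has to be nonzero in the step with three remaining indices. -/
noncomputable def secondPoly (a b c : Fin d) (B : Matrix (Fin d) (Fin d) ℝ) : ℝ :=
  skewForm d (firstPoly b c B • B a - skewForm d (B b) (B c) (B a) • B c)
    (firstPoly b c B • B b - skewForm d (B b) (B c) (B b) • B c)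
    (firstPoly b c B • B b - skewForm d (B b) (B c) (B b) • B c)

/-- The three transvections enforce the three vanishing conditions of `skewThree_eliminated`, and
the first two tests are its two inequalities. The last test cannot fail once they hold. -/
theorem spec_up3Attempt {l : Filter ℝ} {ab : Prop} {p : ℕ} (hp : p + 3 = d) {a b c : Fin d}
    (ha : (a : ℕ) = p) (hb : (b : ℕ) = p + 1) (hc : (c : ℕ) = p + 2)
    {B : Matrix (Fin d) (Fin d) ℝ} (hB : BlockId p B) (hu : IsUnit B) :
    (up3Attempt a b c (congruence B (coreTensor d))).Spec l ab ((100 * d ^ 4 : ℕ) : ℕ∞) (fun o =>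
      (∀ Q, o = some Q → IsUpper a B (Matrix.of Q)) ∧
      (o = none → ¬ (firstPoly b c B ≠ 0 ∧ secondPoly a b c B ≠ 0))) := by
  classical
  have hab : a ≠ b := fun h => by rw [h] at ha; omega
  have hac : a ≠ c := fun h => by rw [h] at ha; omega
  have hbc : b ≠ c := fun h => by rw [h] at hb; omega
  have hd : 1 ≤ d := by omega
  have hX1 : 1 ≤ d ^ 4 := Nat.one_le_pow _ _ hd
  have hX2 : d * (d * 1) ≤ d ^ 4 := by
    have : d ^ 2 ≤ d ^ 4 := Nat.pow_le_pow_right hd (by norm_num)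
    ring_nf at *; linarith
  have hX3 : 3 * d ^ 3 ≤ 3 * d ^ 4 := Nat.mul_le_mul_left _ (Nat.pow_le_pow_right hd (by norm_num))
  rw [up3Attempt]
  refine Spec.cost_le (Runs.bind_spec (runs_sub _ _) (Runs.bind_spec (runs_isZero _)
    (c' := ((90 * d ^ 4 : ℕ) : ℕ∞)) ?_)) (by norm_cast; omega)
  rw [congruence_sub_swap]
  set δ := skewForm d (B b) (B c) (B c) with hδ
  by_cases hδ0 : δ = 0
  · rw [if_pos (decide_eq_true hδ0)]
    exact Spec.pure ⟨by simp, fun _ h => h.1 hδ0⟩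
  rw [if_neg (by simpa using hδ0)]
  set x₁ := -skewForm d (B b) (B c) (B b) / δ with hx₁
  set B₁ := Matrix.transvection b c x₁ * B with hB₁
  set x₂ := -skewForm d (B₁ b) (B c) (B a) / δ with hx₂
  set B₂ := Matrix.transvection a c x₂ * B₁ with hB₂
  have a₁ : B₁ a = B a := transvection_mul_row_of_ne hab _ _ _
  have b₁ : B₁ b = B b + x₁ • B c := transvection_mul_row_same _ _ _ _
  have c₁ : B₁ c = B c := transvection_mul_row_of_ne hbc.symm _ _ _
  have a₂ : B₂ a = B a + x₂ • B c := by rw [hB₂, transvection_mul_row_same, a₁, c₁]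
  have b₂ : B₂ b = B₁ b := transvection_mul_row_of_ne hab.symm _ _ _
  have c₂ : B₂ c = B c := by rw [hB₂, transvection_mul_row_of_ne hac.symm, c₁]
  have s₁ : ∀ w, skewForm d (B₁ b) (B c) w = skewForm d (B b) (B c) w := fun w => by
    rw [b₁, map_add, map_smul]
    simp [skewForm_self]
  have t₁ : skewForm d (B₁ b) (B c) (B₁ b) = 0 := by
    rw [s₁, b₁, map_add, map_smul, ← hδ, hx₁, smul_eq_mul]
    field_simp; ring
  have t₂ : skewForm d (B₁ b) (B c) (B₂ a) = 0 := by
    rw [a₂, map_add, map_smul, s₁ (B c), ← hδ, hx₂, smul_eq_mul]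
    field_simp; ring
  have first : congruence (Matrix.of (Matrix.transvection b c x₁)) (congruence B (coreTensor d)) =
      congruence B₁ (coreTensor d) := (congruence_mul _ _ _).symm
  have second : congruence (Matrix.of (Matrix.transvection a c x₂)) (congruence B₁ (coreTensor d)) =
      congruence B₂ (coreTensor d) := (congruence_mul _ _ _).symm
  have e₁ : (congruence B (coreTensor d) c b b - congruence B (coreTensor d) b c b) / δ = x₁ := by
    rw [congruence_sub_swap, skewForm_swap]
  have e₂ : (congruence B₁ (coreTensor d) c b a - congruence B₁ (coreTensor d) b c a) /
      (congruence B₁ (coreTensor d) b c c - congruence B₁ (coreTensor d) c b c) = x₂ := by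
    rw [congruence_sub_swap, congruence_sub_swap, skewForm_swap, c₁, s₁ (B c), a₁]
  refine Spec.cost_le (Runs.bind_spec (runs_sub _ _) (Runs.bind_spec (runs_div _ _) ?_
    (c' := ((80 * d ^ 4 : ℕ) : ℕ∞)))) (by norm_cast; omega)
  rw [e₁]
  refine Spec.cost_le (Runs.bind_spec (runs_transvection hbc _) (Runs.bind_spec
    (runs_applyCongruence_dense hd _ _) ?_ (c' := ((65 * d ^ 4 : ℕ) : ℕ∞)))) (by norm_cast; omega)
  rw [first]
  refine Spec.cost_le (Runs.bind_spec (runs_sub _ _) (Runs.bind_spec (runs_sub _ _)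
    (Runs.bind_spec (runs_div _ _) ?_ (c' := ((60 * d ^ 4 : ℕ) : ℕ∞))))) (by norm_cast; omega)
  rw [e₂]
  refine Spec.cost_le (Runs.bind_spec (runs_transvection hac _) (Runs.bind_spec
    (runs_applyCongruence_dense hd _ _) (Runs.bind_spec (runs_sub _ _) (Runs.bind_spec (runs_isZero _)
    ?_ (c' := ((40 * d ^ 4 : ℕ) : ℕ∞)))))) (by norm_cast; omega)
  rw [second, congruence_sub_swap]
  set ε := skewForm d (B₂ a) (B₂ b) (B₂ b) with hε
  by_cases hε0 : ε = 0
  · rw [if_pos (decide_eq_true hε0)]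
    refine Spec.pure ⟨by simp, fun _ h => h.2 ?_⟩
    -- Clearing the denominator `δ`: `secondPoly` is `δ ^ 3 * ε`, so a failed second test makes it
    -- vanish.
    have f₁ : δ • B b - skewForm d (B b) (B c) (B b) • B c = δ • B₂ b := by
      rw [b₂, b₁, smul_add, smul_smul, hx₁, mul_div_cancel₀ _ hδ0, neg_smul, sub_eq_add_neg]
    have f₂ : δ • B a - skewForm d (B b) (B c) (B a) • B c = δ • B₂ a := by
      rw [a₂, smul_add, smul_smul, hx₂, mul_div_cancel₀ _ hδ0, neg_smul, sub_eq_add_neg, s₁]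
    rw [secondPoly, firstPoly, ← hδ, f₁, f₂]
    simp only [map_smul, LinearMap.smul_apply, ← hε, hε0, smul_zero]
  rw [if_neg (by simpa using hε0)]
  set x₃ := -skewForm d (B₂ a) (B₂ b) (B₂ a) / ε with hx₃
  set B₃ := Matrix.transvection a b x₃ * B₂ with hB₃
  have third : congruence (Matrix.of (Matrix.transvection a b x₃)) (congruence B₂ (coreTensor d)) =
      congruence B₃ (coreTensor d) := (congruence_mul _ _ _).symm
  have e₃ : (congruence B₂ (coreTensor d) b a a - congruence B₂ (coreTensor d) a b a) / ε = x₃ := by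
    rw [congruence_sub_swap, skewForm_swap]
  have a₃ : B₃ a = B₂ a + x₃ • B₂ b := transvection_mul_row_same _ _ _ _
  have s₃ : ∀ w, skewForm d (B₃ a) (B₂ b) w = skewForm d (B₂ a) (B₂ b) w := fun w => by
    rw [a₃, map_add, map_smul]
    simp [skewForm_self]
  have t₃ : skewForm d (B₃ a) (B₂ b) (B₃ a) = 0 := by
    rw [s₃, a₃, map_add, map_smul, ← hε, hx₃, smul_eq_mul]
    field_simp; ring
  have t₂' : skewForm d (B₂ b) (B c) (B₃ a) = 0 := by
    rw [a₃, map_add, map_smul, b₂, t₂, t₁, smul_zero, add_zero]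
  have hT₁ := blockId_transvection (p := p) (a := b) (b := c) (by omega) (by omega) x₁
  have hT₂ := blockId_transvection (p := p) (a := a) (b := c) (by omega) (by omega) x₂
  have hT₃ := blockId_transvection (p := p) (a := a) (b := b) (by omega) (by omega) x₃
  have hB₂' := hT₂.mul (hT₁.mul hB)
  have hB₃' := hT₃.mul hB₂'
  have va : VanishesBelow p (B₃ a) := hB₃'.vanishesBelow ha.ge
  have vb : VanishesBelow p (B₂ b) := hB₂'.vanishesBelow (by omega)
  have vc : VanishesBelow p (B c) := hB.vanishesBelow (by omega)
  have hrow : ∀ j, a < j → B₃ a j = 0 := by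
    refine eq_zero_after_first hp ha hb hc va vb vc t₂' ?_ t₃ ?_ ?_
    · rw [b₂]; exact t₁
    · rw [b₂, s₁]; exact hδ0
    · rw [s₃]; exact hε0
  have hB₃u : IsUnit B₃ := (isUnit_transvection hab _).mul ((isUnit_transvection hac _).mul
    ((isUnit_transvection hbc _).mul hu))
  have hprod : Matrix.transvection a b x₃ * (Matrix.transvection a c x₂ * Matrix.transvection b c x₁) * B = B₃ := by
    simp only [hB₃, hB₂, hB₁, Matrix.mul_assoc]
  refine Spec.cost_le (Runs.bind_spec (runs_sub _ _) (Runs.bind_spec (runs_div _ _) ?_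
    (c' := ((30 * d ^ 4 : ℕ) : ℕ∞)))) (by norm_cast; omega)
  rw [e₃]
  refine Spec.cost_le (Runs.bind_spec (runs_transvection hab _) (Runs.bind_spec
    (runs_applyCongruence_dense hd _ _) (Runs.bind_spec (runs_isZero _) ?_
    (c' := ((10 * d ^ 4 : ℕ) : ℕ∞))))) (by norm_cast; omega)
  rw [third]
  -- The entry is the cube of the diagonal entry of `B₃` at `a`, nonzero by invertibility.
  have hne : congruence B₃ (coreTensor d) a a a ≠ 0 := by
    have hd := diag_ne_zero (p := a) (ha ▸ hB₃') hB₃u hrow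
    rw [congruence_apply, row_eq_smul_single (p := a) (ha ▸ hB₃') hrow]
    simp only [map_smul, LinearMap.smul_apply, triForm_single_middle, smul_eq_mul, Pi.single_eq_same]
    exact mul_ne_zero hd (mul_ne_zero hd (mul_ne_zero hd one_ne_zero))
  rw [if_neg (by simpa using hne)]
  refine Spec.cost_le (Runs.bind_spec (runs_matMul_le hd _ _) (Runs.bind_spec (runs_matMul_le hd _ _)
    (c' := 0) (Spec.pure ⟨fun Q hQ => ?_, by simp⟩))) (by norm_cast; omega)
  obtain rfl := Option.some.inj hQ
  have hT := (isUnit_transvection hab x₃).mul ((isUnit_transvection hac x₂).mul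
    (isUnit_transvection hbc x₁))
  refine ⟨ha ▸ (hT₃.mul (hT₂.mul hT₁) :), hT, fun j hj => ?_⟩
  exact (congrFun (congrFun hprod a) j).trans (hrow j hj)

end LastSteps

/-! ### Cost and correctness of the upper transformation in all cases -/

section UpTransform

variable {d : ℕ} {p : Fin (d - 1)} {B : Matrix (Fin d) (Fin d) ℝ}

theorem PolyOnLines.skewForm {E : Type} [AddCommGroup E] [Module ℝ E] {f g h : E → Fin d → ℝ}
    (hf : ∀ i, PolyOnLines fun x => f x i) (hg : ∀ i, PolyOnLines fun x => g x i)
    (hh : ∀ i, PolyOnLines fun x => h x i) :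
    PolyOnLines fun x => SigLearn.skewForm d (f x) (g x) (h x) := by
  simp only [SigLearn.skewForm, triForm_apply]
  exact .sum _ fun a => .sum _ fun b => .sum _ fun c => (((const _).mul (hf a)).mul (hg b)).mul (hh c)

theorem polyOnLines_firstPoly (b c : Fin d) (B : Matrix (Fin d) (Fin d) ℝ) :
    PolyOnLines fun W => firstPoly b c (W * B) :=
  .skewForm (.matrix_mul B b) (.matrix_mul B c) (.matrix_mul B c)

theorem polyOnLines_secondPoly (a b c : Fin d) (B : Matrix (Fin d) (Fin d) ℝ) :
    PolyOnLines fun W => secondPoly a b c (W * B) := by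
  have h : ∀ k i, PolyOnLines fun W : Matrix (Fin d) (Fin d) ℝ =>
      (firstPoly b c (W * B) • (W * B) k -
        skewForm d ((W * B) b) ((W * B) c) ((W * B) k) • (W * B) c) i := fun k i =>
    ((polyOnLines_firstPoly b c B).mul (.matrix_mul B k i)).sub
      ((PolyOnLines.skewForm (.matrix_mul B b) (.matrix_mul B c) (.matrix_mul B k)).mul
        (.matrix_mul B c i))
  exact .skewForm (h a) (h b) (h b)

theorem firstPoly_one {b c : Fin d} (hbc : b < c) : firstPoly b c 1 ≠ 0 := by
  have h : ∀ i : Fin d, (1 : Matrix (Fin d) (Fin d) ℝ) i = Pi.single i 1 := fun i => by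
    ext j; simp [one_apply, Pi.single_apply, eq_comm]
  simp [firstPoly, h, skewForm_single_single hbc, coreWeight_apply, Pi.single_apply]

theorem secondPoly_one {a b c : Fin d} (hab : a < b) (hbc : b < c) : secondPoly a b c 1 ≠ 0 := by
  have h : ∀ i : Fin d, (1 : Matrix (Fin d) (Fin d) ℝ) i = Pi.single i 1 := fun i => by
    ext j; simp [one_apply, Pi.single_apply, eq_comm]
  have h1 := firstPoly_one hbc
  have h2 : skewForm d (Pi.single b 1) (Pi.single c 1) (Pi.single b 1) = 0 := by
    rw [skewForm_single_single hbc, coreWeight_single_of_lt hbc]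
  have h3 : skewForm d (Pi.single b 1) (Pi.single c 1) (Pi.single a 1) = 0 := by
    rw [skewForm_single_single hbc, coreWeight_single_of_lt (hab.trans hbc)]
  have h4 : skewForm d (Pi.single a 1) (Pi.single b 1) (Pi.single b 1) ≠ 0 := by
    simp [skewForm_single_single hab, coreWeight_apply, Pi.single_apply]
  simp only [secondPoly, h, h2, h3, zero_smul, sub_zero, map_smul, LinearMap.smul_apply, smul_eq_mul]
  exact mul_ne_zero h1 (mul_ne_zero h1 (mul_ne_zero h1 h4))

theorem one_le_of_pivot (p : Fin (d - 1)) : 1 ≤ d := by have := p.2; omega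

theorem always_up3 (hp : (p : ℕ) + 3 = d) (N : ℕ) (hB : BlockId p B) (hu : IsUnit B) :
    (up3 p hp N (congruence B (coreTensor d))).Spec ⊤ True ⊤
      (fun Q => IsUpper (pivot p) B (Matrix.of Q)) := by
  induction N generalizing B with
  | zero => trivial
  | succ N ih =>
    rw [up3]
    refine Spec.cost_le (Spec.bind (spec_up3Attempt hp rfl rfl rfl hB hu)
      (c' := ⊤) fun o ho => ?_) le_top
    cases o with
    | some Q => exact Spec.pure (ho.1 Q rfl)
    | none =>
      refine Spec.cost_le ((always_randBlock p N).bind fun W hW => (runs_applyCongruence W _).bind_spec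
        (c' := ⊤) ?_) le_top
      rw [← congruence_mul]
      refine Spec.cost_le ((ih (hW.1.mul hB) (hW.2.mul hu)).bind fun Q hQ =>
        (runs_matMul Q W).spec (hQ.mul hW.1 hW.2)) le_top

theorem spec_up3_of_generic {l : Filter ℝ} {ab : Prop} (hp : (p : ℕ) + 3 = d) {N : ℕ}
    (hN : N = 0 → ab) (hB : BlockId p B) (hu : IsUnit B)
    (h : firstPoly ⟨p + 1, by omega⟩ ⟨p + 2, by omega⟩ B ≠ 0 ∧
      secondPoly ⟨p, by omega⟩ ⟨p + 1, by omega⟩ ⟨p + 2, by omega⟩ B ≠ 0) :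
    (up3 p hp N (congruence B (coreTensor d))).Spec l ab ((100 * d ^ 4 : ℕ) : ℕ∞)
      (fun Q => IsUpper (pivot p) B (Matrix.of Q)) := by
  cases N with
  | zero => exact hN rfl
  | succ N =>
    rw [up3, ← add_zero ((100 * d ^ 4 : ℕ) : ℕ∞)]
    refine Spec.bind (spec_up3Attempt hp rfl rfl rfl hB hu) fun o ho => ?_
    cases o with
    | some Q => exact Spec.pure (ho.1 Q rfl)
    | none => exact (ho.2 rfl h).elim

/-- If the first pass fails, a random block matrix almost surely makes both test polynomials
nonzero, since they do not vanish at the identity. Hence two attempts suffice. -/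
theorem spec_up3 {ν : Measure ℝ} [NullSingletonClass ν] {ab : Prop} (hp : (p : ℕ) + 3 = d) {N : ℕ}
    (hN : N < 2 → ab) (hB : BlockId p B) (hu : IsUnit B) :
    (up3 p hp N (congruence B (coreTensor d))).Spec (ae ν) ab ((300 * d ^ 4 : ℕ) : ℕ∞)
      (fun Q => IsUpper (pivot p) B (Matrix.of Q)) := by
  cases N with
  | zero => exact hN zero_lt_two
  | succ N =>
    have hd := one_le_of_pivot p
    have e3 : d ^ 3 ≤ d ^ 4 := Nat.pow_le_pow_right hd (by norm_num)
    have hab : (⟨p, by omega⟩ : Fin d) < ⟨p + 1, by omega⟩ := by simp [Fin.lt_def]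
    have hbc : (⟨p + 1, by omega⟩ : Fin d) < ⟨p + 2, by omega⟩ := by simp [Fin.lt_def]
    rw [up3]
    refine Spec.cost_le (Spec.bind (spec_up3Attempt hp rfl rfl rfl hB hu)
      (c' := ((200 * d ^ 4 : ℕ) : ℕ∞)) fun o ho => ?_) (by norm_cast; omega)
    cases o with
    | some Q => exact Spec.pure (ho.1 Q rfl)
    | none =>
      obtain ⟨W₀, hW₀, hZ⟩ := exists_blockId_mul_eq hB hu (BlockId.one (p := p))
      refine Spec.cost_le ((spec_randBlock p (fun h => hN (by omega)) (ι := Bool)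
        (F := fun b W => if b then firstPoly ⟨p + 1, by omega⟩ ⟨p + 2, by omega⟩ (W * B) else
          secondPoly ⟨p, by omega⟩ ⟨p + 1, by omega⟩ ⟨p + 2, by omega⟩ (W * B))
        (fun b => ?_) (fun b => ⟨W₀, hW₀, ?_⟩)).bind fun W hW =>
        Runs.bind_spec (runs_applyCongruence_dense hd W _) (c' := ((103 * d ^ 4 : ℕ) : ℕ∞)) ?_)
        (by norm_cast; omega)
      · cases b
        · exact polyOnLines_secondPoly _ _ _ B
        · exact polyOnLines_firstPoly _ _ B
      · rw [hZ]
        cases b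
        · exact secondPoly_one hab hbc
        · exact firstPoly_one hbc
      · rw [← congruence_mul]
        refine Spec.cost_le ((spec_up3_of_generic hp (fun h => hN (by omega)) (hW.1.mul hB)
          (hW.2.1.mul hu) ⟨hW.2.2 true, hW.2.2 false⟩).bind fun Q hQ =>
          (runs_matMul_le hd Q W).spec (hQ.mul hW.1 hW.2.1)) (by norm_cast; omega)

/-- The matrix of the transposition of `a` and `b`. -/
def swapMat (a b : Fin d) : Matrix (Fin d) (Fin d) ℝ := fun i j =>
  (1 : Matrix (Fin d) (Fin d) ℝ) (Equiv.swap a b i) j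

theorem swapMat_mul (a b : Fin d) (X : Matrix (Fin d) (Fin d) ℝ) (i j : Fin d) :
    (swapMat a b * X) i j = X (Equiv.swap a b i) j := by
  simp [mul_apply, swapMat, one_apply]

theorem isUnit_swapMat (a b : Fin d) : IsUnit (swapMat a b) := by
  refine IsUnit.of_mul_eq_one (swapMat a b) ?_
  ext i j
  rw [swapMat_mul, swapMat, Equiv.swap_apply_self]

theorem blockId_swapMat {p : ℕ} {a b : Fin d} (ha : p ≤ a) (hb : p ≤ b) :
    BlockId p (swapMat a b) := by
  have fix : ∀ i : Fin d, (i : ℕ) < p → Equiv.swap a b i = i := fun i hi =>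
    Equiv.swap_apply_of_ne_of_ne (by rintro rfl; omega) (by rintro rfl; omega)
  rintro i j (hi | hj)
  · rw [swapMat, fix i hi]
  · simp only [swapMat, one_apply]
    congr 1
    rw [eq_iff_iff, Equiv.swap_apply_eq_iff, fix j hj]

/-- The tested number is `3 * B b b` times the determinant of the last two by two block. As `B` is
invertible it vanishes exactly when `B b b` does; then exchanging the rows already clears the entry,
and no randomness is needed. -/
theorem spec_up2 {l : Filter ℝ} {ab : Prop} (hp : (p : ℕ) + 2 = d) (hB : BlockId p B) (hu : IsUnit B) :
    (up2 ⟨p, by omega⟩ ⟨p + 1, by omega⟩ (congruence B (coreTensor d))).Spec l ab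
      ((10 * d ^ 4 : ℕ) : ℕ∞) (fun Q => IsUpper (pivot p) B (Matrix.of Q)) := by
  classical
  have hd := one_le_of_pivot p
  have hX1 : 1 ≤ d ^ 4 := Nat.one_le_pow _ _ hd
  have hX2 : d * (d * 1) ≤ d ^ 4 := by
    have : d ^ 2 ≤ d ^ 4 := Nat.pow_le_pow_right hd (by norm_num)
    ring_nf at *; linarith
  set a : Fin d := ⟨p, by omega⟩ with ha
  set b : Fin d := ⟨p + 1, by omega⟩ with hb
  have hab : a ≠ b := fun h => by simpa [ha, hb] using congrArg Fin.val h
  have va : VanishesBelow p (B a) := hB.vanishesBelow (by simp [ha])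
  have vb : VanishesBelow p (B b) := hB.vanishesBelow (by simp [hb])
  have hj : ∀ j, pivot p < j → j = b := fun j hj => by
    rw [Fin.lt_def] at hj
    exact Fin.ext (by simp only [hb, pivot] at hj ⊢; omega)
  rw [up2]
  refine Spec.cost_le (Runs.bind_spec (runs_sub _ _) (Runs.bind_spec (runs_isZero _)
    (c' := ((5 * d ^ 4 : ℕ) : ℕ∞)) ?_)) (by norm_cast; omega)
  rw [congruence_sub_swap, skewForm_last_two hp _ va vb]
  by_cases hδ : 3 * B b b * (B a a * B b b - B a b * B b a) = 0
  · rw [if_pos (decide_eq_true hδ)]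
    have hruns : (permMat a b : Prog ℝ _).Runs (d * (d * 1)) (swapMat a b) :=
      runs_tabulate₂ fun i j => runs_delta _ _
    refine Spec.cost_le (hruns.spec ⟨blockId_swapMat (by simp [pivot, ha]) (by simp [pivot, hb]),
      isUnit_swapMat a b, ?_⟩) (by norm_cast; omega)
    · intro j hj'
      rw [hj j hj']
      change (swapMat a b * B) a b = 0
      rw [swapMat_mul, Equiv.swap_apply_left]
      by_contra hbb
      have hdet : B a a * B b b - B a b * B b a = 0 :=
        (mul_eq_zero.1 hδ).resolve_left (mul_ne_zero three_ne_zero hbb)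
      -- A zero determinant would give a linear relation between rows `a` and `b`.
      have h0 : (Pi.single a (B b b) - Pi.single b (B a b)) ᵥ* B = 0 := by
        ext j
        rw [sub_vecMul, Pi.sub_apply, single_vecMul, single_vecMul]
        change B b b * B a j - B a b * B b j = 0
        rcases lt_or_ge (j : ℕ) p with h | h
        · rw [va j h, vb j h]; ring
        · rcases h.lt_or_eq with h | h
          · rw [hj j h]; ring
          · rw [show j = a from Fin.ext h.symm]; linarith
      have h1 := vecMul_injective_of_isUnit hu (h0.trans (zero_vecMul B).symm)
      have := congrFun h1 a
      simp [hab] at this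
      exact hbb this
  · rw [if_neg (by simpa using hδ)]
    have hbb : B b b ≠ 0 := fun h => hδ (by rw [h]; ring)
    have hdet : B a a * B b b - B a b * B b a ≠ 0 := fun h => hδ (by rw [h]; ring)
    refine Spec.cost_le (Runs.bind_spec (runs_sub _ _) (Runs.bind_spec (runs_div _ _)
      ((runs_transvection hab _).spec ⟨blockId_transvection (by simp [pivot, ha]) (by simp [pivot, hb]) _,
        isUnit_transvection hab _, fun j hj' => ?_⟩))) (by norm_cast; omega)
    rw [hj j hj']
    refine (congrFun (transvection_mul_row_same a b _ B) b).trans ?_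
    rw [congruence_sub_swap, skewForm_swap, skewForm_last_two hp _ va vb]
    simp only [Pi.add_apply, Pi.smul_apply, smul_eq_mul]
    change B a b + -(3 * B a b * (B a a * B b b - B a b * B b a)) /
      (3 * B b b * (B a a * B b b - B a b * B b a)) * B b b = 0
    field_simp
    ring

theorem always_upTransform (N : ℕ) (hB : BlockId p B) (hu : IsUnit B) :
    (upTransform N p (congruence B (coreTensor d))).Spec ⊤ True ⊤
      (fun Q => IsUpper (pivot p) B (Matrix.of Q)) := by
  rw [upTransform]
  split_ifs with h4 h3
  · exact always_up4 N hB hu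
  · exact always_up3 h3 N hB hu
  · exact (spec_up2 (by have := p.2; omega) hB hu).cost_le le_top

theorem spec_upTransform_last {ν : Measure ℝ} [NullSingletonClass ν] {ab : Prop}
    (hp : ¬ (p : ℕ) + 4 ≤ d) {N : ℕ} (hN : N < 2 → ab) (hB : BlockId p B) (hu : IsUnit B) :
    (upTransform N p (congruence B (coreTensor d))).Spec (ae ν) ab ((300 * d ^ 4 : ℕ) : ℕ∞)
      (fun Q => IsUpper (pivot p) B (Matrix.of Q)) := by
  rw [upTransform, if_neg hp]
  split_ifs with h3
  · exact spec_up3 h3 hN hB hu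
  · exact (spec_up2 (by have := p.2; omega) hB hu).cost_le (by norm_cast; omega)

end UpTransform

/-! ## The main loop -/

theorem realCbrt_pow_three (x : ℝ) : realCbrt (x ^ 3) = x := by
  have key : ∀ y : ℝ, 0 ≤ y → (y ^ 3) ^ (1 / 3 : ℝ) = y := fun y hy => by
    rw [← Real.rpow_natCast, ← Real.rpow_mul hy]; norm_num
  rw [realCbrt]
  split_ifs with h
  · exact key x ((Odd.pow_nonneg_iff (by decide)).1 h)
  · have hx : x < 0 := (Odd.pow_neg_iff (by decide)).1 (not_le.1 h)
    rw [show -x ^ 3 = (-x) ^ 3 by ring, key _ (by linarith), neg_neg]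

section Loop

variable {d : ℕ} {p : Fin (d - 1)} {A B : Matrix (Fin d) (Fin d) ℝ}

/-- The identity matrix with the entry at `(a, a)` replaced by `r`. -/
def diagMat (a : Fin d) (r : ℝ) : Matrix (Fin d) (Fin d) ℝ := diagonal (Function.update 1 a r)

theorem runs_diagGauss (a : Fin d) (h : ℝ) :
    (diagGauss a h).Runs (1 + d * (d * 1)) (diagMat a (realCbrt h)) := by
  refine (runs_cbrt h).bind (runs_tabulate₂ fun i j => ?_)
  by_cases hij : i = a ∧ j = a
  · rw [if_pos hij, hij.1, hij.2]
    exact (Runs.pure _).cost_le (by simp) |>.val (by simp [diagMat])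
  · rw [if_neg hij]
    refine (runs_delta i j).val ?_
    rw [diagMat, diagonal_apply, one_apply]
    split_ifs with h
    · rw [Function.update_of_ne (by rintro rfl; exact hij ⟨rfl, h.symm⟩)]; rfl
    · rfl

theorem isUnit_diagMat (a : Fin d) {r : ℝ} (hr : r ≠ 0) : IsUnit (diagMat a r) := by
  rw [isUnit_iff_isUnit_det, diagMat, det_diagonal, isUnit_iff_ne_zero]
  refine Finset.prod_ne_zero_iff.2 fun i _ => ?_
  rcases eq_or_ne i a with rfl | h
  · simpa
  · simp [h]

/-- The matrix `L^{(s,y)}`. -/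
def lowerMat (p : Fin (d - 1)) (y : Fin (d - (p + 1)) → ℝ) : Matrix (Fin d) (Fin d) ℝ := fun i j =>
  if h : (j : ℕ) = p ∧ (p : ℕ) < i then y ⟨(i : ℕ) - (p + 1), by omega⟩
  else (1 : Matrix (Fin d) (Fin d) ℝ) i j

theorem runs_lowerGauss (p : Fin (d - 1)) (y : Fin (d - (p + 1)) → ℝ) :
    (lowerGauss p y).Runs (d * (d * 1)) (lowerMat p y) := by
  refine runs_tabulate₂ fun i j => ?_
  rw [lowerMat]
  by_cases h : (j : ℕ) = p ∧ (p : ℕ) < i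
  · rw [dif_pos h, dif_pos h]
    exact (Runs.pure _).cost_le (by simp)
  · rw [dif_neg h, dif_neg h]
    exact runs_delta i j

theorem lowerMat_apply (y : Fin (d - (p + 1)) → ℝ) (i j : Fin d) : lowerMat p y i j =
    (1 : Matrix (Fin d) (Fin d) ℝ) i j + if j = pivot p then tailLift p y i else 0 := by
  rw [lowerMat, tailLift]
  by_cases hj : j = pivot p
  · by_cases hi : (p : ℕ) < i
    · rw [dif_pos ⟨by rw [hj]; rfl, hi⟩, if_pos hj, dif_pos hi, one_apply_ne, zero_add]
      rintro rfl
      rw [hj] at hi; simp [pivot] at hi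
    · rw [dif_neg (by tauto), if_pos hj, dif_neg hi, add_zero]
  · rw [dif_neg (fun h => hj (Fin.ext h.1)), if_neg hj, add_zero]

theorem lowerMat_mul (y : Fin (d - (p + 1)) → ℝ) (X : Matrix (Fin d) (Fin d) ℝ) (i j : Fin d) :
    (lowerMat p y * X) i j = X i j + tailLift p y i * X (pivot p) j := by
  simp [mul_apply, lowerMat_apply, add_mul, Finset.sum_add_distrib, one_apply]

theorem isUnit_lowerMat (p : Fin (d - 1)) (y : Fin (d - (p + 1)) → ℝ) : IsUnit (lowerMat p y) := by
  rw [isUnit_iff_isUnit_det, det_of_isLowerTriangular]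
  · rw [Finset.prod_eq_one fun i _ => by rw [lowerMat, dif_neg (by omega), one_apply_eq]]
    exact isUnit_one
  · intro i j hij
    have hij : i < j := hij
    rw [Fin.lt_def] at hij
    rw [lowerMat, dif_neg (by omega), one_apply_ne]
    rintro rfl; omega

/-- The lower transformation completes the elimination of a row and a column. -/
theorem lower_mul_eq_trunc {X : Matrix (Fin d) (Fin d) ℝ} (hX : BlockId p X)
    (h : ∀ j, pivot p < j → X (pivot p) j = 0) {r : ℝ} (hr : r * X (pivot p) (pivot p) = 1)
    {y : Fin (d - (p + 1)) → ℝ}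
    (hy : ∀ c, y c * X (pivot p) (pivot p) = -X (tail p c) (pivot p)) :
    diagMat (pivot p) r * lowerMat p y * X = trunc (p + 1) X := by
  have hrow : ∀ j, X (pivot p) j = X (pivot p) (pivot p) * (Pi.single (pivot p) 1 : Fin d → ℝ) j :=
    fun j => congrFun (row_eq_smul_single (p := pivot p) hX h) j
  ext i j
  rw [Matrix.mul_assoc, diagMat, diagonal_mul, lowerMat_mul, trunc]
  rcases lt_trichotomy i (pivot p) with hi | rfl | hi
  · have hi' : (i : ℕ) < p := hi
    rw [Function.update_of_ne hi.ne, if_pos (by omega), vanishesBelow_tailLift p y i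
      (by simp only [pivot]; omega), hX i j (.inl hi')]
    simp
  · rw [Function.update_self, if_pos (by simp [pivot]), vanishesBelow_tailLift p y _ (by simp),
      zero_mul, add_zero, hrow, ← mul_assoc, hr, one_mul, one_apply, Pi.single_apply]
    simp only [eq_comm]
  · obtain ⟨c, rfl⟩ := exists_tail_eq hi
    have hi' : ¬ ((tail p c : Fin d) : ℕ) < p + 1 := by simp only [tail]; omega
    rw [Function.update_of_ne hi.ne', tailLift_tail, hrow, ← mul_assoc, hy]
    rcases lt_trichotomy j (pivot p) with hj | rfl | hj
    · have hj' : (j : ℕ) < p := hj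
      rw [if_pos (by omega), hX _ j (.inr hj')]
      simp [hj.ne]
    · rw [if_pos (by simp [pivot]), one_apply_ne hi.ne']
      simp
    · have hj' : ¬ (j : ℕ) < p + 1 := by
        have : (p : ℕ) < j := hj
        omega
      rw [if_neg (by tauto)]
      simp [hj.ne']

theorem BlockId.congruence_pivot {X : Matrix (Fin d) (Fin d) ℝ} (hX : BlockId p X)
    (h : ∀ j, pivot p < j → X (pivot p) j = 0) (j : Fin d) :
    congruence X (coreTensor d) (pivot p) j (pivot p) = X (pivot p) (pivot p) ^ 2 * X j (pivot p) := by
  rw [congruence_apply, row_eq_smul_single (p := pivot p) hX h]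
  simp only [map_smul, LinearMap.smul_apply, triForm_single_middle, smul_eq_mul]
  simp
  ring

/-- The state of the main loop before the step with pivot `k`, when the input is `A * C`. -/
def LoopInvariant (A : Matrix (Fin d) (Fin d) ℝ) (k : ℕ)
    (s : (Fin d → Fin d → ℝ) × Tensor d ℝ) : Prop :=
  IsUnit (Matrix.of s.1) ∧ BlockId k (Matrix.of s.1 * A) ∧
    s.2 = congruence (Matrix.of s.1 * A) (coreTensor d)

/-- The only cost besides the upper transformation that can exceed `O(d ^ 3)` is the congruence by
`Q`, namely `6 * m * d ^ 2` for `m` nonzero entries. `P` carries what is known about `Q` on to the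
next state. -/
theorem spec_learningStep {l : Filter ℝ} {ab : Prop} {N : ℕ} {c : ℕ∞} {m : ℕ}
    {s : (Fin d → Fin d → ℝ) × Tensor d ℝ} (hs : LoopInvariant A p s) (hA : IsUnit A)
    {P : Matrix (Fin d) (Fin d) ℝ → Prop}
    (h : (upTransform N p (congruence (Matrix.of s.1 * A) (coreTensor d))).Spec l ab c fun Q =>
      IsUpper (pivot p) (Matrix.of s.1 * A) (Matrix.of Q) ∧ nnz Q ≤ m ∧ P (Matrix.of Q)) :
    (learningStep N s p).Spec l ab (c + ((6 * m * d ^ 2 + 60 * d ^ 3 : ℕ) : ℕ∞)) (fun s' =>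
      LoopInvariant A (p + 1) s' ∧ ∃ Q, P Q ∧
        Matrix.of s'.1 * A = trunc (p + 1) (Q * (Matrix.of s.1 * A))) := by
  have hd := one_le_of_pivot p
  rw [learningStep, hs.2.2]
  refine Spec.bind h fun Qup hQ => ?_
  obtain ⟨hup, hnnz, hP⟩ := hQ
  set B := Matrix.of s.1 * A with hB
  set X := Matrix.of Qup * B with hX
  have hXu : IsUnit X := hup.2.1.mul (hs.1.mul hA)
  have hXb : BlockId p X := BlockId.mul hup.1 hs.2.1
  have hc := diag_ne_zero (p := pivot p) hXb hXu hup.2.2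
  have first : congruence (Matrix.of Qup) (congruence B (coreTensor d)) =
      congruence X (coreTensor d) := (congruence_mul _ _ _).symm
  have hH := hXb.congruence_pivot hup.2.2
  set x := X (pivot p) (pivot p) with hx
  set hinv : ℝ := 1 / (x ^ 2 * x) with hhinv
  -- The entry of `H` at the pivot is `x ^ 3`, so the real cube root recovers `x` with its sign.
  have hcb : realCbrt hinv = x⁻¹ := by
    rw [hhinv, show 1 / (x ^ 2 * x) = x⁻¹ ^ 3 by field_simp, realCbrt_pow_three]
  set y : Fin (d - (p + 1)) → ℝ := fun c => 0 - hinv * (x ^ 2 * X (tail p c) (pivot p)) with hy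
  have hlow : diagMat (pivot p) x⁻¹ * lowerMat p y * X = trunc (p + 1) X :=
    lower_mul_eq_trunc hXb hup.2.2 (inv_mul_cancel₀ hc) fun c => by
      simp only [hy, hhinv, ← hx]; field_simp; ring
  have hLu : IsUnit (diagMat (pivot p) x⁻¹ * lowerMat p y) :=
    (isUnit_diagMat _ (inv_ne_zero hc)).mul (isUnit_lowerMat p y)
  have hLn : nnz (diagMat (pivot p) x⁻¹ * lowerMat p y) ≤ 2 * d := by
    refine nnz_le_of_col (pivot p) fun i j hij => ?_
    rw [diagMat, diagonal_mul, lowerMat_apply] at hij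
    by_contra! hne
    rw [one_apply_ne hne.1, if_neg hne.2] at hij
    simp at hij
  refine Spec.cost_le (Runs.bind_spec (runs_applyCongruence Qup _) (Runs.bind_spec (runs_const 1)
    (Runs.bind_spec (runs_const 0) (Runs.bind_spec (runs_div _ _) (Runs.bind_spec
    (runs_tabulate_const fun c => (runs_mul _ _).bind (runs_sub _ _)) ?_
    (c' := ((50 * d ^ 3 : ℕ) : ℕ∞))))))) ?_
  · rw [first]
    simp only [hH, Rat.cast_one, Rat.cast_zero]
    refine Spec.cost_le (Runs.bind_spec (runs_diagGauss _ _) (Runs.bind_spec (runs_lowerGauss _ _)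
      (Runs.bind_spec (runs_matMul_le hd _ _) ?_ (c' := ((40 * d ^ 3 : ℕ) : ℕ∞))))) ?_
    · rw [← hx, ← hhinv, hcb]
      refine Spec.cost_le (Runs.bind_spec (Runs.cost_le (runs_applyCongruence _ _)
        (c' := d * d + 3 * (d * d * (2 * (2 * d) + d))) (by gcongr; exact hLn))
        (Runs.bind_spec (runs_matMul_le hd _ _) (Runs.bind_spec (runs_matMul_le hd _ _)
          (c' := 0) (Spec.pure ?_)))) ?_
      · have e : (diagMat (pivot p) x⁻¹ * lowerMat p y) * (Matrix.of Qup * Matrix.of s.1) * A =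
            trunc (p + 1) X := by
          rw [← hlow, hX, hB]; simp only [Matrix.mul_assoc]
        refine ⟨⟨hLu.mul (hup.2.1.mul hs.1), ?_, ?_⟩, Matrix.of Qup, hP, e⟩
        · change BlockId (p + 1) ((diagMat (pivot p) x⁻¹ * lowerMat p y) *
            (Matrix.of Qup * Matrix.of s.1) * A)
          rw [e]
          exact blockId_trunc _ _
        · change congruence (diagMat (pivot p) x⁻¹ * lowerMat p y) (congruence X (coreTensor d)) =
            congruence ((diagMat (pivot p) x⁻¹ * lowerMat p y) *
              (Matrix.of Qup * Matrix.of s.1) * A) _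
          rw [e, ← congruence_mul, hlow]
      · rw [add_zero]
        norm_cast
        have e2 : d ^ 2 ≤ d ^ 3 := Nat.pow_le_pow_right hd (by norm_num)
        have e0 : 1 ≤ d ^ 3 := Nat.one_le_pow _ _ hd
        ring_nf at *; linarith
    · norm_cast
      have e2 : d ^ 2 ≤ d ^ 3 := Nat.pow_le_pow_right hd (by norm_num)
      have e0 : 1 ≤ d ^ 3 := Nat.one_le_pow _ _ hd
      ring_nf at *; linarith
  · norm_cast
    have e2 : d ^ 2 ≤ d ^ 3 := Nat.pow_le_pow_right hd (by norm_num)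
    have e1 : d ≤ d ^ 3 := Nat.le_self_pow (by norm_num) d
    have e0 : 1 ≤ d ^ 3 := Nat.one_le_pow _ _ hd
    calc _ ≤ d * d + 3 * (d * d * (2 * m + d)) + (1 + (1 + (1 + (d * (1 + 1) + 50 * d ^ 3)))) := by
          gcongr; exact Nat.sub_le _ _
      _ ≤ _ := by ring_nf at *; linarith

end Loop

/-! ### The loop as a whole: invariant, total cost, and result -/

section Learning

variable {d : ℕ} {A : Matrix (Fin d) (Fin d) ℝ}

theorem loopInvariant_one (A : Matrix (Fin d) (Fin d) ℝ) :
    LoopInvariant A 0 ((1 : Matrix (Fin d) (Fin d) ℝ), congruence A (coreTensor d)) := by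
  have h : Matrix.of ((1 : Matrix (Fin d) (Fin d) ℝ) : Fin d → Fin d → ℝ) * A = A := Matrix.one_mul A
  refine ⟨isUnit_one, fun i j hij => by omega, ?_⟩
  simp only [h]

/-- Correctness alone: the flag and the costs play no role, so the loop rule is used with a constant
invariant and infinite budgets. -/
theorem always_loop (hA : IsUnit A) (N : ℕ) :
    ((List.finRange (d - 1)).foldlM (learningStep N)
      ((1 : Matrix (Fin d) (Fin d) ℝ), congruence A (coreTensor d))).Spec ⊤ True ⊤
      (LoopInvariant A (d - 1)) := by
  have step : ∀ (p : Fin (d - 1)) s, LoopInvariant A p s →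
      (learningStep N s p).Spec ⊤ True ⊤ (LoopInvariant A (p + 1)) := fun p s hs =>
    (spec_learningStep (m := d * d) (P := fun _ => True) hs hA
      ((always_upTransform N hs.2.1 (hs.1.mul hA)).imp fun Q hQ => ⟨hQ, nnz_le Q, trivial⟩)).mono
      le_top fun _ h => h.1
  exact (spec_foldlM (I := fun k _ => LoopInvariant A k) (c := fun _ => ⊤) (e := ⊤)
    step (fun p s hs => Or.inl (step p s hs)) true (loopInvariant_one A)).mono le_top
    fun s ⟨_, hs⟩ => hs

/-- The flag means that all remaining systems are generic. It is raised by the only step that draws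
a random matrix before the last two, so its surcharge of order `d ^ 4` is paid once. The total is
`300 + 2 * 400 + 1100 = 2200` times `d ^ 4`. -/
theorem spec_loop {ν : Measure ℝ} [NullSingletonClass ν] {ab : Prop} (hd : 2 ≤ d) (hA : IsUnit A)
    {N : ℕ} (hN : N < 2 → ab) :
    ((List.finRange (d - 1)).foldlM (learningStep N)
      ((1 : Matrix (Fin d) (Fin d) ℝ), congruence A (coreTensor d))).Spec (ae ν) ab
      ((2200 * d ^ 4 : ℕ) : ℕ∞) (LoopInvariant A (d - 1)) := by
  have e3 : d ^ 3 ≤ d ^ 4 := Nat.pow_le_pow_right (by omega) (by norm_num)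
  have e0 : 1 ≤ d ^ 3 := Nat.one_le_pow _ _ (by omega)
  let c : Fin (d - 1) → ℕ := fun p => 300 * d ^ 3 + 400 * d ^ 4 * if (p : ℕ) + 4 ≤ d then 0 else 1
  let I : ℕ → Bool → (Fin d → Fin d → ℝ) × Tensor d ℝ → Prop := fun k b s =>
    LoopInvariant A k s ∧ (b = true → GenericFrom k (Matrix.of s.1 * A))
  have cheap : ∀ (p : Fin (d - 1)) s, LoopInvariant A p s → (p : ℕ) + 4 ≤ d →
      InjectiveAt (pivot p) (Matrix.of s.1 * A) →
      (learningStep N s p).Spec (ae ν) ab (c p : ℕ∞) (fun s' => LoopInvariant A (p + 1) s' ∧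
        (GenericFrom p (Matrix.of s.1 * A) → GenericFrom (p + 1) (Matrix.of s'.1 * A))) := by
    intro p s hs hp hinj
    have hup : (upTransform N p (congruence (Matrix.of s.1 * A) (coreTensor d))).Spec (ae ν) ab
        ((210 * d ^ 3 : ℕ) : ℕ∞) (fun Q => IsUpper (pivot p) (Matrix.of s.1 * A) (Matrix.of Q) ∧
          nnz Q ≤ 2 * d ∧ ∀ i j, i ≠ pivot p →
            Matrix.of Q i j = (1 : Matrix (Fin d) (Fin d) ℝ) i j) := by
      rw [upTransform, if_pos hp]
      refine (spec_up4_of_injectiveAt (N := N) (fun h => hN (by omega)) hp hinj hs.2.1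
        (hs.1.mul hA)).imp fun Q hQ => ⟨hQ.1, nnz_le_of_row (pivot p) fun i j hij => ?_, hQ.2⟩
      by_contra! hne
      have := hQ.2 i j hne.2
      rw [one_apply_ne hne.1] at this
      exact hij this
    refine (spec_learningStep
      (P := fun Q => ∀ i j, i ≠ pivot p → Q i j = (1 : Matrix (Fin d) (Fin d) ℝ) i j)
      hs hA hup).mono ?_ fun s' hs' => ⟨hs'.1, fun hg => ?_⟩
    · norm_cast
      simp only [c, if_pos hp]
      ring_nf at *; linarith
    · obtain ⟨Q, hQ, hQ'⟩ := hs'.2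
      rw [hQ']
      refine (hg.mono (Nat.le_succ _)).congr fun i j hi hj => ?_
      have hip : i ≠ pivot p := by
        rintro rfl; simp [pivot] at hi
      rw [trunc, if_neg (by omega), mul_apply (M := Q)]
      simp [hQ i _ hip, one_apply]
  have last : ∀ (p : Fin (d - 1)) b s, LoopInvariant A p s → ¬ (p : ℕ) + 4 ≤ d →
      (learningStep N s p).Spec (ae ν) ab (c p : ℕ∞) (I (p + 1) b) := by
    intro p b s hs hp
    refine (spec_learningStep (m := d * d) (P := fun _ => True) hs hA
      ((spec_upTransform_last hp hN hs.2.1 (hs.1.mul hA)).imp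
        fun Q hQ => ⟨hQ, nnz_le Q, trivial⟩)).mono ?_ fun s' hs' => ⟨hs'.1, fun _ q => ?_⟩
    · norm_cast
      simp only [c, if_neg hp]
      ring_nf at *; linarith
    · have := q.2; omega
  have main := spec_foldlM (l := ae ν) (ab := ab) (f := learningStep N) (I := I)
    (c := fun p => (c p : ℕ∞)) (e := ((1100 * d ^ 4 : ℕ) : ℕ∞)) (fun p s hs => ?_)
    (fun p s hs => ?_) false ⟨loopInvariant_one A, by simp⟩
  · refine main.mono ?_ fun s ⟨_, hs⟩ => hs.1
    -- Only the pivots `d - 3` and `d - 2` are charged `d ^ 4` in any case.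
    have hsum : ∑ p : Fin (d - 1), (if (p : ℕ) + 4 ≤ d then 0 else 1) ≤ 2 := by
      rw [Fin.sum_univ_eq_sum_range (fun p => if p + 4 ≤ d then 0 else 1)]
      have : ∀ p, (if p + 4 ≤ d then 0 else 1) = if ¬ p + 4 ≤ d then 1 else 0 := fun p => by
        split_ifs <;> rfl
      simp only [this, ← Finset.card_filter]
      refine (Finset.card_le_card (t := Finset.Ico (d - 3) (d - 1)) fun p hp => ?_).trans ?_
      · simp only [Finset.mem_filter, Finset.mem_range, Finset.mem_Ico] at hp ⊢
        omega
      · rw [Nat.card_Ico]; omega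
    norm_cast
    simp only [c, Finset.sum_add_distrib, ← Finset.mul_sum, Finset.sum_const, Finset.card_univ,
      Fintype.card_fin, smul_eq_mul, if_false]
    have h1 := Nat.mul_le_mul_right (d ^ 3) (Nat.sub_le d 1)
    have h2 := Nat.mul_le_mul_left (400 * d ^ 4) hsum
    have h3 : d * d ^ 3 = d ^ 4 := by ring
    omega
  · by_cases hp : (p : ℕ) + 4 ≤ d
    · exact (cheap p s hs.1 hp ((hs.2 rfl).injectiveAt (p := pivot p)
        (by simp only [pivot]; omega) hs.1.2.1 (hs.1.1.mul hA))).imp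
        fun s' hs' => ⟨hs'.1, fun _ => hs'.2 (hs.2 rfl)⟩
    · exact last p true s hs.1 hp
  · by_cases hp : (p : ℕ) + 4 ≤ d
    · by_cases hinj : InjectiveAt (pivot p) (Matrix.of s.1 * A)
      · exact Or.inl ((cheap p s hs.1 hp hinj).imp fun s' hs' => ⟨hs'.1, by simp⟩)
      · right
        have hup : (upTransform N p (congruence (Matrix.of s.1 * A) (coreTensor d))).Spec (ae ν) ab
            ((1000 * d ^ 4 : ℕ) : ℕ∞) (fun Q => IsUpper (pivot p) (Matrix.of s.1 * A) (Matrix.of Q) ∧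
              nnz Q ≤ d * d ∧ GenericFrom (p + 1) (Matrix.of Q * (Matrix.of s.1 * A))) := by
          rw [upTransform, if_pos hp]
          exact (spec_up4_of_not_injectiveAt hN hp hinj hs.1.2.1 (hs.1.1.mul hA)).imp
            fun Q hQ => ⟨hQ.1, nnz_le Q, hQ.2⟩
        refine (spec_learningStep
          (P := fun Q => GenericFrom (p + 1) (Q * (Matrix.of s.1 * A))) hs.1 hA hup).mono ?_
          fun s' hs' => ⟨hs'.1, fun _ => ?_⟩
        · norm_cast
          simp only [c, if_pos hp]
          ring_nf at *; linarith
        · obtain ⟨Q, hQ, hQ'⟩ := hs'.2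
          rw [hQ']
          exact hQ.congr fun i j hi hj => by rw [trunc, if_neg (by omega)]
    · exact Or.inl (last p false s hs.1 hp)

/-- After the loop `Q A` is the identity except for its last diagonal entry, whose cube is the last
entry of the tensor. So the final diagonal matrix equals `Q A`, and `Q⁻¹ D = A`. -/
theorem BlockId.diagMat_last {X : Matrix (Fin d) (Fin d) ℝ} (hX : BlockId (d - 1) X) {q : Fin d}
    (hq : (q : ℕ) = d - 1) :
    diagMat q (X q q) = X ∧ congruence X (coreTensor d) q q q = X q q ^ 3 := by
  have hrow : X q = X q q • (Pi.single q 1 : Fin d → ℝ) :=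
    row_eq_smul_single (p := q) (by rwa [hq]) fun j hj => by
      have : (q : ℕ) < j := hj
      omega
  have hrow' : ∀ j, X q j = X q q * (Pi.single q 1 : Fin d → ℝ) j := fun j => congrFun hrow j
  constructor
  · ext i j
    rw [diagMat, diagonal_apply]
    by_cases hi : i = q
    · rw [hi, hrow' j, Function.update_self, Pi.single_apply]
      simp [eq_comm]
    · have hi' : (i : ℕ) < d - 1 := by
        have : (i : ℕ) ≠ q := fun h => hi (Fin.ext h)
        omega
      rw [hX i j (.inl hi'), one_apply, Function.update_of_ne hi]
      rfl
  · rw [congruence_apply, hrow]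
    simp only [map_smul, LinearMap.smul_apply, triForm_single_middle, smul_eq_mul]
    simp
    ring

theorem spec_tensorLearning {l : Filter ℝ} {ab : Prop} {c : ℕ∞} {N : ℕ} (hd : 2 ≤ d)
    (h : ((List.finRange (d - 1)).foldlM (learningStep N)
      ((1 : Matrix (Fin d) (Fin d) ℝ), congruence A (coreTensor d))).Spec l ab c
      (LoopInvariant A (d - 1))) :
    (tensorLearning N hd (congruence A (coreTensor d))).Spec l ab (c + ((100 * d ^ 4 : ℕ) : ℕ∞))
      (· = A) := by
  have hd1 : 1 ≤ d := by omega
  have e4 : 1 ≤ d ^ 4 := Nat.one_le_pow _ _ hd1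
  have e3 : d ^ 3 ≤ d ^ 4 := Nat.pow_le_pow_right hd1 (by norm_num)
  have e2 : d ^ 2 ≤ d ^ 4 := Nat.pow_le_pow_right hd1 (by norm_num)
  have e1 : d ≤ d ^ 4 := Nat.le_self_pow (by norm_num) d
  rw [tensorLearning]
  refine Spec.cost_le (Runs.bind_spec (c := d * (d * 1)) (a := (1 : Matrix (Fin d) (Fin d) ℝ))
    (runs_tabulate₂ fun i j => runs_delta i j) (h.bind (c' := ((98 * d ^ 4 : ℕ) : ℕ∞)) fun s hs => ?_)) ?_
  · refine Spec.cost_le ((spec_inverse s.1).bind (c' := ((10 * d ^ 4 : ℕ) : ℕ∞)) fun o ho => ?_) ?_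
    · cases o with
      | none => exact (ho.2 rfl hs.1).elim
      | some Qinv =>
        obtain ⟨hdiag, hG⟩ := hs.2.1.diagMat_last (q := ⟨d - 1, by omega⟩) rfl
        refine Spec.cost_le (Runs.bind_spec (runs_diagGauss _ _) (Runs.bind_spec (runs_matMul_le hd1 _ _)
          (c' := 0) (Spec.pure ?_))) ?_
        · rw [hs.2.2, hG, realCbrt_pow_three]
          refine (congrArg (Matrix.of Qinv * ·) hdiag).trans ?_
          rw [← Matrix.mul_assoc, mul_eq_one_comm.1 (ho.1 Qinv rfl), Matrix.one_mul]
        · rw [add_zero]; norm_cast; ring_nf at *; linarith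
    · norm_cast; ring_nf at *; linarith
  · rw [add_left_comm]
    gcongr
    norm_cast
    ring_nf at *; linarith

end Learning

/-! ## The signature of the transformed axis path -/

section Signature

variable {d : ℕ}

/-- The breakpoints of the axis path, as a subset of the line. -/
def breakpoints (d : ℕ) : Set ℝ := {t | ∃ m : ℤ, (d : ℝ) * t = m}

theorem countable_breakpoints (hd : d ≠ 0) : (breakpoints d).Countable := by
  refine (Set.countable_range fun m : ℤ => (m : ℝ) / d).mono ?_
  rintro t ⟨m, hm⟩
  exact ⟨m, by simp only; rw [← hm]; field_simp⟩

theorem cbrt_six_pow_three : ((6 : ℝ) ^ (1 / 3 : ℝ)) ^ 3 = 6 := by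
  rw [← Real.rpow_natCast, ← Real.rpow_mul (by norm_num)]; norm_num

theorem continuous_axisPath (i : Fin d) : Continuous fun t => axisPath d t i := by
  unfold axisPath; fun_prop

theorem monotone_axisPath (i : Fin d) : Monotone fun t => axisPath d t i := by
  intro s t hst
  simp only [axisPath]
  gcongr

theorem axisPath_of_le {i : Fin d} {t : ℝ} (h : (d : ℝ) * t ≤ i) : axisPath d t i = 0 := by
  rw [axisPath, max_eq_left ((min_le_right _ _).trans (by linarith)), mul_zero]

theorem axisPath_of_ge {i : Fin d} {t : ℝ} (h : (i : ℝ) + 1 ≤ d * t) :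
    axisPath d t i = (6 : ℝ) ^ (1 / 3 : ℝ) := by
  rw [axisPath, min_eq_left (by linarith), max_eq_right zero_le_one, mul_one]

theorem axisPath_zero (i : Fin d) : axisPath d 0 i = 0 := axisPath_of_le (by simp)

theorem axisPath_one (i : Fin d) : axisPath d 1 i = (6 : ℝ) ^ (1 / 3 : ℝ) :=
  axisPath_of_ge (by rw [mul_one]; exact_mod_cast i.2)

/-- Off the breakpoints, a coordinate of the axis path is locally constant, unless the time is
between the breakpoints that belong to it. -/
theorem hasDerivAt_axisPath {t : ℝ} (ht : t ∉ breakpoints d) (i : Fin d) :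
    ∃ v, HasDerivAt (fun t => axisPath d t i) v t ∧
      (v = 0 ∨ ((i : ℝ) < d * t ∧ (d : ℝ) * t < i + 1)) := by
  have hc : ContinuousAt (fun t : ℝ => (d : ℝ) * t) t := by fun_prop
  rcases lt_trichotomy ((d : ℝ) * t) i with h | h | h
  · refine ⟨0, (hasDerivAt_const t (0 : ℝ)).congr_of_eventuallyEq ?_, Or.inl rfl⟩
    filter_upwards [hc.eventually_lt_const h] with s hs using axisPath_of_le hs.le
  · exact (ht ⟨(i : ℕ), by simpa using h⟩).elim
  rcases lt_trichotomy ((d : ℝ) * t) (i + 1) with h' | h' | h'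
  · refine ⟨(6 : ℝ) ^ (1 / 3 : ℝ) * d, ?_, Or.inr ⟨h, h'⟩⟩
    have hl : HasDerivAt (fun s : ℝ => (6 : ℝ) ^ (1 / 3 : ℝ) * ((d : ℝ) * s - i))
        ((6 : ℝ) ^ (1 / 3 : ℝ) * d) t := by
      simpa using (((hasDerivAt_id t).const_mul (d : ℝ)).sub_const (i : ℝ)).const_mul
        ((6 : ℝ) ^ (1 / 3 : ℝ))
    refine hl.congr_of_eventuallyEq ?_
    filter_upwards [hc.eventually_const_lt h, hc.eventually_lt_const h'] with s hs hs'
    rw [axisPath, min_eq_right (by linarith), max_eq_right (by linarith)]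
  · exact (ht ⟨(i : ℕ) + 1, by simpa using h'⟩).elim
  · refine ⟨0, (hasDerivAt_const t ((6 : ℝ) ^ (1 / 3 : ℝ))).congr_of_eventuallyEq ?_, Or.inl rfl⟩
    filter_upwards [hc.eventually_const_lt h'] with s hs using axisPath_of_ge hs.le

/-- The coordinates move one after the other: while `j` moves, the earlier ones have reached their
end value and the later ones are still zero. This makes the iterated integrals polynomials in the
last coordinate. -/
theorem axisPath_of_lt_of_deriv_ne_zero {t : ℝ} (ht : t ∉ breakpoints d) {i j : Fin d} (hij : i < j)
    (h : deriv (fun t => axisPath d t j) t ≠ 0) : axisPath d t i = (6 : ℝ) ^ (1 / 3 : ℝ) := by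
  obtain ⟨v, hv, h0⟩ := hasDerivAt_axisPath ht j
  rw [hv.deriv] at h
  have : ((i : ℕ) : ℝ) + 1 ≤ (j : ℕ) := by exact_mod_cast hij
  exact axisPath_of_ge (this.trans (h0.resolve_left h).1.le)

theorem axisPath_of_gt_of_deriv_ne_zero {t : ℝ} (ht : t ∉ breakpoints d) {i j : Fin d} (hij : j < i)
    (h : deriv (fun t => axisPath d t j) t ≠ 0) : axisPath d t i = 0 := by
  obtain ⟨v, hv, h0⟩ := hasDerivAt_axisPath ht j
  rw [hv.deriv] at h
  have : ((j : ℕ) : ℝ) + 1 ≤ (i : ℕ) := by exact_mod_cast hij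
  exact axisPath_of_le ((h0.resolve_left h).2.le.trans this)

theorem hasDerivAt_axisPath_deriv {t : ℝ} (ht : t ∉ breakpoints d) (i : Fin d) :
    HasDerivAt (fun t => axisPath d t i) (deriv (fun t => axisPath d t i) t) t := by
  obtain ⟨v, hv, -⟩ := hasDerivAt_axisPath ht i
  exact hv.differentiableAt.hasDerivAt

/-- The second level iterated integrals of the axis path, as functions of its second coordinate. -/
noncomputable def areaPoly (i j : Fin d) (x : ℝ) : ℝ :=
  if i < j then (6 : ℝ) ^ (1 / 3 : ℝ) * x else if i = j then x ^ 2 / 2 else 0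

/-- The third level iterated integrals of the axis path, as functions of its third coordinate. -/
noncomputable def volumePoly (i j k : Fin d) (x : ℝ) : ℝ :=
  if j < k then areaPoly i j ((6 : ℝ) ^ (1 / 3 : ℝ)) * x
  else if j = k then
    if i < j then (6 : ℝ) ^ (1 / 3 : ℝ) * (x ^ 2 / 2) else if i = j then x ^ 3 / 6 else 0
  else 0

theorem areaPoly_zero (i j : Fin d) : areaPoly i j 0 = 0 := by simp [areaPoly]

theorem volumePoly_zero (i j k : Fin d) : volumePoly i j k 0 = 0 := by simp [volumePoly]

/-- With `κ ^ 3 = 6` the end values are `κ ^ 3 / 6 = 1`, `κ ^ 3 / 2 = 3`, `κ ^ 3 = 6` and 0, which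
explains the scaling of the axis path. -/
theorem volumePoly_end (i j k : Fin d) :
    volumePoly i j k ((6 : ℝ) ^ (1 / 3 : ℝ)) = coreTensor d i j k := by
  have h := cbrt_six_pow_three
  simp only [volumePoly, areaPoly, coreTensor]
  generalize (6 : ℝ) ^ (1 / 3 : ℝ) = κ at h ⊢
  split_ifs <;> first | omega | linarith

theorem continuous_areaPoly (i j : Fin d) : Continuous (areaPoly i j) := by
  unfold areaPoly; split_ifs <;> fun_prop

theorem continuous_volumePoly (i j k : Fin d) : Continuous (volumePoly i j k) := by
  unfold volumePoly; split_ifs <;> fun_prop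

theorem hasDerivAt_areaPoly {t : ℝ} (ht : t ∉ breakpoints d) (i j : Fin d) :
    HasDerivAt (fun t => areaPoly i j (axisPath d t j))
      (axisPath d t i * deriv (fun t => axisPath d t j) t) t := by
  have hj := hasDerivAt_axisPath_deriv ht j
  unfold areaPoly
  split_ifs with h h
  -- Where `j` stands still both sides vanish, so the value of coordinate `i` matters only while `j`
  -- moves.
  · by_cases h0 : deriv (fun t => axisPath d t j) t = 0
    · rw [h0] at hj ⊢
      simpa using hj.const_mul ((6 : ℝ) ^ (1 / 3 : ℝ))
    · rw [axisPath_of_lt_of_deriv_ne_zero ht h h0]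
      exact hj.const_mul _
  · subst h
    refine ((hj.pow 2).div_const 2).congr_deriv ?_
    simp; ring
  · by_cases h0 : deriv (fun t => axisPath d t j) t = 0
    · rw [h0, mul_zero]; exact hasDerivAt_const _ _
    · rw [axisPath_of_gt_of_deriv_ne_zero ht (by omega) h0, zero_mul]; exact hasDerivAt_const _ _

theorem hasDerivAt_volumePoly {t : ℝ} (ht : t ∉ breakpoints d) (i j k : Fin d) :
    HasDerivAt (fun t => volumePoly i j k (axisPath d t k))
      (areaPoly i j (axisPath d t j) * deriv (fun t => axisPath d t k) t) t := by
  have hk := hasDerivAt_axisPath_deriv ht k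
  unfold volumePoly
  split_ifs with h h hij hij
  · by_cases h0 : deriv (fun t => axisPath d t k) t = 0
    · rw [h0] at hk ⊢
      simpa using hk.const_mul (areaPoly i j ((6 : ℝ) ^ (1 / 3 : ℝ)))
    · rw [axisPath_of_lt_of_deriv_ne_zero ht h h0]
      exact hk.const_mul _
  · subst h
    refine (((hk.pow 2).div_const 2).const_mul ((6 : ℝ) ^ (1 / 3 : ℝ))).congr_deriv ?_
    simp [areaPoly, hij]; ring
  · subst h; subst hij
    refine ((hk.pow 3).div_const 6).congr_deriv ?_
    simp [areaPoly]; ring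
  · simp only [areaPoly, if_neg hij, ‹¬ i < j›, if_false, zero_mul]
    exact hasDerivAt_const _ _
  · by_cases h0 : deriv (fun t => axisPath d t k) t = 0
    · rw [h0, mul_zero]; exact hasDerivAt_const _ _
    · rw [axisPath_of_gt_of_deriv_ne_zero ht (by omega) h0, areaPoly_zero, zero_mul]
      exact hasDerivAt_const _ _

theorem hasDerivAt_mulVec_axisPath (A : Matrix (Fin d) (Fin d) ℝ) {t : ℝ} (ht : t ∉ breakpoints d)
    (i : Fin d) : HasDerivAt (fun t => A.mulVec (axisPath d t) i)
      (∑ a, A i a * deriv (fun t => axisPath d t a) t) t :=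
  HasDerivAt.fun_sum (u := Finset.univ) (A := fun a t => A i a * axisPath d t a) fun a _ =>
    (hasDerivAt_axisPath_deriv ht a).const_mul (A i a)

theorem continuous_mulVec_axisPath (A : Matrix (Fin d) (Fin d) ℝ) (i : Fin d) :
    Continuous fun t => A.mulVec (axisPath d t) i :=
  continuous_finsetSum Finset.univ (f := fun a t => A i a * axisPath d t a) fun a _ =>
    continuous_const.mul (continuous_axisPath a)

theorem ae_notMem_breakpoints (hd : d ≠ 0) : ∀ᵐ t : ℝ, t ∉ breakpoints d :=
  measure_eq_zero_iff_ae_notMem.1 ((countable_breakpoints hd).measure_zero _)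

theorem intervalIntegrable_deriv_mulVec_axisPath (hd : d ≠ 0) (A : Matrix (Fin d) (Fin d) ℝ)
    (i : Fin d) (a b : ℝ) :
    IntervalIntegrable (deriv fun t => A.mulVec (axisPath d t) i) volume a b := by
  have h : IntervalIntegrable (fun t => ∑ a, A i a * deriv (fun t => axisPath d t a) t)
      volume a b := by
    have := IntervalIntegrable.sum (μ := volume) (a := a) (b := b) Finset.univ
      (f := fun c t => A i c * deriv (fun t => axisPath d t c) t) fun c _ =>
        (((monotone_axisPath c).monotoneOn _).intervalIntegrable_deriv).const_mul _
    simpa [Finset.sum_fn] using this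
  refine h.congr_ae (ae_restrict_of_ae ?_)
  filter_upwards [ae_notMem_breakpoints hd] with t ht
  exact (hasDerivAt_mulVec_axisPath A ht i).deriv.symm

/-- The fundamental theorem of calculus off the breakpoints. -/
theorem integral_mul_deriv_axisPath (hd : d ≠ 0) (A : Matrix (Fin d) (Fin d) ℝ) (k : Fin d)
    {F g : ℝ → ℝ} (hF : Continuous F) (hF0 : F 0 = 0) (hg : Continuous g)
    (h : ∀ t, t ∉ breakpoints d →
      HasDerivAt F (g t * ∑ c, A k c * deriv (fun t => axisPath d t c) t) t) (t : ℝ) :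
    ∫ s in (0 : ℝ)..t, g s * deriv (fun t => A.mulVec (axisPath d t) k) s = F t := by
  rw [integral_eq_of_hasDerivAt_off_countable F _ (countable_breakpoints hd) hF.continuousOn
    (fun s hs => ?_) ((intervalIntegrable_deriv_mulVec_axisPath hd A k 0 t).continuousOn_mul
      hg.continuousOn), hF0, sub_zero]
  rw [(hasDerivAt_mulVec_axisPath A hs.2 k).deriv]
  exact h s hs.2

/-- Explicit primitives at each level, expanded multilinearly in `A`, are continuous and have the
right derivative off countably many times, so the three integrals are evaluated from the inside out.
-/
theorem congruence_coreTensor_eq_signature (hd : d ≠ 0) (A : Matrix (Fin d) (Fin d) ℝ) :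
    congruence A (coreTensor d) = signature fun t => A.mulVec (axisPath d t) := by
  have first : ∀ i t, ∫ s in (0 : ℝ)..t, deriv (fun t => A.mulVec (axisPath d t) i) s =
      A.mulVec (axisPath d t) i := fun i t => by
    simpa using integral_mul_deriv_axisPath hd A i (continuous_mulVec_axisPath A i)
      (by simp [mulVec, dotProduct, axisPath_zero]) (continuous_const (y := (1 : ℝ)))
      (fun s hs => by simpa using hasDerivAt_mulVec_axisPath A hs i) t
  let F : Fin d → Fin d → ℝ → ℝ := fun i j t =>
    ∑ a, ∑ b, A i a * A j b * areaPoly a b (axisPath d t b)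
  have hFc : ∀ i j, Continuous (F i j) := fun i j =>
    continuous_finsetSum _ fun a _ => continuous_finsetSum _ fun b _ =>
      continuous_const.mul ((continuous_areaPoly a b).comp (continuous_axisPath b))
  have second : ∀ i j t, ∫ s in (0 : ℝ)..t, A.mulVec (axisPath d s) i *
      deriv (fun t => A.mulVec (axisPath d t) j) s = F i j t := fun i j t => by
    refine integral_mul_deriv_axisPath hd A j (hFc i j)
      (by simp [F, axisPath_zero, areaPoly_zero]) (continuous_mulVec_axisPath A i) (fun s hs => ?_) t
    refine (HasDerivAt.fun_sum fun a _ => HasDerivAt.fun_sum fun b _ =>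
      (hasDerivAt_areaPoly hs a b).const_mul (A i a * A j b)).congr_deriv ?_
    simp only [mulVec, dotProduct, Finset.sum_mul_sum]
    exact Finset.sum_congr rfl fun a _ => Finset.sum_congr rfl fun b _ => by ring
  let E : Fin d → Fin d → Fin d → ℝ → ℝ := fun i j k t =>
    ∑ a, ∑ b, ∑ c, A i a * A j b * A k c * volumePoly a b c (axisPath d t c)
  have third : ∀ i j k t, ∫ s in (0 : ℝ)..t, F i j s *
      deriv (fun t => A.mulVec (axisPath d t) k) s = E i j k t := fun i j k t => by
    refine integral_mul_deriv_axisPath hd A k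
      (continuous_finsetSum _ fun a _ => continuous_finsetSum _ fun b _ =>
        continuous_finsetSum _ fun c _ =>
          continuous_const.mul ((continuous_volumePoly a b c).comp (continuous_axisPath c)))
      (by simp [axisPath_zero, volumePoly_zero]) (hFc i j) (fun s hs => ?_) t
    refine (HasDerivAt.fun_sum fun a _ => HasDerivAt.fun_sum fun b _ => HasDerivAt.fun_sum fun c _ =>
      (hasDerivAt_volumePoly hs a b c).const_mul (A i a * A j b * A k c)).congr_deriv ?_
    simp only [F, Finset.sum_mul]
    simp only [Finset.mul_sum]
    exact Finset.sum_congr rfl fun a _ => Finset.sum_congr rfl fun b _ =>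
      Finset.sum_congr rfl fun c _ => by ring
  funext i j k
  simp only [signature, intervalIntegral.integral_mul_const, first, second, third]
  simp only [E, axisPath_one, volumePoly_end, congruence]
  exact Finset.sum_congr rfl fun a _ => Finset.sum_congr rfl fun b _ =>
    Finset.sum_congr rfl fun c _ => by ring

end Signature
end SigLearn

/-! ### Assembly of the main theorem -/

theorem theorem1p1 :
    ∃ K : ℝ≥0, ∀ (d : ℕ) (hd : 2 ≤ d) (ν : Measure ℝ) [IsProbabilityMeasure ν] [NullSingletonClass ν]
      (G : SigLearn.Tensor d ℝ), G ∈ SigLearn.coreOrbit d →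
      -- every finished run returns the unique `A ∈ GL_d` with `G = A * C`, and thus the path
      (∀ N : ℕ, (SigLearn.tensorLearning N hd G).Always (fun A =>
        IsUnit A ∧ G = SigLearn.congruence A (SigLearn.coreTensor d) ∧
        (∀ A' : Matrix (Fin d) (Fin d) ℝ,
          IsUnit A' → G = SigLearn.congruence A' (SigLearn.coreTensor d) → A' = A) ∧
        G = SigLearn.signature (fun t => A.mulVec (SigLearn.axisPath d t)))) ∧
      -- the algorithm halts with probability one
      Tendsto (fun N : ℕ => (SigLearn.tensorLearning N hd G).haltProb ν) atTop (𝓝 1) ∧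
      -- the expected number of elementary operations
      (∀ N : ℕ, (SigLearn.tensorLearning N hd G).expectedCost ν ≤ (K : ℝ≥0∞) * (d : ℝ≥0∞) ^ 4) := by
  refine ⟨2300, fun d hd ν _ _ G hG => ?_⟩
  obtain ⟨⟨A, A', h, h'⟩, rfl⟩ := hG
  have hA : IsUnit A := ⟨⟨A, A', h, h'⟩, rfl⟩
  change (∀ N, (SigLearn.tensorLearning N hd (SigLearn.congruence A _)).Always _) ∧
    Tendsto (fun N : ℕ => (SigLearn.tensorLearning N hd (SigLearn.congruence A _)).haltProb ν) _ _ ∧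
    ∀ N : ℕ, (SigLearn.tensorLearning N hd (SigLearn.congruence A _)).expectedCost ν ≤ _
  refine ⟨fun N => ?_, ?_, fun N => ?_⟩
  -- The input is the same tensor for every invertible `B` with `B * C = A * C`, so correctness
  -- applied to each such `B` shows that a finished run returns all of them; hence they coincide.
  · refine (SigLearn.Prog.Always.forall (P := fun (B : {B : Matrix (Fin d) (Fin d) ℝ // IsUnit B ∧
      SigLearn.congruence A (SigLearn.coreTensor d) =
        SigLearn.congruence B (SigLearn.coreTensor d)}) r => r = B.1) fun B => ?_).imp fun r hr => ?_
    · obtain ⟨B, hB, hAB⟩ := B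
      change SigLearn.Prog.Always (· = B) _
      rw [hAB]
      exact (SigLearn.spec_tensorLearning hd (SigLearn.always_loop hB N)).always
    · obtain rfl := hr ⟨A, hA, rfl⟩
      exact ⟨hA, rfl, fun B hB hGB => (hr ⟨B, hB, hGB⟩).symm,
        SigLearn.congruence_coreTensor_eq_signature (by omega) r⟩
  · refine tendsto_const_nhds.congr' ?_
    -- From budget two on the halting probability is exactly 1, so the limit is that of an
    -- eventually constant sequence.
    filter_upwards [eventually_ge_atTop 2] with N hN
    exact (SigLearn.spec_tensorLearning hd (SigLearn.spec_loop (ab := False) hd hA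
      (fun h => by omega))).haltProb_eq_one.symm
  -- Permitting cut-offs covers the small budgets too; the constant is `2200 + 100`.
  · refine (SigLearn.spec_tensorLearning hd (SigLearn.spec_loop (ν := ν) (ab := True) hd hA
      (N := N) fun _ => trivial)).expectedCost_le.trans (le_of_eq ?_)
    rw [← Nat.cast_add, ← add_mul, ENat.toENNReal_coe]
    norm_cast
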